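/- Notation. Let $n\ge 1$. Cubes $Q\subset\mathbb R^n$ have sides parallel to the axes, and a weight is a locally integrable function that is positive a.e.; $w(E)=\int_E w$. For weights $u,v$ put $M_uv(x)=\sup_{Q\ni x}\frac1{u(Q)}\int_Q |v|u$, $M=M_1$, $$[v]_{A_p(u)}=\sup_Q \frac1{u(Q)}\int_Q vu\Big(\frac1{u(Q)}\int_Q v^{-\frac1{p-1}}u\Big)^{p-1}\ (1<p<\infty),\qquad [v]_{A_1(u)}=\Big\|\frac{M_uv}{v}\Big\|_\infty,$$ $$[w]_{A_1}=[w]_{A_1(1)},\qquad [w]_{A_\infty}=\sup_Q\frac1{w(Q)}\int_Q M(\chi_Qw),\qquad [w]_{RH_s}=\sup_Q\frac{\big(\frac1{|Q|}\int_Q w^s\big)^{1/s}}{\frac1{|Q|}w(Q)}\ (s\ge1),$$ and write $v\in A_p(u)$, $w\in A_1$, $w\in RH_s$ when the corresponding constant is finite. A Young function is a convex nondecreasing $A:[0,\infty)\to[0,\infty)$ with $A(0)=0$ and $A(t)\to\infty$ as $t\to\infty$; $A\in B_\rho$ means $\int_1^\infty \frac{A(t)}{t^\rho}\frac{dt}t<\infty$;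 $\|g\|_{A,Q}=\inf\{t>0:\frac1{|Q|}\int_QA(|g|/t)\le1\}$, and $\|f\|_{1,Q}=\frac1{|Q|}\int_Q|f|$. A dyadic grid is a family of cubes with side lengths $\rho2^k$, $k\in\mathbb Z$ ($\rho>0$ fixed), such that the cubes of each generation partition $\mathbb R^n$ and any two cubes that meet are nested. A family $\mathcal S$ of cubes is $\eta$-sparse if there are pairwise disjoint measurable $E_Q\subset Q$, $Q\in\mathcal S$, with $|E_Q|\ge\eta|Q|$. Let $T$ be an operator, defined on a class $\mathcal D$ of functions on $\mathbb R^n$, with measurable real values. We say that $T$ satisfies the bilinear sparse bound for $A$ with constants $c_T>0$ and $\eta\in(0,1]$ if for all $f\in\mathcal D$ and all bounded compactly supported measurable $g$ with $T(f)g$ integrable there are $\eta$-sparse subfamilies $\mathcal S_1,\dots,\mathcal S_{3^n}$ of dyadic grids such that $$\int T(f)g\le c_T\sum_{j=1}^{3^n}\sum_{Q\in\mathcal S_j}\|f\|_{1,Q}\|g\|_{A,Q}|Q|.$$ **Theorem.** There is $\tau>0$, depending only on $n$, such that the following holds. Let $1\le p,r<\infty$ and $q=2r-1$. Let $A$ be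 a Young function with $A\in B_\rho$ for all $\rho>r$, and let $T$ satisfy the bilinear sparse bound for $A$ with constants $c_T$, $\eta$. Let $u\in A_1\cap RH_q$ and $v\in A_p(u)$ be weights. Then $[u^r]_{A_\infty}<\infty$, $[uv]_{A_\infty}<\infty$, and for all $\lambda>0$ and all measurable $f$ with $fv\in\mathcal D$, $$uv\Big(\Big\{x\in\mathbb R^n:\frac{T(fv)(x)}{v(x)}>\lambda\Big\}\Big)\le C\,C_{u,v}\int_{\mathbb R^n}\frac{|f(x)|}\lambda u(x)v(x)\,dx,\tag{1}$$ $$C_{u,v}=K\log\big(e+K[v]_{A_p(u)}\big),\qquad K=\kappa_u[u]_{RH_q}^{1+\frac q{4r}}[u]_{A_1}[uv]_{A_\infty},$$ $$\kappa_u=\Big(\sup_{t\ge1}\frac{A(t)}{t^{r(1+\varepsilon)}}\Big)^{1/r}<\infty,\qquad \varepsilon=\frac1{2\tau[u^r]_{A_\infty}},$$ where $C$ depends only on $n,p,r,A,c_T,\eta$. If $A(t)=t^r(1+\log^+t)^\gamma$ with $\gamma\ge0$, then (1) also holds with $\kappa_u=[u^r]_{A_\infty}^{\gamma/r}$ and $C$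 depending only on $n,p,r,\gamma,c_T,\eta$; moreover $[u^r]_{A_\infty}^{\gamma/r}\le C'[u]_{RH_q}^{\gamma/r}[u]_{A_1}^{\gamma/r}$ with $C'$ depending only on $n,r,\gamma$. -/

import Mathlib

open MeasureTheory Set Filter
open scoped ENNReal

namespace MixedWeak

noncomputable section

/-- Half-open axis-parallel cubes of positive side length. The space is `Fin n → ℝ` with Lebesgue
measure; its norm plays no role below. -/
@[ext]
structure Cube (n : ℕ) where
  corner : Fin n → ℝ
  side : ℝ
  side_pos : 0 < side

/-- The points of a cube. -/
def Cube.toSet {n : ℕ} (Q : Cube n) : Set (Fin n → ℝ) :=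
  {x | ∀ i, Q.corner i ≤ x i ∧ x i < Q.corner i + Q.side}

/-- A dyadic grid: the side lengths are `ρ 2 ^ k` for `k ∈ ℤ` (with `ρ > 0` fixed), the cubes of each
generation partition the space, and two cubes that meet are nested. -/
def IsDyadicGrid {n : ℕ} (D : Set (Cube n)) : Prop :=
  ∃ ρ : ℝ, 0 < ρ ∧
    (∀ Q ∈ D, ∃ k : ℤ, Q.side = ρ * (2 : ℝ) ^ k) ∧
    (∀ (k : ℤ) (x : Fin n → ℝ), ∃! Q : Cube n, Q ∈ D ∧ Q.side = ρ * (2 : ℝ) ^ k ∧ x ∈ Q.toSet) ∧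
    (∀ P ∈ D, ∀ Q ∈ D, (P.toSet ∩ Q.toSet).Nonempty →
      P.toSet ⊆ Q.toSet ∨ Q.toSet ⊆ P.toSet)

/-- `η`-sparse families: there are pairwise disjoint measurable `E Q ⊆ Q` with `|E Q| ≥ η |Q|`. -/
def IsSparse {n : ℕ} (η : ℝ) (S : Set (Cube n)) : Prop :=
  ∃ E : Cube n → Set (Fin n → ℝ),
    (∀ Q ∈ S, MeasurableSet (E Q) ∧ E Q ⊆ Q.toSet ∧
      ENNReal.ofReal η * volume Q.toSet ≤ volume (E Q)) ∧
    S.PairwiseDisjoint E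

/-- Weights: locally integrable and positive almost everywhere. -/
def IsWeight {n : ℕ} (w : (Fin n → ℝ) → ℝ) : Prop :=
  LocallyIntegrable w volume ∧ ∀ᵐ x ∂volume, 0 < w x

/-- The average `(1 / u(Q)) ∫_Q |h| u`. -/
def wavg {n : ℕ} (u h : (Fin n → ℝ) → ℝ) (Q : Cube n) : ℝ≥0∞ :=
  (∫⁻ x in Q.toSet, ENNReal.ofReal (|h x| * u x)) / ∫⁻ x in Q.toSet, ENNReal.ofReal (u x)

/-- The maximal function `M_u h (x) = sup_{Q ∋ x} (1 / u(Q)) ∫_Q |h| u`, the supremum being over all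
cubes that contain `x`. For `u = 1` it is the Hardy-Littlewood maximal function. -/
def maximal {n : ℕ} (u h : (Fin n → ℝ) → ℝ) (x : Fin n → ℝ) : ℝ≥0∞ :=
  ⨆ (Q : Cube n) (_ : x ∈ Q.toSet), wavg u h Q

/-- The constant `[v]_{A_p(u)}`, for `1 ≤ p < ∞`. -/
def apConst {n : ℕ} (p : ℝ) (u v : (Fin n → ℝ) → ℝ) : ℝ≥0∞ :=
  if p = 1 then essSup (fun x => maximal u v x / ENNReal.ofReal (v x)) volume
  else ⨆ Q : Cube n, wavg u v Q * wavg u (fun x => v x ^ (-(1 / (p - 1)))) Q ^ (p - 1)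

/-- The constant `[w]_{A_1}`. -/
def a1Const {n : ℕ} (w : (Fin n → ℝ) → ℝ) : ℝ≥0∞ := apConst 1 (fun _ => 1) w

/-- The constant `[w]_{A_∞} = sup_Q (1 / w(Q)) ∫_Q M(χ_Q w)`. -/
def ainfConst {n : ℕ} (w : (Fin n → ℝ) → ℝ) : ℝ≥0∞ :=
  ⨆ Q : Cube n, (∫⁻ x in Q.toSet, maximal (fun _ => 1) (Q.toSet.indicator w) x) /
    ∫⁻ x in Q.toSet, ENNReal.ofReal (w x)

/-- The reverse Hölder constant `[w]_{RH_s}`. It equals `1` for every weight if `s = 1`. -/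
def rhConst {n : ℕ} (s : ℝ) (w : (Fin n → ℝ) → ℝ) : ℝ≥0∞ :=
  ⨆ Q : Cube n, wavg (fun _ => 1) (fun x => w x ^ s) Q ^ (1 / s) / wavg (fun _ => 1) w Q

/-- Young functions; only the values on `[0, ∞)` matter. -/
def IsYoung (A : ℝ → ℝ) : Prop :=
  ConvexOn ℝ (Ici 0) A ∧ MonotoneOn A (Ici 0) ∧ A 0 = 0 ∧ Tendsto A atTop atTop

/-- The condition `A ∈ B_ρ`: the integral `∫_1^∞ A(t) t^{-ρ} dt / t` is finite. -/
def MemB (ρ : ℝ) (A : ℝ → ℝ) : Prop :=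
  IntegrableOn (fun t : ℝ => A t / t ^ ρ / t) (Ioi 1) volume

/-- The Luxemburg average `‖g‖_{A,Q}`. -/
def luxNorm {n : ℕ} (A : ℝ → ℝ) (Q : Cube n) (g : (Fin n → ℝ) → ℝ) : ℝ≥0∞ :=
  sInf {l : ℝ≥0∞ | ∃ t : ℝ, 0 < t ∧ l = ENNReal.ofReal t ∧
    (∫⁻ x in Q.toSet, ENNReal.ofReal (A (|g x| / t))) / volume Q.toSet ≤ 1}

/-- The bilinear sparse bound
`∫ T(f) g ≤ c ∑_{j ≤ 3^n} ∑_{Q ∈ S_j} ‖f‖_{1,Q} ‖g‖_{A,Q} |Q|`, with `S_j` an `η`-sparse subfamily of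
a dyadic grid, for all `f` in the domain `dom` of the operator and all bounded compactly supported
`g` for which the left side is an absolutely convergent integral. The grids and the sparse families
may depend on `f` and `g`, but `c` and `η` do not. -/
def SparseBound {n : ℕ} (A : ℝ → ℝ) (c η : ℝ) (dom : Set ((Fin n → ℝ) → ℝ))
    (T : ((Fin n → ℝ) → ℝ) → ((Fin n → ℝ) → ℝ)) : Prop :=
  ∀ f ∈ dom, AEMeasurable (T f) volume ∧
    ∀ g : (Fin n → ℝ) → ℝ, Measurable g → (∃ b : ℝ, ∀ x, |g x| ≤ b) → HasCompactSupport g →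
      Integrable (fun x => T f x * g x) volume →
      ∃ D S : Fin (3 ^ n) → Set (Cube n),
        (∀ j, IsDyadicGrid (D j) ∧ S j ⊆ D j ∧ IsSparse η (S j)) ∧
        ENNReal.ofReal (∫ x, T f x * g x) ≤
          ENNReal.ofReal c * ∑ j, ∑' Q : S j,
            wavg (fun _ => 1) f Q.1 * luxNorm A Q.1 g * volume Q.1.toSet

/-- The growth constant `sup_{t ≥ 1} A(t) / t ^ s`. -/
def growth (A : ℝ → ℝ) (s : ℝ) : ℝ≥0∞ :=
  ⨆ (t : ℝ) (_ : 1 ≤ t), ENNReal.ofReal (A t / t ^ s)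

/-- The exponent `r (1 + ε)` with `ε = 1 / (2 τ [u^r]_{A_∞})`. -/
def expo {n : ℕ} (τ r : ℝ) (u : (Fin n → ℝ) → ℝ) : ℝ :=
  r * (1 + 1 / (2 * τ * (ainfConst (fun x => u x ^ r)).toReal))

/-- The constant `κ_u = (sup_{t ≥ 1} A(t) / t ^ {r (1 + ε)}) ^ {1/r}`, where
`ε = 1 / (2 τ [u^r]_{A_∞})`. -/
def kappa {n : ℕ} (τ r : ℝ) (A : ℝ → ℝ) (u : (Fin n → ℝ) → ℝ) : ℝ :=
  (growth A (expo τ r u)).toReal ^ (1 / r)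

/-- The constant `K log(e + K [v]_{A_p(u)})` with
`K = κ [u]_{RH_q}^{1 + q/(4r)} [u]_{A_1} [uv]_{A_∞}` and `q = 2r - 1`. -/
def mixedConst {n : ℕ} (p r κ : ℝ) (u v : (Fin n → ℝ) → ℝ) : ℝ :=
  let K : ℝ := κ * (rhConst (2 * r - 1) u).toReal ^ (1 + (2 * r - 1) / (4 * r)) *
    (a1Const u).toReal * (ainfConst (fun x => u x * v x)).toReal
  K * Real.log (Real.exp 1 + K * (apConst p u v).toReal)

/-- The mixed weak type estimate with constant `C`: for every `f` such that `f v` is in the domain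
of `T`, and every `λ > 0`,
`uv {x : T(f v)(x) / v(x) > λ} ≤ C ∫ (|f| / λ) u v`. -/
def MixedWeakType {n : ℕ} (C : ℝ) (dom : Set ((Fin n → ℝ) → ℝ))
    (T : ((Fin n → ℝ) → ℝ) → ((Fin n → ℝ) → ℝ)) (u v : (Fin n → ℝ) → ℝ) : Prop :=
  ∀ f : (Fin n → ℝ) → ℝ, AEMeasurable f volume → (fun x => f x * v x) ∈ dom →
    ∀ l : ℝ, 0 < l →
      (volume.withDensity fun x => ENNReal.ofReal (u x * v x))
          {x | l < T (fun y => f y * v y) x / v x} ≤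
        ENNReal.ofReal C * ∫⁻ x, ENNReal.ofReal (|f x| / l * (u x * v x))

/-- The function `t ^ r (1 + log⁺ t) ^ γ`. -/
def powLog (r γ t : ℝ) : ℝ := t ^ r * (1 + Real.posLog t) ^ γ

end

end MixedWeak

open MixedWeak

/-! Write `U` for $u$, `Y` for $uv$, `H` for $|fv|$, and let $a,h,V,M$ be the $A_1$, $RH_q$,
$A_p(u)$ constants and $[uv]_{A_\infty}$. The aim is $Y\{T(fv)>\lambda v\}\le \frac C\lambda\int
HU$.

The measure $Y$ is doubling on cubes, with constant $L=V(6^na)^p$ for the sixfold dilate. By a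
Vitali covering, the cubes with $\int_QHU>\lambda L\,Y(Q)$ have union of $Y$-measure at most
$\lambda^{-1}\int HU$, so they may be discarded. On a bounded piece $G$ of the rest, the sparse
bound is tested with $g=u\chi_G$; this gives $\lambda Y(G)\le\int T(fv)g$ on the left and a sparse
sum on the right.

A single term is controlled by the density $\alpha_Q=u(Q\cap G)/u(Q)$. Hölder with $RH_{2r-1}$ for
$u$, and the sharp reverse Hölder inequality for $u^r$ with gain $\delta\sim1/[u^r]_{A_\infty}$,
give $\|u\chi_G\|_{A,Q}\lesssim\kappa h\,\alpha_Q^\theta\,u(Q)/|Q|$; the $A_1$ condition then turns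
the term into $\kappa ha\,\alpha_Q^\theta\int_QHU$ (`sparse_term_le`).

To sum these terms, note that a sparse family is Carleson for $Y$ with constant $M/\eta$, so cubes
selected by a lower bound on $\int_QHU/Y(Q)$ satisfy a weak-type packing estimate
(`sum_mul_le_of_carleson`). By the $A_p(u)$ condition, $\alpha_Q^pY(Q)\le V\,Y(Q\cap G)$, so these
numbers pack as well. Comparing $\int_QHU$ with $c\,\alpha_Q^pY(Q)$ and $cY(Q)$ splits the sum in
three (`sum_mul_rpow_le_of_packing`): the lowest range is absorbed by $\lambda Y(G)$ if $c$ is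
small, the middle one is a geometric series, and the top one consists of about $\log_2(\lambda L/c)$
dyadic levels. These levels produce the logarithm in $C_{u,v}$.

The reverse Hölder inequality comes from a stopping-time argument (`lintegral_rpow_le_of_decay`).
Its converse `lintegral_hlMax_le` gives the finiteness of $[uv]_{A_\infty}$ and, for $r>1$, the
estimate of $[u^r]_{A_\infty}$. -/

namespace MixedWeak

section

/-! ### Cubes -/

variable {n : ℕ}

theorem Cube.toSet_eq_pi (Q : Cube n) :
    Q.toSet = Set.pi univ fun i => Ico (Q.corner i) (Q.corner i + Q.side) := by
  ext x; simp [Cube.toSet, Set.mem_pi]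

theorem Cube.measurableSet (Q : Cube n) : MeasurableSet Q.toSet := by
  rw [Q.toSet_eq_pi]
  exact MeasurableSet.univ_pi fun i => measurableSet_Ico

theorem Cube.volume_toSet (Q : Cube n) : volume Q.toSet = ENNReal.ofReal Q.side ^ n := by
  rw [Q.toSet_eq_pi, Real.volume_pi_Ico]
  simp

theorem Cube.volume_pos (Q : Cube n) : volume Q.toSet ≠ 0 := by
  rw [Q.volume_toSet]
  exact pow_ne_zero _ (by simpa using Q.side_pos)

theorem Cube.volume_ne_top (Q : Cube n) : volume Q.toSet ≠ ⊤ := by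
  rw [Q.volume_toSet]
  exact ENNReal.pow_ne_top ENNReal.ofReal_ne_top

theorem Cube.corner_mem (Q : Cube n) : Q.corner ∈ Q.toSet := fun i => ⟨le_rfl, by
  linarith [Q.side_pos]⟩

/-- The centre of a cube. -/
noncomputable def Cube.center (Q : Cube n) : Fin n → ℝ := fun i => Q.corner i + Q.side / 2

/-- The concentric cube with six times the side length. -/
noncomputable def Cube.dilate (Q : Cube n) : Cube n where
  corner := fun i => Q.corner i - 5 / 2 * Q.side
  side := 6 * Q.side
  side_pos := by linarith [Q.side_pos]

theorem Cube.mem_closedBall_center {Q : Cube n} {x : Fin n → ℝ} {r : ℝ} (hr : 0 ≤ r) :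
    x ∈ Metric.closedBall Q.center r ↔
      ∀ i, Q.corner i + Q.side / 2 - r ≤ x i ∧ x i ≤ Q.corner i + Q.side / 2 + r := by
  rw [Metric.mem_closedBall, dist_pi_le_iff hr]
  refine forall_congr' fun i => ?_
  rw [Real.dist_eq, abs_le, Cube.center]
  constructor <;> rintro ⟨h1, h2⟩ <;> constructor <;> linarith

theorem Cube.subset_closedBall (Q : Cube n) :
    Q.toSet ⊆ Metric.closedBall Q.center (Q.side / 2) := by
  intro x hx
  have hs := Q.side_pos
  rw [Cube.mem_closedBall_center (by linarith)]
  intro i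
  have := hx i
  constructor <;> linarith

/-- The Vitali enlargement factor is 5; the factor 6 in `dilate` leaves room for the missing
right-hand faces of a half-open cube. -/
theorem Cube.closedBall_subset_dilate (Q : Cube n) :
    Metric.closedBall Q.center (5 * (Q.side / 2)) ⊆ Q.dilate.toSet := by
  intro x hx i
  have hs := Q.side_pos
  rw [Cube.mem_closedBall_center (by linarith)] at hx
  have := hx i
  simp only [Cube.dilate]
  constructor <;> linarith

theorem Cube.subset_dilate (Q : Cube n) : Q.toSet ⊆ Q.dilate.toSet := by
  refine Q.subset_closedBall.trans (subset_trans ?_ Q.closedBall_subset_dilate)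
  exact Metric.closedBall_subset_closedBall (by linarith [Q.side_pos])

theorem Cube.volume_dilate (Q : Cube n) :
    volume Q.dilate.toSet = 6 ^ n * volume Q.toSet := by
  rw [Cube.volume_toSet, Cube.volume_toSet, ← mul_pow]
  congr 1
  rw [Cube.dilate, ENNReal.ofReal_mul (by norm_num)]
  norm_num

/-- This transfers Lebesgue differentiation from balls of the sup norm to half-open cubes. -/
theorem Cube.ae_eq_closedBall (Q : Cube n) :
    Q.toSet =ᵐ[volume] Metric.closedBall Q.center (Q.side / 2) := by
  have hs := Q.side_pos
  have h : Metric.closedBall Q.center (Q.side / 2) =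
      Icc Q.corner (fun i => Q.corner i + Q.side) := by
    ext x
    rw [Cube.mem_closedBall_center (by linarith), mem_Icc, Pi.le_def, Pi.le_def, ← forall_and]
    refine forall_congr' fun i => ?_
    constructor <;> rintro ⟨h1, h2⟩ <;> constructor <;> linarith
  rw [h, Q.toSet_eq_pi]
  exact Measure.univ_pi_Ico_ae_eq_Icc

/-- Vitali covering argument for a measure that is doubling on cubes. -/
theorem measure_iUnion_le_of_doubling (ν φ : Measure (Fin n → ℝ)) (d : ℝ≥0∞)
    (hd : ∀ Q : Cube n, ν Q.dilate.toSet ≤ d * ν Q.toSet) (F : Set (Cube n))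
    (hF : ∀ Q ∈ F, ν Q.toSet ≤ φ Q.toSet) :
    ν (⋃ Q ∈ F, Q.toSet) ≤ d * φ univ := by
  -- The covering lemma needs bounded radii, so the family is exhausted by its cubes of side at most
  -- `R`. Disjoint closed balls with nonempty interior form a countable family, although `F` need
  -- not be countable.
  have key : ∀ R : ℕ, ν (⋃ Q ∈ {Q ∈ F | Q.side ≤ R}, Q.toSet) ≤ d * φ univ := by
    intro R
    obtain ⟨t, ht, hdis, hcov⟩ := Vitali.exists_disjoint_subfamily_covering_enlargement_closedBall
      {Q ∈ F | Q.side ≤ R} Cube.center (fun Q : Cube n => Q.side / 2) R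
      (fun Q hQ => by have := hQ.2; have := Q.side_pos; linarith) 5 (by norm_num)
    have hcount : t.Countable := by
      refine hdis.countable_of_nonempty_interior fun Q _ => ?_
      refine ⟨Q.center, ?_⟩
      refine interior_mono Metric.ball_subset_closedBall ?_
      rw [Metric.isOpen_ball.interior_eq]
      exact Metric.mem_ball_self (by linarith [Q.side_pos])
    have hdis' : t.PairwiseDisjoint Cube.toSet :=
      hdis.mono fun Q => Q.subset_closedBall
    calc ν (⋃ Q ∈ {Q ∈ F | Q.side ≤ R}, Q.toSet)
        ≤ ν (⋃ Q ∈ t, Q.dilate.toSet) := by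
          refine measure_mono (iUnion₂_subset fun Q hQ => ?_)
          obtain ⟨P, hP, hQP⟩ := hcov Q hQ
          refine subset_trans (Q.subset_closedBall.trans (hQP.trans P.closedBall_subset_dilate)) ?_
          exact subset_iUnion₂ (s := fun (P : Cube n) (_ : P ∈ t) => P.dilate.toSet) P hP
      _ ≤ ∑' Q : t, ν Q.1.dilate.toSet := measure_biUnion_le ν hcount _
      _ ≤ ∑' Q : t, d * φ Q.1.toSet := ENNReal.tsum_le_tsum fun Q =>
          (hd Q).trans (mul_le_mul_right (hF Q (ht Q.2).1) d)
      _ = d * φ (⋃ Q ∈ t, Q.toSet) := by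
          rw [ENNReal.tsum_mul_left, measure_biUnion hcount hdis' fun Q _ => Q.measurableSet]
      _ ≤ d * φ univ := mul_le_mul_right (measure_mono (subset_univ _)) d
  have hU : (⋃ Q ∈ F, Q.toSet) = ⋃ R : ℕ, ⋃ Q ∈ {Q ∈ F | Q.side ≤ R}, Q.toSet := by
    ext x
    simp only [mem_iUnion, mem_ofPred_eq, exists_prop]
    constructor
    · rintro ⟨Q, hQ, hx⟩
      obtain ⟨R, hR⟩ := exists_nat_ge Q.side
      exact ⟨R, Q, ⟨hQ, hR⟩, hx⟩
    · rintro ⟨R, Q, ⟨hQ, -⟩, hx⟩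
      exact ⟨Q, hQ, hx⟩
  rw [hU, Monotone.measure_iUnion]
  · exact iSup_le key
  · intro R R' h
    refine iUnion₂_subset fun Q hQ => ?_
    exact subset_iUnion₂ (s := fun (P : Cube n) (_ : P ∈ {Q ∈ F | Q.side ≤ R'}) => P.toSet) Q
      ⟨hQ.1, hQ.2.trans (by exact_mod_cast h)⟩

/-- Jensen's inequality for powers on a set of finite measure. -/
theorem rpow_setLIntegral_le {α : Type*} [MeasurableSpace α] {μ : Measure α} (s : Set α)
    {w : α → ℝ≥0∞} (hw : AEMeasurable w (μ.restrict s)) {σ : ℝ} (hσ : 1 ≤ σ)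
    (h0 : μ s ≠ 0) (hs : μ s ≠ ⊤) :
    ((∫⁻ x in s, w x ∂μ) / μ s) ^ σ ≤ (∫⁻ x in s, w x ^ σ ∂μ) / μ s := by
  have hσ0 : 0 < σ := by linarith
  have h := ENNReal.lintegral_mul_norm_pow_le (μ := μ.restrict s) (hw.pow_const σ)
    (aemeasurable_const (b := (1 : ℝ≥0∞))) (p := 1 / σ) (q := 1 - 1 / σ) (by positivity)
    (by rw [sub_nonneg, div_le_one hσ0]; exact hσ) (by ring)
  simp only [ENNReal.one_rpow, mul_one, lintegral_const, Measure.restrict_apply_univ,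
    one_mul] at h
  have h1 : ∀ x, (w x ^ σ) ^ (1 / σ) = w x := fun x => by
    rw [← ENNReal.rpow_mul, mul_one_div_cancel hσ0.ne', ENNReal.rpow_one]
  simp only [h1] at h
  calc ((∫⁻ x in s, w x ∂μ) / μ s) ^ σ
      ≤ (((∫⁻ x in s, w x ^ σ ∂μ) ^ (1 / σ) * μ s ^ (1 - 1 / σ)) / μ s) ^ σ := by gcongr
    _ = (∫⁻ x in s, w x ^ σ ∂μ) / μ s := by
        have : (((∫⁻ x in s, w x ^ σ ∂μ) ^ (1 / σ) * μ s ^ (1 - 1 / σ)) / μ s) =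
            ((∫⁻ x in s, w x ^ σ ∂μ) / μ s) ^ (1 / σ) := by
          rw [ENNReal.div_rpow_of_nonneg _ _ (by positivity), mul_div_assoc,
            ENNReal.rpow_sub _ _ h0 hs, ENNReal.rpow_one, div_eq_mul_inv,
            div_eq_mul_inv, div_eq_mul_inv]
          rw [show ∀ a b : ℝ≥0∞, a * (μ s * b * (μ s)⁻¹) = a * b * (μ s * (μ s)⁻¹) from
            fun a b => by ring, ENNReal.mul_inv_cancel h0 hs, mul_one, div_eq_mul_inv (b := μ s ^ _)]
        rw [this, ← ENNReal.rpow_mul, one_div_mul_cancel hσ0.ne', ENNReal.rpow_one]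

/-! ### Averages and the Hardy-Littlewood maximal function. -/

/-- The average of a nonnegative function over a cube. -/
noncomputable def avg (w : (Fin n → ℝ) → ℝ≥0∞) (Q : Cube n) : ℝ≥0∞ :=
  (∫⁻ x in Q.toSet, w x) / volume Q.toSet

/-- The Hardy-Littlewood maximal function of a nonnegative function. -/
noncomputable def hlMax (w : (Fin n → ℝ) → ℝ≥0∞) (x : Fin n → ℝ) : ℝ≥0∞ :=
  ⨆ (Q : Cube n) (_ : x ∈ Q.toSet), avg w Q

theorem avg_mul_volume (w : (Fin n → ℝ) → ℝ≥0∞) (Q : Cube n) :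
    avg w Q * volume Q.toSet = ∫⁻ x in Q.toSet, w x :=
  ENNReal.div_mul_cancel Q.volume_pos Q.volume_ne_top

theorem avg_rpow_le {w : (Fin n → ℝ) → ℝ≥0∞} (hw : AEMeasurable w) {σ : ℝ} (hσ : 1 ≤ σ)
    (Q : Cube n) : avg w Q ^ σ ≤ avg (fun x => w x ^ σ) Q :=
  rpow_setLIntegral_le Q.toSet hw.restrict hσ Q.volume_pos Q.volume_ne_top

/-- If the average of `w` over `Q` exceeds `t`, Jensen gives $|Q|\le t^{-\sigma}\int_Qw^\sigma$, and
the covering lemma applies with this right side as `φ`. The power `σ` gives decay in `t` beyond weak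
type $(1,1)$, which `lintegral_hlMax_le` needs. -/
theorem volume_lt_hlMax_le {w : (Fin n → ℝ) → ℝ≥0∞} (hw : AEMeasurable w) {σ : ℝ} (hσ : 1 ≤ σ)
    {t : ℝ≥0∞} (ht0 : t ≠ 0) (ht : t ≠ ⊤) :
    volume {x | t < hlMax w x} ≤ 6 ^ n * ((t ^ σ)⁻¹ * ∫⁻ x, w x ^ σ) := by
  have hσ0 : 0 < σ := by linarith
  have htσ0 : t ^ σ ≠ 0 := by simp [ENNReal.rpow_eq_zero_iff, ht0, ht]
  have htσ : t ^ σ ≠ ⊤ := ENNReal.rpow_ne_top_of_nonneg hσ0.le ht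
  let φ : Measure (Fin n → ℝ) := (t ^ σ)⁻¹ • volume.withDensity fun x => w x ^ σ
  have hφ : ∀ s, MeasurableSet s → φ s = (t ^ σ)⁻¹ * ∫⁻ x in s, w x ^ σ := fun s hs => by
    simp only [φ, Measure.smul_apply, smul_eq_mul, withDensity_apply _ hs]
  have h := measure_iUnion_le_of_doubling volume φ (6 ^ n) (fun Q => Q.volume_dilate.le)
    {Q | t < avg w Q} ?_
  · rw [hφ _ MeasurableSet.univ, Measure.restrict_univ] at h
    refine (measure_mono ?_).trans h
    intro x hx
    have hx' : t < ⨆ (Q : Cube n) (_ : x ∈ Q.toSet), avg w Q := hx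
    simp only [lt_iSup_iff] at hx'
    obtain ⟨Q, hxQ, hQ⟩ := hx'
    exact mem_iUnion₂.2 ⟨Q, hQ, hxQ⟩
  · intro Q hQ
    rw [hφ _ Q.measurableSet]
    have h1 : t ^ σ ≤ avg (fun x => w x ^ σ) Q :=
      (ENNReal.rpow_le_rpow (le_of_lt hQ) hσ0.le).trans (avg_rpow_le hw hσ Q)
    have h2 : t ^ σ * volume Q.toSet ≤ ∫⁻ x in Q.toSet, w x ^ σ := by
      rw [← avg_mul_volume]
      gcongr
    calc volume Q.toSet = (t ^ σ)⁻¹ * (t ^ σ * volume Q.toSet) := by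
          rw [← mul_assoc, ENNReal.inv_mul_cancel htσ0 htσ, one_mul]
      _ ≤ _ := by gcongr

/-- A layer-cake bound with dyadic levels: one term of the series already suffices. Allowing
supersets `U k` of the level sets makes room for measurable hulls, so `f` need not be measurable. -/
theorem le_add_tsum_indicator {α : Type*} (f : α → ℝ≥0∞) {m : ℝ≥0∞} (hm0 : m ≠ 0)
    {U : ℕ → Set α} (hU : ∀ k, {x | 2 ^ k * m < f x} ⊆ U k) (x : α) :
    f x ≤ m + ∑' k, (U k).indicator (fun _ => 2 ^ (k + 1) * m) x := by
  -- Since `f x` may be infinite, finite numbers below it are compared instead.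
  refine le_of_forall_lt fun c hc => ?_
  obtain ⟨c', hc', hc'f⟩ := exists_between hc
  refine hc'.trans_le ?_
  clear hc hc' c
  rename' c' => c, hc'f => hc
  have hc' : c ≠ ⊤ := (hc.trans_le le_top).ne
  have hex : ∃ k : ℕ, c ≤ 2 ^ k * m := by
    by_cases hm : m = ⊤
    · exact ⟨0, by simp [hm]⟩
    obtain ⟨N, hN⟩ := ENNReal.exists_nat_mul_gt hm0 hc'
    refine ⟨N, hN.le.trans ?_⟩
    gcongr
    exact_mod_cast (Nat.lt_two_pow_self (n := N)).le
  classical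
  obtain ⟨k, hk, hmin⟩ : ∃ k : ℕ, c ≤ 2 ^ k * m ∧ ∀ j < k, ¬ c ≤ 2 ^ j * m :=
    ⟨Nat.find hex, Nat.find_spec hex, fun j hj => Nat.find_min hex hj⟩
  rcases k with _ | k
  · refine le_trans ?_ le_self_add
    simpa using hk
  · refine le_trans ?_ le_add_self
    have hx : x ∈ U k := hU k ((not_le.1 (hmin k k.lt_succ_self)).trans hc)
    refine le_trans ?_ (ENNReal.le_tsum k)
    rwa [indicator_of_mem hx]

/-- The constant in `lintegral_hlMax_le`. -/
noncomputable def hlConst (n : ℕ) (σ : ℝ) : ℝ≥0∞ := 1 + 2 * 6 ^ n * (1 - 2 ^ (1 - σ))⁻¹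

theorem hlConst_ne_top (n : ℕ) {σ : ℝ} (hσ : 1 < σ) : hlConst n σ ≠ ⊤ := by
  have : (2 : ℝ≥0∞) ^ (1 - σ) < 1 :=
    ENNReal.rpow_lt_one_of_one_lt_of_neg (by norm_num) (by linarith)
  refine ENNReal.add_ne_top.2 ⟨by simp, ENNReal.mul_ne_top ?_ ?_⟩
  · exact ENNReal.mul_ne_top (by norm_num) (ENNReal.pow_ne_top (by norm_num))
  · exact ENNReal.inv_ne_top.2 (tsub_pos_of_lt this).ne'

/-- A reverse Hölder inequality on one cube bounds the local maximal function in $L^1$. By the weak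
type $(\sigma,\sigma)$ estimate, level $2^km$ contributes a geometric term of ratio $2^{1-\sigma}$.
The bound is linear in `B`; this makes the later estimate of $[u^r]_{A_\infty}$ linear in
$[u]_{RH_q}$. -/
theorem lintegral_hlMax_le {w : (Fin n → ℝ) → ℝ≥0∞} (hw : AEMeasurable w) {σ : ℝ} (hσ : 1 < σ)
    {Q : Cube n} (h0 : avg w Q ≠ 0) (ht : avg w Q ≠ ⊤) {B : ℝ≥0∞} (hB : 1 ≤ B)
    (h : avg (fun x => w x ^ σ) Q ≤ B * avg w Q ^ σ) :
    ∫⁻ x in Q.toSet, hlMax (Q.toSet.indicator w) x ≤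
      hlConst n σ * B * ∫⁻ x in Q.toSet, w x := by
  have hσ0 : 0 < σ := by linarith
  set m := avg w Q with hm
  set g := Q.toSet.indicator w with hg
  let U : ℕ → Set (Fin n → ℝ) := fun k => toMeasurable volume {x | 2 ^ k * m < hlMax g x}
  have hUm : ∀ k, MeasurableSet (U k) := fun k => measurableSet_toMeasurable _ _
  have hgσ : ∫⁻ x, g x ^ σ = ∫⁻ x in Q.toSet, w x ^ σ := by
    rw [← lintegral_indicator Q.measurableSet]
    refine lintegral_congr fun x => ?_
    by_cases hx : x ∈ Q.toSet
    · simp [hg, hx]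
    · simp [hg, hx, hσ0]
  have hUv : ∀ k, 2 ^ (k + 1) * m * volume (U k) ≤
      2 * 6 ^ n * B * (2 ^ (1 - σ)) ^ k * ∫⁻ x in Q.toSet, w x := by
    intro k
    have h2k0 : (2 : ℝ≥0∞) ^ k ≠ 0 := pow_ne_zero _ (by norm_num)
    have h2k : (2 : ℝ≥0∞) ^ k ≠ ⊤ := ENNReal.pow_ne_top (by norm_num)
    have h1 : volume (U k) ≤ 6 ^ n * (((2 ^ k * m) ^ σ)⁻¹ * (B * m ^ σ * volume Q.toSet)) := by
      rw [measure_toMeasurable]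
      refine (volume_lt_hlMax_le (hw.indicator Q.measurableSet) hσ.le
        (mul_ne_zero h2k0 h0) (ENNReal.mul_ne_top h2k ht)).trans ?_
      rw [hgσ, ← avg_mul_volume]
      gcongr
    have h2 : ((2 ^ k * m) ^ σ)⁻¹ * (B * m ^ σ * volume Q.toSet) =
        (2 ^ (-σ)) ^ k * (B * volume Q.toSet) := by
      rw [ENNReal.mul_rpow_of_nonneg _ _ hσ0.le, ENNReal.mul_inv (Or.inl (by
        simp [ENNReal.rpow_eq_zero_iff])) (Or.inl (ENNReal.rpow_ne_top_of_nonneg hσ0.le h2k))]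
      have h3 : (((2 : ℝ≥0∞) ^ k) ^ σ)⁻¹ = (2 ^ (-σ)) ^ k := by
        rw [← ENNReal.rpow_natCast, ← ENNReal.rpow_natCast, ← ENNReal.rpow_mul,
          ← ENNReal.rpow_mul, ← ENNReal.rpow_neg]
        ring_nf
      have h4 : (m ^ σ)⁻¹ * m ^ σ = 1 := ENNReal.inv_mul_cancel
        (by simp [ENNReal.rpow_eq_zero_iff, h0, ht]) (ENNReal.rpow_ne_top_of_nonneg hσ0.le ht)
      rw [h3]
      calc (2 ^ (-σ)) ^ k * (m ^ σ)⁻¹ * (B * m ^ σ * volume Q.toSet)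
          = ((m ^ σ)⁻¹ * m ^ σ) * ((2 ^ (-σ)) ^ k * (B * volume Q.toSet)) := by ring
        _ = _ := by rw [h4, one_mul]
    rw [h2] at h1
    have h5 : (2 : ℝ≥0∞) ^ (1 - σ) = 2 * 2 ^ (-σ) := by
      rw [sub_eq_add_neg, ENNReal.rpow_add _ _ (by norm_num) (by norm_num), ENNReal.rpow_one]
    calc 2 ^ (k + 1) * m * volume (U k)
        ≤ 2 ^ (k + 1) * m * (6 ^ n * ((2 ^ (-σ)) ^ k * (B * volume Q.toSet))) := by gcongr
      _ = 2 * 6 ^ n * B * (2 * 2 ^ (-σ)) ^ k * (m * volume Q.toSet) := by ring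
      _ = _ := by rw [h5, hm, avg_mul_volume]
  calc ∫⁻ x in Q.toSet, hlMax g x
      ≤ ∫⁻ x in Q.toSet, m + ∑' k, (U k).indicator (fun _ => 2 ^ (k + 1) * m) x :=
        lintegral_mono fun x => le_add_tsum_indicator _ h0 (fun k => subset_toMeasurable _ _) x
    _ = m * volume Q.toSet + ∑' k, ∫⁻ x in Q.toSet, (U k).indicator (fun _ => 2 ^ (k + 1) * m) x := by
        rw [lintegral_add_left measurable_const, lintegral_tsum fun k =>
          (measurable_const.indicator (hUm k)).aemeasurable]
        simp
    _ ≤ (∫⁻ x in Q.toSet, w x) +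
        ∑' k : ℕ, 2 * 6 ^ n * B * (2 ^ (1 - σ)) ^ k * ∫⁻ x in Q.toSet, w x := by
        rw [hm, avg_mul_volume]
        gcongr with k
        refine le_trans ?_ (hUv k)
        refine (setLIntegral_le_lintegral _ _).trans ?_
        rw [lintegral_indicator_const (hUm k)]
    _ = (1 + 2 * 6 ^ n * B * (1 - 2 ^ (1 - σ))⁻¹) * ∫⁻ x in Q.toSet, w x := by
        rw [ENNReal.tsum_mul_right, ENNReal.tsum_mul_left, ENNReal.tsum_geometric]
        ring
    _ ≤ hlConst n σ * B * ∫⁻ x in Q.toSet, w x := by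
        gcongr
        rw [hlConst, add_mul, one_mul]
        exact add_le_add hB (le_of_eq (by ring))

end

section

variable {n : ℕ}

/-! ### Dyadic subcubes and the Calderón-Zygmund decomposition -/

theorem Cube.side_le_of_subset (hn : 1 ≤ n) {P Q : Cube n} (h : P.toSet ⊆ Q.toSet) :
    (∀ i, Q.corner i ≤ P.corner i ∧ P.corner i + P.side ≤ Q.corner i + Q.side) ∧
      P.side ≤ Q.side := by
  have hs := P.side_pos
  have h1 : ∀ i, Q.corner i ≤ P.corner i := fun i => (h P.corner_mem i).1
  have h2 : ∀ i, P.corner i + P.side ≤ Q.corner i + Q.side := fun i => by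
    refine le_of_forall_pos_lt_add fun ε hε => ?_
    have hδ : 0 < min ε P.side := lt_min hε hs
    have hx : (fun j => P.corner j + P.side - min ε P.side) ∈ P.toSet := fun j =>
      ⟨by have := min_le_right ε P.side; linarith, by linarith⟩
    have := (h hx i).2
    have := min_le_left ε P.side
    linarith
  refine ⟨fun i => ⟨h1 i, h2 i⟩, ?_⟩
  have := h1 ⟨0, hn⟩
  have := h2 ⟨0, hn⟩
  linarith

/-- In dimension zero the point set does not determine the side, whence `hn` here and in the lemmas
on disjoint families. -/
theorem Cube.eq_of_subset_of_side_le (hn : 1 ≤ n) {P Q : Cube n} (h : P.toSet ⊆ Q.toSet)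
    (hs : Q.side ≤ P.side) : P = Q := by
  obtain ⟨h1, h2⟩ := Cube.side_le_of_subset hn h
  have h3 : P.side = Q.side := le_antisymm h2 hs
  refine Cube.ext (funext fun i => ?_) h3
  have := h1 i
  linarith [this.1, this.2]

/-- The cubes of the grid obtained by dividing the sides of `Q` into `2 ^ k` equal parts. -/
noncomputable def Cube.sub (Q : Cube n) (k : ℕ) (m : Fin n → ℤ) : Cube n where
  corner := fun i => Q.corner i + m i * (Q.side / 2 ^ k)
  side := Q.side / 2 ^ k
  side_pos := div_pos Q.side_pos (by positivity)

theorem Cube.mem_sub {Q : Cube n} {k : ℕ} {m : Fin n → ℤ} {x : Fin n → ℝ} :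
    x ∈ (Q.sub k m).toSet ↔
      ∀ i, (m i : ℝ) ≤ (x i - Q.corner i) / Q.side * 2 ^ k ∧
        (x i - Q.corner i) / Q.side * 2 ^ k < m i + 1 := by
  have hs := Q.side_pos
  refine forall_congr' fun i => ?_
  have h : (x i - Q.corner i) / Q.side * 2 ^ k = (x i - Q.corner i) / (Q.side / 2 ^ k) := by
    field_simp
  have hp : 0 < Q.side / 2 ^ k := div_pos hs (by positivity)
  rw [h, le_div_iff₀ hp, div_lt_iff₀ hp, Cube.sub]
  simp only
  constructor <;> rintro ⟨h1, h2⟩ <;> constructor <;> linarith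

theorem Cube.sub_subset_sub {Q : Cube n} {j k : ℕ} (hjk : j ≤ k) {m l : Fin n → ℤ}
    (h : ((Q.sub j m).toSet ∩ (Q.sub k l).toSet).Nonempty) :
    (Q.sub k l).toSet ⊆ (Q.sub j m).toSet := by
  obtain ⟨x, hx, hx'⟩ := h
  obtain ⟨d, rfl⟩ := Nat.exists_eq_add_of_le hjk
  rw [Cube.mem_sub] at hx hx'
  intro z hz
  rw [Cube.mem_sub] at hz ⊢
  intro i
  have hd : (0 : ℝ) < 2 ^ d := by positivity
  obtain ⟨a1, a2⟩ := hx i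
  obtain ⟨b1, b2⟩ := hx' i
  obtain ⟨c1, c2⟩ := hz i
  rw [pow_add, ← mul_assoc] at b1 b2 c1 c2
  set X := (x i - Q.corner i) / Q.side * 2 ^ j
  set Z := (z i - Q.corner i) / Q.side * 2 ^ j
  -- The strict inequalities are between integers, so they sharpen by one to $m2^d\le l$ and
  -- $l+1\le(m+1)2^d$: the finer cell lies in the coarser one.
  have e1 : m i * 2 ^ d < l i + 1 := by
    have : (m i : ℝ) * 2 ^ d < l i + 1 := lt_of_le_of_lt (by gcongr) b2
    exact_mod_cast this
  have e2 : l i < (m i + 1) * 2 ^ d := by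
    have : (l i : ℝ) < (m i + 1) * 2 ^ d := lt_of_le_of_lt b1 (by gcongr)
    exact_mod_cast this
  have e1' : (m i : ℝ) * 2 ^ d ≤ l i := by exact_mod_cast Int.lt_add_one_iff.1 e1
  have e2' : (l i : ℝ) + 1 ≤ (m i + 1) * 2 ^ d := by exact_mod_cast Int.add_one_le_iff.2 e2
  exact ⟨le_of_mul_le_mul_right (e1'.trans c1) hd, lt_of_mul_lt_mul_right (c2.trans_le e2') hd.le⟩

/-- The dyadic subcubes of `Q` of generation `k`. -/
def Cube.gen (Q : Cube n) (k : ℕ) : Set (Cube n) :=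
  {R | (∃ m, R = Q.sub k m) ∧ R.toSet ⊆ Q.toSet}

theorem Cube.gen_countable (Q : Cube n) (k : ℕ) : (Q.gen k).Countable :=
  (countable_range (Q.sub k)).mono fun _ hR => hR.1.imp fun _ hm => hm.symm

theorem Cube.side_of_mem_gen {Q R : Cube n} {k : ℕ} (h : R ∈ Q.gen k) :
    R.side = Q.side / 2 ^ k := by
  obtain ⟨⟨m, rfl⟩, -⟩ := h
  rfl

theorem Cube.gen_nested {Q P R : Cube n} {j k : ℕ} (hjk : j ≤ k) (hP : P ∈ Q.gen j)
    (hR : R ∈ Q.gen k) (h : (P.toSet ∩ R.toSet).Nonempty) : R.toSet ⊆ P.toSet := by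
  obtain ⟨⟨m, rfl⟩, -⟩ := hP
  obtain ⟨⟨l, rfl⟩, -⟩ := hR
  exact Cube.sub_subset_sub hjk h

theorem Cube.sub_zero_zero (Q : Cube n) : Q.sub 0 0 = Q := by
  ext <;> simp [Cube.sub]

theorem Cube.exists_mem_gen {Q : Cube n} (k : ℕ) {x : Fin n → ℝ} (hx : x ∈ Q.toSet) :
    ∃ R ∈ Q.gen k, x ∈ R.toSet := by
  have hx' : x ∈ (Q.sub k fun i => ⌊(x i - Q.corner i) / Q.side * 2 ^ k⌋).toSet :=
    Cube.mem_sub.2 fun i => ⟨Int.floor_le _, Int.lt_floor_add_one _⟩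
  refine ⟨_, ⟨⟨_, rfl⟩, ?_⟩, hx'⟩
  have h := Cube.sub_subset_sub (Q := Q) (Nat.zero_le k) (m := 0) (l := fun i =>
    ⌊(x i - Q.corner i) / Q.side * 2 ^ k⌋) ⟨x, by rwa [Q.sub_zero_zero], hx'⟩
  rwa [Q.sub_zero_zero] at h

theorem Cube.eq_of_mem_gen_zero (hn : 1 ≤ n) {Q R : Cube n} (h : R ∈ Q.gen 0) : R = Q :=
  Cube.eq_of_subset_of_side_le hn h.2 (by simp [Cube.side_of_mem_gen h])

theorem Cube.volume_of_mem_gen_succ {Q P R : Cube n} {k : ℕ} (hP : P ∈ Q.gen k)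
    (hR : R ∈ Q.gen (k + 1)) : volume P.toSet = 2 ^ n * volume R.toSet := by
  rw [Cube.volume_toSet, Cube.volume_toSet, ← mul_pow, Cube.side_of_mem_gen hP,
    Cube.side_of_mem_gen hR]
  congr 1
  rw [show (2 : ℝ≥0∞) = ENNReal.ofReal 2 by norm_num, ← ENNReal.ofReal_mul (by norm_num)]
  congr 1
  rw [pow_succ]
  field_simp

/-! ### Calderón-Zygmund level sets and stopping cubes. -/

/-- The union of the dyadic subcubes of `Q` on which the average of `w` exceeds `t`. -/
def levelSet (w : (Fin n → ℝ) → ℝ≥0∞) (Q : Cube n) (t : ℝ≥0∞) : Set (Fin n → ℝ) :=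
  ⋃ k, ⋃ R ∈ {R ∈ Q.gen k | t < avg w R}, R.toSet

/-- The maximal dyadic subcubes of `Q` on which the average of `w` exceeds `t`. -/
def maxFamily (w : (Fin n → ℝ) → ℝ≥0∞) (Q : Cube n) (t : ℝ≥0∞) : Set (Cube n) :=
  {R | ∃ k, R ∈ Q.gen k ∧ t < avg w R ∧ ∀ j < k, ∀ P ∈ Q.gen j, R.toSet ⊆ P.toSet → avg w P ≤ t}

variable {w : (Fin n → ℝ) → ℝ≥0∞} {Q : Cube n} {s t : ℝ≥0∞}

theorem mem_levelSet {x : Fin n → ℝ} :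
    x ∈ levelSet w Q t ↔ ∃ k, ∃ R ∈ Q.gen k, t < avg w R ∧ x ∈ R.toSet := by
  simp only [levelSet, mem_iUnion, mem_ofPred_eq, exists_prop, and_assoc]

theorem measurableSet_levelSet : MeasurableSet (levelSet w Q t) :=
  MeasurableSet.iUnion fun k => MeasurableSet.biUnion ((Q.gen_countable k).mono fun _ h => h.1)
    fun R _ => R.measurableSet

theorem levelSet_subset : levelSet w Q t ⊆ Q.toSet := fun x hx => by
  obtain ⟨k, R, hR, -, hx⟩ := mem_levelSet.1 hx
  exact hR.2 hx

theorem levelSet_anti (h : s ≤ t) : levelSet w Q t ⊆ levelSet w Q s := fun x hx => by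
  obtain ⟨k, R, hR, ht, hx⟩ := mem_levelSet.1 hx
  exact mem_levelSet.2 ⟨k, R, hR, h.trans_lt ht, hx⟩

theorem maxFamily_countable : (maxFamily w Q t).Countable :=
  (countable_iUnion Q.gen_countable).mono fun _ ⟨k, hk, _⟩ => mem_iUnion.2 ⟨k, hk⟩

theorem levelSet_eq_biUnion : levelSet w Q t = ⋃ R ∈ maxFamily w Q t, R.toSet := by
  classical
  ext x
  rw [mem_levelSet, mem_iUnion₂]
  constructor
  · intro hex
    obtain ⟨R, hR, ht, hx⟩ := Nat.find_spec hex
    refine ⟨R, ⟨Nat.find hex, hR, ht, fun j hj P hP hRP => ?_⟩, hx⟩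
    by_contra hlt
    exact Nat.find_min hex hj ⟨P, hP, not_le.1 hlt, hRP hx⟩
  · rintro ⟨R, ⟨k, hR, ht, -⟩, hx⟩
    exact ⟨k, R, hR, ht, hx⟩

/-- Were `P` of an earlier generation, it would contain `R` and violate its maximality. This gives
both disjointness within one family and nesting of the families of increasing levels. -/
theorem subset_of_mem_maxFamily {P R : Cube n} {j : ℕ} (hR : R ∈ maxFamily w Q t) (hts : t ≤ s)
    (hP : P ∈ Q.gen j) (hPs : s < avg w P) (h : (R.toSet ∩ P.toSet).Nonempty) :
    P.toSet ⊆ R.toSet := by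
  obtain ⟨k, hR, -, hmax⟩ := hR
  rcases le_or_gt k j with hkj | hjk
  · exact Cube.gen_nested hkj hR hP h
  · exact absurd (hmax j hjk P hP (Cube.gen_nested hjk.le hP hR (by rwa [inter_comm])))
      (not_le.2 (hts.trans_lt hPs))

theorem maxFamily_pairwiseDisjoint (hn : 1 ≤ n) :
    (maxFamily w Q t).PairwiseDisjoint Cube.toSet := by
  intro P hP R hR hne
  by_contra h
  rw [Function.onFun, not_disjoint_iff_nonempty_inter] at h
  obtain ⟨j, hj, hjt, -⟩ := id hP
  obtain ⟨k, hk, hkt, -⟩ := id hR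
  have h1 := subset_of_mem_maxFamily hP le_rfl hk hkt h
  have h2 := subset_of_mem_maxFamily hR le_rfl hj hjt (by rwa [inter_comm])
  exact hne (Cube.eq_of_subset_of_side_le hn h2 (Cube.side_le_of_subset hn h1).2)

/-- The dyadic parent of a stopping cube has average at most `t` and $2^n$ times the volume; `ht`
excludes generation zero, so the parent exists. -/
theorem lintegral_le_of_mem_maxFamily (hn : 1 ≤ n) (ht : avg w Q ≤ t) {R : Cube n}
    (hR : R ∈ maxFamily w Q t) : ∫⁻ x in R.toSet, w x ≤ 2 ^ n * t * volume R.toSet := by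
  obtain ⟨k, hR, hlt, hmax⟩ := hR
  rcases k with _ | k
  · rw [Cube.eq_of_mem_gen_zero hn hR] at hlt
    exact absurd hlt (not_lt.2 ht)
  · obtain ⟨P, hP, hRP⟩ := Cube.exists_mem_gen k (hR.2 R.corner_mem)
    have hsub := Cube.gen_nested k.le_succ hP hR ⟨_, hRP, R.corner_mem⟩
    calc ∫⁻ x in R.toSet, w x ≤ ∫⁻ x in P.toSet, w x := lintegral_mono_set hsub
      _ = avg w P * volume P.toSet := (avg_mul_volume w P).symm
      _ ≤ t * (2 ^ n * volume R.toSet) := by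
          rw [← Cube.volume_of_mem_gen_succ hP hR]
          gcongr
          exact hmax k k.lt_succ_self P hP hsub
      _ = _ := by ring

theorem inter_levelSet_eq_biUnion {R : Cube n} (hR : R ∈ maxFamily w Q t) (hts : t ≤ s) :
    R.toSet ∩ levelSet w Q s = ⋃ P ∈ {P ∈ maxFamily w Q s | P.toSet ⊆ R.toSet}, P.toSet := by
  rw [levelSet_eq_biUnion]
  ext x
  simp only [mem_inter_iff, mem_iUnion₂, mem_ofPred_eq, exists_prop]
  constructor
  · rintro ⟨hx, P, hP, hxP⟩
    obtain ⟨j, hj, hjs, -⟩ := id hP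
    exact ⟨P, ⟨hP, subset_of_mem_maxFamily hR hts hj hjs ⟨x, hx, hxP⟩⟩, hxP⟩
  · rintro ⟨P, ⟨hP, hPR⟩, hxP⟩
    exact ⟨hPR hxP, P, hP, hxP⟩

theorem mul_measure_le_setLIntegral_biUnion (hn : 1 ≤ n) {F : Set (Cube n)}
    (hF : F ⊆ maxFamily w Q s) :
    s * volume (⋃ P ∈ F, P.toSet) ≤ ∫⁻ x in ⋃ P ∈ F, P.toSet, w x := by
  have hc := maxFamily_countable.mono hF
  have hd := (maxFamily_pairwiseDisjoint hn).subset hF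
  rw [measure_biUnion hc hd fun P _ => P.measurableSet,
    lintegral_biUnion hc (fun P _ => P.measurableSet) hd, ← ENNReal.tsum_mul_left]
  refine ENNReal.tsum_le_tsum fun P => ?_
  obtain ⟨j, hj, hjs, -⟩ := hF P.2
  rw [← avg_mul_volume]
  gcongr

/-- The mass of `R` is at most $2^nt|R|$, so by Chebyshev the level $2^{n+1}t$ is exceeded on at
most half of `R`. This fixes the ratio of consecutive levels below. -/
theorem volume_le_two_mul_diff (hn : 1 ≤ n) (ht : avg w Q ≤ t) (ht0 : t ≠ 0) (htt : t ≠ ⊤)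
    {R : Cube n} (hR : R ∈ maxFamily w Q t) :
    volume R.toSet ≤ 2 * volume (R.toSet \ levelSet w Q (2 ^ (n + 1) * t)) := by
  set s := 2 ^ (n + 1) * t with hs
  have hts : t ≤ s := le_mul_of_one_le_left' (one_le_pow₀ (by norm_num))
  have h1 : s * volume (R.toSet ∩ levelSet w Q s) ≤ 2 ^ n * t * volume R.toSet := by
    rw [inter_levelSet_eq_biUnion hR hts]
    refine (mul_measure_le_setLIntegral_biUnion hn fun _ h => h.1).trans ?_
    refine (lintegral_mono_set (iUnion₂_subset fun P hP => hP.2)).trans ?_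
    exact lintegral_le_of_mem_maxFamily hn ht hR
  have h2 : 2 * volume (R.toSet ∩ levelSet w Q s) ≤ volume R.toSet := by
    have h3 : 2 ^ n * t * (2 * volume (R.toSet ∩ levelSet w Q s)) ≤
        2 ^ n * t * volume R.toSet := by
      refine le_trans (le_of_eq ?_) h1
      rw [hs, pow_succ]; ring
    rwa [ENNReal.mul_le_mul_iff_right (mul_ne_zero (by simp) ht0)
      (ENNReal.mul_ne_top (ENNReal.pow_ne_top (by norm_num)) htt)] at h3
  have h4 := measure_inter_add_sdiff (μ := volume) R.toSet (measurableSet_levelSet (w := w) (Q := Q) (t := s))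
  have h5 : volume (R.toSet ∩ levelSet w Q s) ≠ ⊤ :=
    measure_ne_top_of_subset inter_subset_left R.volume_ne_top
  refine (ENNReal.add_le_add_iff_right (a := 2 * volume (R.toSet ∩ levelSet w Q s))
    (ENNReal.mul_ne_top (by norm_num) h5)).1 ?_
  calc volume R.toSet + 2 * volume (R.toSet ∩ levelSet w Q s)
      ≤ volume R.toSet + volume R.toSet := by gcongr
    _ = 2 * volume (R.toSet \ levelSet w Q s) + 2 * volume (R.toSet ∩ levelSet w Q s) := by
      rw [← h4]; ring

/-- Lebesgue differentiation along the dyadic subcubes shrinking to `x`. The corresponding balls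
contain `x` but need not be centred there, which the Vitali family with parameter `1` allows. -/
theorem ae_le_of_notMem_levelSet (hw : AEMeasurable w) (hQ : ∫⁻ x in Q.toSet, w x ≠ ⊤) :
    ∀ᵐ x, x ∈ Q.toSet → ∀ t, x ∉ levelSet w Q t → w x ≤ t := by
  have hw' : AEMeasurable (Q.toSet.indicator w) := hw.indicator Q.measurableSet
  have hfin : ∫⁻ x, Q.toSet.indicator w x ≠ ⊤ := by
    rwa [lintegral_indicator Q.measurableSet]
  filter_upwards [(IsUnifLocDoublingMeasure.vitaliFamily (volume : Measure (Fin n → ℝ))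
    1).ae_tendsto_lintegral_div hw' hfin] with x hx hxQ t hxt
  choose R hR hxR using fun k => Cube.exists_mem_gen k hxQ
  have hlim : Tendsto (fun k => (R k).side / 2) atTop (nhdsWithin 0 (Ioi 0)) := by
    refine tendsto_nhdsWithin_iff.2 ⟨?_, Eventually.of_forall fun k => ?_⟩
    · have : (fun k => (R k).side / 2) = fun k : ℕ => Q.side / 2 * (1 / 2 : ℝ) ^ k := by
        ext k
        rw [Cube.side_of_mem_gen (hR k), one_div, inv_pow]
        ring
      rw [this, ← mul_zero (Q.side / 2)]
      exact (tendsto_pow_atTop_nhds_zero_of_lt_one (by norm_num) (by norm_num)).const_mul _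
    · have := (R k).side_pos
      exact mem_Ioi.2 (by linarith)
  have h := hx.comp (IsUnifLocDoublingMeasure.tendsto_closedBall_filterAt volume
    (fun k => (R k).center) _ hlim (Eventually.of_forall fun k => by
      rw [one_mul]; exact (R k).subset_closedBall (hxR k)))
  rw [indicator_of_mem hxQ] at h
  refine le_of_tendsto h (Eventually.of_forall fun k => ?_)
  simp only [Function.comp]
  rw [← measure_congr (R k).ae_eq_closedBall, ← setLIntegral_congr (R k).ae_eq_closedBall]
  have h2 : ∫⁻ y in (R k).toSet, Q.toSet.indicator w y = ∫⁻ y in (R k).toSet, w y :=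
    setLIntegral_congr_fun (R k).measurableSet fun y hy => indicator_of_mem ((hR k).2 hy) _
  rw [h2]
  by_contra hlt
  exact hxt (mem_levelSet.2 ⟨k, R k, hR k, not_le.1 hlt, hxR k⟩)

end

section

variable {n : ℕ}

/-! ### The reverse Hölder inequality -/

/-- A form of the `A_∞` condition: mass of `w` on a cube is controlled by an integral over any large
part of the cube, with total mass at most `N` times that of `w`. -/
def Decay (N : ℝ≥0∞) (w : (Fin n → ℝ) → ℝ≥0∞) : Prop :=
  ∀ R : Cube n, ∃ Φ : (Fin n → ℝ) → ℝ≥0∞,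
    ∫⁻ x in R.toSet, Φ x ≤ N * ∫⁻ x in R.toSet, w x ∧
    ∀ P : Cube n, P.toSet ⊆ R.toSet → ∀ E, MeasurableSet E → E ⊆ P.toSet →
      volume P.toSet ≤ 2 * volume E → ∫⁻ x in P.toSet, w x ≤ ∫⁻ x in E, Φ x

variable {w : (Fin n → ℝ) → ℝ≥0∞} {Q : Cube n} {s t : ℝ≥0∞}

/-- A stopping cube of level $t_j$ has at least half its volume outside the next level set, so
`Decay` bounds its mass by $\int\Phi$ over that part. These parts are disjoint for different $j$, so
the whole sum costs only one integral of $\Phi$. -/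
theorem sum_lintegral_inter_levelSet_le (hn : 1 ≤ n) {N : ℝ≥0∞} (hN : Decay N w)
    {t : ℕ → ℝ≥0∞} (ht : ∀ k, t (k + 1) = 2 ^ (n + 1) * t k) (h0 : t 0 ≠ 0) (htop : t 0 ≠ ⊤)
    (hQ : avg w Q ≤ t 0) (J : ℕ) :
    ∑ j ∈ Finset.range J, ∫⁻ x in levelSet w Q (t j), w x ≤
      N * ∫⁻ x in levelSet w Q (t 0), w x := by
  have hmono : Monotone t := monotone_nat_of_le_succ fun k => by
    rw [ht]; exact le_mul_of_one_le_left' (one_le_pow₀ (by norm_num))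
  have hne : ∀ k, t k ≠ 0 ∧ t k ≠ ⊤ := fun k => by
    induction k with
    | zero => exact ⟨h0, htop⟩
    | succ k ih =>
      rw [ht]
      exact ⟨mul_ne_zero (by simp) ih.1, ENNReal.mul_ne_top (ENNReal.pow_ne_top (by norm_num)) ih.2⟩
  -- The majorant `Φ` depends on the ambient cube, so the argument is run inside each stopping cube
  -- of the lowest level.
  have hloc : ∀ R ∈ maxFamily w Q (t 0),
      ∑ j ∈ Finset.range J, ∫⁻ x in R.toSet ∩ levelSet w Q (t j), w x ≤
        N * ∫⁻ x in R.toSet, w x := by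
    intro R hR
    obtain ⟨Φ, hΦ, hΦ'⟩ := hN R
    have hstep : ∀ j, ∫⁻ x in R.toSet ∩ levelSet w Q (t j), w x ≤
        ∫⁻ x in (R.toSet ∩ levelSet w Q (t j)) \ levelSet w Q (t (j + 1)), Φ x := by
      intro j
      set F := {P ∈ maxFamily w Q (t j) | P.toSet ⊆ R.toSet} with hF
      have hFs : F ⊆ maxFamily w Q (t j) := fun _ h => h.1
      have hc : F.Countable := maxFamily_countable.mono hFs
      have hd : F.PairwiseDisjoint Cube.toSet := (maxFamily_pairwiseDisjoint hn).subset hFs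
      rw [inter_levelSet_eq_biUnion hR (hmono j.zero_le),
        show (⋃ P ∈ F, P.toSet) \ levelSet w Q (t (j + 1)) =
          ⋃ P ∈ F, P.toSet \ levelSet w Q (t (j + 1)) by simp only [sdiff_eq, iUnion₂_inter],
        lintegral_biUnion hc (fun P _ => P.measurableSet) hd,
        lintegral_biUnion hc (fun P _ => P.measurableSet.diff measurableSet_levelSet)
          (hd.mono fun P => sdiff_subset)]
      refine ENNReal.tsum_le_tsum fun P => ?_
      refine hΦ' P P.2.2 _ (P.1.measurableSet.diff measurableSet_levelSet) sdiff_subset ?_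
      rw [ht]
      exact volume_le_two_mul_diff hn (hQ.trans (hmono j.zero_le)) (hne j).1 (hne j).2 P.2.1
    calc ∑ j ∈ Finset.range J, ∫⁻ x in R.toSet ∩ levelSet w Q (t j), w x
        ≤ ∑ j ∈ Finset.range J,
          ∫⁻ x in (R.toSet ∩ levelSet w Q (t j)) \ levelSet w Q (t (j + 1)), Φ x :=
          Finset.sum_le_sum fun j _ => hstep j
      _ = ∫⁻ x in ⋃ j ∈ Finset.range J,
          (R.toSet ∩ levelSet w Q (t j)) \ levelSet w Q (t (j + 1)), Φ x := by
          rw [lintegral_biUnion_finset]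
          · intro i _ j _ hij
            wlog h : i < j generalizing i j
            · exact (this ‹_› ‹_› hij.symm (lt_of_le_of_ne (not_lt.1 h) hij.symm)).symm
            refine Set.disjoint_left.2 fun x hx hx' => hx.2 ?_
            exact levelSet_anti (hmono h) hx'.1.2
          · exact fun j _ => (R.measurableSet.inter measurableSet_levelSet).diff
              measurableSet_levelSet
      _ ≤ ∫⁻ x in R.toSet, Φ x :=
          lintegral_mono_set (iUnion₂_subset fun j _ => sdiff_subset.trans inter_subset_left)
      _ ≤ _ := hΦ
  have hc := maxFamily_countable (w := w) (Q := Q) (t := t 0)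
  have hd := maxFamily_pairwiseDisjoint (w := w) (Q := Q) (t := t 0) hn
  have hdecomp : ∀ j, ∫⁻ x in levelSet w Q (t j), w x =
      ∑' R : maxFamily w Q (t 0), ∫⁻ x in R.1.toSet ∩ levelSet w Q (t j), w x := by
    intro j
    rw [← lintegral_biUnion hc (fun R _ => R.measurableSet.inter measurableSet_levelSet)
      (hd.mono fun R => inter_subset_left), ← iUnion₂_inter, ← levelSet_eq_biUnion,
      inter_eq_self_of_subset_right (levelSet_anti (hmono j.zero_le))]
  calc ∑ j ∈ Finset.range J, ∫⁻ x in levelSet w Q (t j), w x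
      = ∑' R : maxFamily w Q (t 0),
          ∑ j ∈ Finset.range J, ∫⁻ x in R.1.toSet ∩ levelSet w Q (t j), w x := by
        rw [Summable.tsum_finsetSum fun _ _ => ENNReal.summable]
        exact Finset.sum_congr rfl fun j _ => hdecomp j
    _ ≤ ∑' R : maxFamily w Q (t 0), N * ∫⁻ x in R.1.toSet, w x :=
        ENNReal.tsum_le_tsum fun R => hloc R R.2
    _ = N * ∫⁻ x in levelSet w Q (t 0), w x := by
        rw [ENNReal.tsum_mul_left, levelSet_eq_biUnion,
          lintegral_biUnion hc (fun R _ => R.measurableSet) hd]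

/-- A summation by parts in which only tail sums of $W$ are controlled. Induction applies the claim
to the shifted sequence; the resulting error $2(b-1)^2T$ is absorbed because the tail condition and
`hbN` give $2(b-1)T\le W_1$. -/
theorem sum_pow_mul_sub_le {N b : ℝ} (hb : 1 ≤ b) (hbN : (b - 1) * N ≤ 1 / 2) (K : ℕ) :
    ∀ W : ℕ → ℝ, (∀ k, 0 ≤ W k) → (∀ i J, ∑ j ∈ Finset.range J, W (i + j) ≤ N * W i) →
      ∑ k ∈ Finset.range K, b ^ k * (W k - W (k + 1)) ≤
        W 0 + 2 * (b - 1) * ∑ j ∈ Finset.range K, W (j + 1) := by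
  induction K with
  | zero => intro W h0 _; simpa using h0 0
  | succ K ih =>
    intro W h0 hW
    have h := ih (fun k => W (k + 1)) (fun k => h0 _) fun i J => by
      simpa [add_right_comm] using hW (i + 1) J
    have hT := hW 1 (K + 1)
    rw [Finset.sum_range_succ'] at hT
    simp only [add_zero] at hT
    have e : ∀ j, W (1 + (j + 1)) = W (j + 1 + 1) := fun j => by rw [add_comm]
    simp only [e] at hT
    rw [Finset.sum_range_succ', Finset.sum_range_succ' (fun j => W (j + 1))]
    simp only [pow_succ', pow_zero, one_mul, zero_add, mul_assoc, ← Finset.mul_sum] at h ⊢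
    set T := ∑ j ∈ Finset.range K, W (j + 1 + 1)
    have h1 : b * ∑ i ∈ Finset.range K, b ^ i * (W (i + 1) - W (i + 1 + 1)) ≤
        b * (W 1 + 2 * ((b - 1) * T)) := mul_le_mul_of_nonneg_left h (by linarith)
    have h2 : (b - 1) * (T + W 1) ≤ (b - 1) * (N * W 1) :=
      mul_le_mul_of_nonneg_left hT (by linarith)
    have h3 : (b - 1) * N * W 1 ≤ 1 / 2 * W 1 := mul_le_mul_of_nonneg_right hbN (h0 1)
    have h4 : (b - 1) * (2 * ((b - 1) * (T + W 1))) ≤ (b - 1) * W 1 :=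
      mul_le_mul_of_nonneg_left (by linarith) (by linarith)
    nlinarith [mul_nonneg (sq_nonneg (b - 1)) (h0 1)]

/-- By Chebyshev, the intersection $Z$ of the level sets satisfies $t_k|Z|\le\int_Qw<\infty$ for
every $k$. -/
theorem exists_notMem_levelSet (hn : 1 ≤ n) {t : ℕ → ℝ≥0∞}
    (ht : Tendsto t atTop (nhds ⊤)) (hQ : ∫⁻ x in Q.toSet, w x ≠ ⊤) :
    ∀ᵐ x, ∃ k, x ∉ levelSet w Q (t k) := by
  rw [ae_iff]
  set Z := {x | ¬ ∃ k, x ∉ levelSet w Q (t k)}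
  have h1 : ∀ k, t k * volume Z ≤ ∫⁻ x in Q.toSet, w x := by
    intro k
    calc t k * volume Z ≤ t k * volume (levelSet w Q (t k)) := by
          gcongr
          intro x hx
          by_contra h
          exact hx ⟨k, h⟩
      _ ≤ ∫⁻ x in levelSet w Q (t k), w x := by
          rw [levelSet_eq_biUnion]
          exact mul_measure_le_setLIntegral_biUnion hn le_rfl
      _ ≤ _ := lintegral_mono_set levelSet_subset
  by_contra hZ
  have h2 : Tendsto (fun k => t k * volume Z) atTop (nhds (⊤ * volume Z)) :=
    ENNReal.Tendsto.mul_const ht (Or.inl (by simp))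
  rw [ENNReal.top_mul hZ] at h2
  exact hQ (top_le_iff.1 (le_of_tendsto' h2 h1))

/-- Cut `Q` into shells between consecutive level sets of heights $a^km$, $a=2^{n+1}$. On a shell
$w^{1+\delta}\le t_{k+1}^\delta w$, so the integral becomes $\sum_kb^k\,w(\text{shell}_k)$ with
$b=a^\delta$ up to factors. The masses of the level sets have controlled tails, and $b-1\lesssim1/N$
makes the series converge. -/
theorem lintegral_rpow_le_of_decay (hn : 1 ≤ n) (hw : AEMeasurable w) {N : ℝ}
    (hN : Decay (ENNReal.ofReal N) w) {δ : ℝ} (hδ : 0 < δ)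
    (hδN : (((2 : ℝ) ^ (n + 1)) ^ δ - 1) * N ≤ 1 / 2) (hN1 : 1 ≤ N)
    (h0 : avg w Q ≠ 0) (hQ : ∫⁻ x in Q.toSet, w x ≠ ⊤) :
    avg (fun x => w x ^ (1 + δ)) Q ≤ 3 * avg w Q ^ (1 + δ) := by
  set m := avg w Q with hm
  have hmt : m ≠ ⊤ := ENNReal.div_ne_top hQ Q.volume_pos
  set a : ℝ≥0∞ := 2 ^ (n + 1) with ha
  set b : ℝ := ((2 : ℝ) ^ (n + 1)) ^ δ with hb
  have hb1 : 1 ≤ b := Real.one_le_rpow (one_le_pow₀ (by norm_num)) hδ.le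
  have hab : a ^ δ = ENNReal.ofReal b := by
    rw [ha, hb, ← ENNReal.ofReal_rpow_of_pos (by positivity), ENNReal.ofReal_pow (by norm_num)]
    norm_num
  have ha1 : 1 < a := one_lt_pow₀ (by norm_num) (by omega)
  let t : ℕ → ℝ≥0∞ := fun k => a ^ k * m
  have hts : ∀ k, t (k + 1) = 2 ^ (n + 1) * t k := fun k => by simp only [t, pow_succ, ha]; ring
  have hat : a ≠ ⊤ := ENNReal.pow_ne_top (by norm_num)
  have htt : Tendsto t atTop (nhds ⊤) := by
    have : Tendsto (fun k : ℕ => a ^ k) atTop (nhds ⊤) :=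
      ENNReal.tendsto_pow_atTop_nhds_top_iff.2 ha1
    have := ENNReal.Tendsto.mul_const (b := m) this (Or.inl (by simp))
    rwa [ENNReal.top_mul h0] at this
  have hmono : Monotone t := monotone_nat_of_le_succ fun k => by
    rw [hts]; exact le_mul_of_one_le_left' ha1.le
  let L : ℕ → Set (Fin n → ℝ) := fun k => levelSet w Q (t k)
  have hLm : ∀ k, MeasurableSet (L k) := fun k => measurableSet_levelSet
  have hLQ : ∀ k, L k ⊆ Q.toSet := fun k => levelSet_subset
  have hLs : ∀ k, L (k + 1) ⊆ L k := fun k => levelSet_anti (hmono k.le_succ)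
  have hfin : ∀ k, ∫⁻ x in L k, w x ≠ ⊤ := fun k =>
    ne_top_of_le_ne_top hQ (lintegral_mono_set (hLQ k))
  let W : ℕ → ℝ := fun k => (∫⁻ x in L k, w x).toReal
  have htail : ∀ i J, ∑ j ∈ Finset.range J, W (i + j) ≤ N * W i := by
    intro i J
    have h := sum_lintegral_inter_levelSet_le hn hN (Q := Q) (t := fun j => t (i + j))
      (fun k => hts (i + k)) (mul_ne_zero (pow_ne_zero _ (by positivity)) h0)
      (ENNReal.mul_ne_top (ENNReal.pow_ne_top hat) hmt)
      (by simpa [t] using hmono (Nat.zero_le i)) J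
    have h' := ENNReal.toReal_mono (ENNReal.mul_ne_top ENNReal.ofReal_ne_top (hfin i)) h
    rw [ENNReal.toReal_sum fun j _ => hfin (i + j), ENNReal.toReal_mul,
      ENNReal.toReal_ofReal (by linarith)] at h'
    exact h'
  have hdiff : ∀ k, ∫⁻ x in L k \ L (k + 1), w x = ENNReal.ofReal (W k - W (k + 1)) := by
    intro k
    have h := lintegral_inter_add_sdiff (μ := volume) w (L k) (hLm (k + 1))
    rw [inter_eq_self_of_subset_right (hLs k)] at h
    rw [ENNReal.ofReal_sub _ ENNReal.toReal_nonneg, ENNReal.ofReal_toReal (hfin k),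
      ENNReal.ofReal_toReal (hfin (k + 1)), ← h, ENNReal.add_sub_cancel_left (hfin _)]
  have hWanti : ∀ k, W (k + 1) ≤ W k := fun k =>
    ENNReal.toReal_mono (hfin k) (lintegral_mono_set (hLs k))
  have hsum : ∑' k, ENNReal.ofReal b ^ k * ∫⁻ x in L k \ L (k + 1), w x ≤
      2 * ∫⁻ x in L 0, w x := by
    rw [ENNReal.tsum_eq_iSup_nat]
    refine iSup_le fun K => ?_
    have h1 := sum_pow_mul_sub_le hb1 hδN K W (fun k => ENNReal.toReal_nonneg) htail
    have h2 : ∑ j ∈ Finset.range K, W (j + 1) ≤ N * W 0 := by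
      refine le_trans ?_ (htail 0 (K + 1))
      rw [Finset.sum_range_succ']
      simp only [zero_add]
      linarith [show 0 ≤ W 0 from ENNReal.toReal_nonneg]
    have hW0 : 0 ≤ W 0 := ENNReal.toReal_nonneg
    have h3 : ∑ k ∈ Finset.range K, b ^ k * (W k - W (k + 1)) ≤ 2 * W 0 := by
      have h4 : (b - 1) * ∑ j ∈ Finset.range K, W (j + 1) ≤ (b - 1) * (N * W 0) :=
        mul_le_mul_of_nonneg_left h2 (by linarith)
      have h5 : (b - 1) * N * W 0 ≤ 1 / 2 * W 0 := mul_le_mul_of_nonneg_right hδN hW0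
      nlinarith
    calc ∑ k ∈ Finset.range K, ENNReal.ofReal b ^ k * ∫⁻ x in L k \ L (k + 1), w x
        = ENNReal.ofReal (∑ k ∈ Finset.range K, b ^ k * (W k - W (k + 1))) := by
          rw [ENNReal.ofReal_sum_of_nonneg fun k _ =>
            mul_nonneg (by positivity) (sub_nonneg.2 (hWanti k))]
          refine Finset.sum_congr rfl fun k _ => ?_
          rw [hdiff, ENNReal.ofReal_mul (by positivity), ENNReal.ofReal_pow (by linarith)]
      _ ≤ ENNReal.ofReal (2 * W 0) := ENNReal.ofReal_le_ofReal h3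
      _ = 2 * ∫⁻ x in L 0, w x := by
          rw [ENNReal.ofReal_mul (by norm_num), ENNReal.ofReal_toReal (hfin 0)]
          norm_num
  have hcover : Q.toSet ≤ᵐ[volume] (Q.toSet \ L 0 ∪ ⋃ k, (L k \ L (k + 1)) : Set _) := by
    filter_upwards [exists_notMem_levelSet hn htt hQ] with x hx hxQ
    classical
    obtain ⟨k, hk, hmin⟩ : ∃ k : ℕ, x ∉ L k ∧ ∀ j < k, ¬ x ∉ L j :=
      ⟨Nat.find hx, Nat.find_spec hx, fun j hj => Nat.find_min hx hj⟩
    rcases k with _ | k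
    · exact Or.inl ⟨hxQ, hk⟩
    · exact Or.inr (mem_iUnion.2 ⟨k, not_not.1 (hmin k k.lt_succ_self), hk⟩)
  have hae := ae_le_of_notMem_levelSet hw hQ
  have hset : ∀ (S : Set (Fin n → ℝ)) (r : ℝ≥0∞), MeasurableSet S → S ⊆ Q.toSet →
      Disjoint S (levelSet w Q r) →
      ∫⁻ x in S, w x ^ (1 + δ) ≤ r ^ δ * ∫⁻ x in S, w x := by
    intro S r hS hSQ hSr
    rw [← lintegral_const_mul'' _ hw.restrict]
    refine setLIntegral_mono_ae' hS ?_
    filter_upwards [hae] with x hx hxS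
    rw [ENNReal.rpow_add_of_nonneg _ _ zero_le_one hδ.le, ENNReal.rpow_one, mul_comm]
    gcongr
    exact hx (hSQ hxS) r (Set.disjoint_left.1 hSr hxS)
  have htδ : ∀ k, t k ^ δ = ENNReal.ofReal b ^ k * m ^ δ := fun k => by
    rw [← hab, ENNReal.mul_rpow_of_nonneg _ _ hδ.le, ← ENNReal.rpow_natCast,
      ← ENNReal.rpow_natCast, ← ENNReal.rpow_mul, ← ENNReal.rpow_mul, mul_comm δ]
  have hint : ∫⁻ x in Q.toSet, w x ^ (1 + δ) ≤ 3 * m ^ δ * ∫⁻ x in Q.toSet, w x := by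
    calc ∫⁻ x in Q.toSet, w x ^ (1 + δ)
        ≤ ∫⁻ x in Q.toSet \ L 0 ∪ ⋃ k, (L k \ L (k + 1)), w x ^ (1 + δ) :=
          lintegral_mono' (Measure.restrict_mono' hcover le_rfl) le_rfl
      _ ≤ (∫⁻ x in Q.toSet \ L 0, w x ^ (1 + δ)) +
          ∫⁻ x in ⋃ k, (L k \ L (k + 1)), w x ^ (1 + δ) := lintegral_union_le _ _ _
      _ ≤ (∫⁻ x in Q.toSet \ L 0, w x ^ (1 + δ)) +
          ∑' k, ∫⁻ x in L k \ L (k + 1), w x ^ (1 + δ) := by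
          gcongr
          exact lintegral_iUnion_le _ _
      _ ≤ t 0 ^ δ * (∫⁻ x in Q.toSet \ L 0, w x) +
          ∑' k, t (k + 1) ^ δ * ∫⁻ x in L k \ L (k + 1), w x := by
          gcongr with k
          · exact hset _ _ (Q.measurableSet.diff (hLm 0)) sdiff_subset disjoint_sdiff_left
          · exact hset _ _ ((hLm k).diff (hLm _)) (sdiff_subset.trans (hLQ k)) disjoint_sdiff_left
      _ = m ^ δ * ((∫⁻ x in Q.toSet \ L 0, w x) + ENNReal.ofReal b *
          ∑' k, ENNReal.ofReal b ^ k * ∫⁻ x in L k \ L (k + 1), w x) := by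
          simp only [htδ, pow_zero, one_mul, pow_succ]
          rw [mul_add, ← ENNReal.tsum_mul_left, ← ENNReal.tsum_mul_left]
          congr 2
          ext k
          ring
      -- From $(b-1)N\le1/2$ and $N\ge1$ one has $b\le3/2$; with the factor 2 of `hsum` this yields
      -- the constant 3.
      _ ≤ m ^ δ * ((∫⁻ x in Q.toSet \ L 0, w x) + ENNReal.ofReal (3 / 2) *
          (2 * ∫⁻ x in L 0, w x)) := by
          gcongr
          nlinarith
      _ ≤ m ^ δ * (3 * (∫⁻ x in Q.toSet \ L 0, w x) + 3 * ∫⁻ x in L 0, w x) := by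
          refine mul_le_mul_right (add_le_add ?_ (le_of_eq ?_)) _
          · exact le_mul_of_one_le_left' (by norm_num)
          · rw [← mul_assoc, show (2 : ℝ≥0∞) = ENNReal.ofReal 2 by norm_num,
              ← ENNReal.ofReal_mul (by norm_num)]
            norm_num
      _ = 3 * m ^ δ * ∫⁻ x in Q.toSet, w x := by
          have h := lintegral_inter_add_sdiff (μ := volume) w Q.toSet (hLm 0)
          rw [inter_eq_self_of_subset_right (hLQ 0)] at h
          rw [← h]
          ring
  rw [ENNReal.rpow_add_of_nonneg _ _ zero_le_one hδ.le, ENNReal.rpow_one]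
  calc avg (fun x => w x ^ (1 + δ)) Q
      ≤ (3 * m ^ δ * ∫⁻ x in Q.toSet, w x) / volume Q.toSet := ENNReal.div_le_div_right hint _
    _ = 3 * (m * m ^ δ) := by rw [mul_div_assoc, ← avg, ← hm]; ring

end

section

variable {n : ℕ}

/-! ### Weights with values in `ℝ≥0∞` -/

/-- A nonnegative function with finite positive mass on cubes. -/
structure IsCubeWeight (w : (Fin n → ℝ) → ℝ≥0∞) : Prop where
  aemeasurable : AEMeasurable w
  ne_zero : ∀ Q : Cube n, ∫⁻ x in Q.toSet, w x ≠ 0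
  ne_top : ∀ Q : Cube n, ∫⁻ x in Q.toSet, w x ≠ ⊤

variable {w U Y : (Fin n → ℝ) → ℝ≥0∞}

theorem IsCubeWeight.avg_ne_zero (hw : IsCubeWeight w) (Q : Cube n) : avg w Q ≠ 0 :=
  ENNReal.div_ne_zero.2 ⟨hw.ne_zero Q, Q.volume_ne_top⟩

theorem IsCubeWeight.avg_ne_top (hw : IsCubeWeight w) (Q : Cube n) : avg w Q ≠ ⊤ :=
  ENNReal.div_ne_top (hw.ne_top Q) Q.volume_pos

theorem hlMax_mono {f g : (Fin n → ℝ) → ℝ≥0∞} (h : ∀ x, f x ≤ g x) (x : Fin n → ℝ) :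
    hlMax f x ≤ hlMax g x :=
  iSup₂_mono fun _ _ => ENNReal.div_le_div_right (lintegral_mono h) _

theorem avg_le_hlMax (w : (Fin n → ℝ) → ℝ≥0∞) {Q : Cube n} {x : Fin n → ℝ} (hx : x ∈ Q.toSet) :
    avg w Q ≤ hlMax w x :=
  le_iSup₂ (f := fun (Q : Cube n) (_ : x ∈ Q.toSet) => avg w Q) Q hx

theorem avg_le_hlMax_indicator (w : (Fin n → ℝ) → ℝ≥0∞) {P R : Cube n} (h : P.toSet ⊆ R.toSet)
    {x : Fin n → ℝ} (hx : x ∈ P.toSet) : avg w P ≤ hlMax (R.toSet.indicator w) x := by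
  refine le_trans (le_of_eq ?_) (avg_le_hlMax _ hx)
  rw [avg, avg, setLIntegral_congr_fun P.measurableSet fun y hy => (indicator_of_mem (h hy) w).symm]

/-- The `A_∞` constant of a function with values in `ℝ≥0∞`. -/
noncomputable def ainf (w : (Fin n → ℝ) → ℝ≥0∞) : ℝ≥0∞ :=
  ⨆ Q : Cube n, (∫⁻ x in Q.toSet, hlMax (Q.toSet.indicator w) x) / ∫⁻ x in Q.toSet, w x

theorem IsCubeWeight.lintegral_hlMax_le (hw : IsCubeWeight w) (Q : Cube n) :
    ∫⁻ x in Q.toSet, hlMax (Q.toSet.indicator w) x ≤ ainf w * ∫⁻ x in Q.toSet, w x := by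
  rw [← ENNReal.div_le_iff (hw.ne_zero Q) (hw.ne_top Q)]
  exact le_iSup (fun Q : Cube n =>
    (∫⁻ x in Q.toSet, hlMax (Q.toSet.indicator w) x) / ∫⁻ x in Q.toSet, w x) Q

theorem IsCubeWeight.ainf_le (hw : IsCubeWeight w) {c : ℝ≥0∞}
    (h : ∀ Q : Cube n, ∫⁻ x in Q.toSet, hlMax (Q.toSet.indicator w) x ≤
      c * ∫⁻ x in Q.toSet, w x) : ainf w ≤ c :=
  iSup_le fun Q => (ENNReal.div_le_iff (hw.ne_zero Q) (hw.ne_top Q)).2 (h Q)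

/-- A cube of side one. -/
noncomputable def unitCube (n : ℕ) : Cube n := ⟨0, 1, one_pos⟩

theorem IsCubeWeight.one_le_ainf (hw : IsCubeWeight w) : 1 ≤ ainf w := by
  have h := hw.lintegral_hlMax_le (unitCube n)
  set Q := unitCube n
  have h1 : ∫⁻ x in Q.toSet, w x ≤ ainf w * ∫⁻ x in Q.toSet, w x := by
    refine le_trans ?_ h
    rw [← avg_mul_volume, ← setLIntegral_const]
    exact setLIntegral_mono' Q.measurableSet fun x hx => avg_le_hlMax_indicator w le_rfl hx
  nth_rewrite 1 [← one_mul (∫⁻ x in Q.toSet, w x)] at h1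
  exact (ENNReal.mul_le_mul_iff_left (hw.ne_zero Q) (hw.ne_top Q)).1 h1

/-- Every point of `P` sees the average over `P` in the maximal function localized to `R`; hence
$\Phi=2M(\chi_Rw)$ works. -/
theorem IsCubeWeight.decay (hw : IsCubeWeight w) : Decay (2 * ainf w) w := by
  intro R
  refine ⟨fun x => 2 * hlMax (R.toSet.indicator w) x, ?_, fun P hP E hE hEP hvol => ?_⟩
  · rw [lintegral_const_mul' _ _ (by norm_num), mul_assoc]
    exact mul_le_mul_right (hw.lintegral_hlMax_le R) _
  · calc ∫⁻ x in P.toSet, w x = avg w P * volume P.toSet := (avg_mul_volume w P).symm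
      _ ≤ avg w P * (2 * volume E) := by gcongr
      _ = ∫⁻ _ in E, 2 * avg w P := by rw [setLIntegral_const]; ring
      _ ≤ _ := setLIntegral_mono' hE fun x hx => by
          gcongr
          exact avg_le_hlMax_indicator w hP (hEP hx)

/-- With $y=(n+1)\delta\log2$ the base is $e^y$; use $e^y-1\le2y$ for $y\le1$ and $yN\le1/4$. -/
theorem rpow_sub_one_mul_le {N δ : ℝ} (hN : 1 ≤ N) (hδ : 0 < δ) (h : 4 * (n + 1) * N * δ ≤ 1) :
    (((2 : ℝ) ^ (n + 1)) ^ δ - 1) * N ≤ 1 / 2 := by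
  have hl : Real.log 2 ≤ 1 := by linarith [Real.log_two_lt_d9]
  have hl0 : 0 < Real.log 2 := Real.log_pos (by norm_num)
  have e : ((2 : ℝ) ^ (n + 1)) ^ δ = Real.exp ((n + 1) * Real.log 2 * δ) := by
    rw [Real.rpow_def_of_pos (by positivity), Real.log_pow]
    push_cast
    ring_nf
  have hn : (0 : ℝ) ≤ n := Nat.cast_nonneg n
  set y := (n + 1) * Real.log 2 * δ with hy
  have hy0 : 0 ≤ y := by positivity
  have hyN : y * N ≤ 1 / 4 := by
    have : y * N ≤ (n + 1) * 1 * δ * N := by rw [hy]; gcongr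
    linarith
  have hy1 : y ≤ 1 := by nlinarith
  have h2 := Real.abs_exp_sub_one_le (x := y) (by rwa [abs_of_nonneg hy0])
  rw [abs_of_nonneg hy0] at h2
  have h3 := (le_abs_self _).trans h2
  rw [e]
  calc (Real.exp y - 1) * N ≤ 2 * y * N := by gcongr
    _ ≤ 1 / 2 := by linarith

/-- The reverse Hölder inequality for `A_∞` weights. -/
theorem IsCubeWeight.reverse_holder (hn : 1 ≤ n) (hw : IsCubeWeight w) {N : ℝ} (hN1 : 1 ≤ N)
    (hN : Decay (ENNReal.ofReal N) w) {δ : ℝ} (hδ : 0 < δ) (h : 4 * (n + 1) * N * δ ≤ 1)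
    (Q : Cube n) : avg (fun x => w x ^ (1 + δ)) Q ≤ 3 * avg w Q ^ (1 + δ) :=
  lintegral_rpow_le_of_decay hn hw.aemeasurable hN hδ (rpow_sub_one_mul_le hN1 hδ h) hN1
    (hw.avg_ne_zero Q) (hw.ne_top Q)

/-- `Decay` gives reverse Hölder, which in turn bounds the local maximal function. -/
theorem IsCubeWeight.ainf_lt_top_of_decay (hn : 1 ≤ n) (hw : IsCubeWeight w) {N : ℝ} (hN1 : 1 ≤ N)
    (hN : Decay (ENNReal.ofReal N) w) : ainf w < ⊤ := by
  set δ : ℝ := 1 / (4 * (n + 1) * N) with hδ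
  have hδ0 : 0 < δ := by positivity
  have h : 4 * (n + 1) * N * δ ≤ 1 := by rw [hδ]; field_simp; rfl
  refine (hw.ainf_le (c := hlConst n (1 + δ) * 3) fun Q => ?_).trans_lt
    (ENNReal.mul_lt_top (hlConst_ne_top n (by linarith)).lt_top (by norm_num))
  exact MixedWeak.lintegral_hlMax_le hw.aemeasurable (by linarith) (hw.avg_ne_zero Q)
    (hw.avg_ne_top Q) (by norm_num) (hw.reverse_holder hn hN1 hN hδ0 h Q)

/-! ### Consequences of the $A_1$, $A_p(u)$ and reverse Hölder conditions. -/

/-- The `A_1` condition with constant `a`. -/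
def A1Bound (a : ℝ≥0∞) (U : (Fin n → ℝ) → ℝ≥0∞) : Prop := ∀ᵐ x, hlMax U x ≤ a * U x

/-- The consequence of the `A_p(U)` condition for `V` that is used below; `Y` is `U V`. -/
def ApBound (p : ℝ) (c : ℝ≥0∞) (U Y : (Fin n → ℝ) → ℝ≥0∞) : Prop :=
  ∀ (Q : Cube n) (E : Set (Fin n → ℝ)), MeasurableSet E → E ⊆ Q.toSet →
    (∫⁻ x in E, U x) ^ p * ∫⁻ x in Q.toSet, Y x ≤
      c * (∫⁻ x in E, Y x) * (∫⁻ x in Q.toSet, U x) ^ p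

/-- The reverse Hölder condition with exponent `q` and constant `h`. -/
def RHBound (q : ℝ) (h : ℝ≥0∞) (U : (Fin n → ℝ) → ℝ≥0∞) : Prop :=
  ∀ Q : Cube n, avg (fun x => U x ^ q) Q ≤ (h * avg U Q) ^ q

theorem A1Bound.avg_mul_volume_le {a : ℝ≥0∞} (h : A1Bound a U) (hU : AEMeasurable U) {Q : Cube n}
    {E : Set (Fin n → ℝ)} (hE : MeasurableSet E) (hEQ : E ⊆ Q.toSet) :
    avg U Q * volume E ≤ a * ∫⁻ x in E, U x := by
  rw [← setLIntegral_const, ← lintegral_const_mul'' _ hU.restrict]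
  refine setLIntegral_mono_ae' hE ?_
  filter_upwards [h] with x hx hxE using (avg_le_hlMax U (hEQ hxE)).trans hx

theorem A1Bound.one_le {a : ℝ≥0∞} (h : A1Bound a U) (hU : IsCubeWeight U) : 1 ≤ a := by
  have h1 := h.avg_mul_volume_le hU.aemeasurable (unitCube n).measurableSet le_rfl
  rw [avg_mul_volume] at h1
  nth_rewrite 1 [← one_mul (∫⁻ x in _, U x)] at h1
  exact (ENNReal.mul_le_mul_iff_left (hU.ne_zero _) (hU.ne_top _)).1 h1

theorem A1Bound.ainf_le {a : ℝ≥0∞} (h : A1Bound a U) (hU : IsCubeWeight U) : ainf U ≤ a := by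
  refine hU.ainf_le fun Q => ?_
  rw [← lintegral_const_mul'' _ hU.aemeasurable.restrict]
  refine lintegral_mono_ae (ae_restrict_of_ae ?_)
  filter_upwards [h] with x hx
  exact (hlMax_mono (fun y => indicator_le_self _ _ _) x).trans hx

theorem ApBound.one_le {p : ℝ} (hp : 1 ≤ p) {c : ℝ≥0∞} (h : ApBound p c U Y)
    (hU : IsCubeWeight U) (hY : IsCubeWeight Y) : 1 ≤ c := by
  have h1 := h (unitCube n) _ (unitCube n).measurableSet le_rfl
  set Q := unitCube n
  have e : c * (∫⁻ x in Q.toSet, Y x) * (∫⁻ x in Q.toSet, U x) ^ p =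
    c * ((∫⁻ x in Q.toSet, U x) ^ p * (∫⁻ x in Q.toSet, Y x)) := by ring
  rw [e] at h1
  nth_rewrite 1 [← one_mul (_ * _)] at h1
  have hp0 : 0 < p := by linarith
  refine (ENNReal.mul_le_mul_iff_left (mul_ne_zero ?_ (hY.ne_zero _))
    (ENNReal.mul_ne_top (ENNReal.rpow_ne_top_of_nonneg hp0.le (hU.ne_top _)) (hY.ne_top _))).1 h1
  simp [ENNReal.rpow_eq_zero_iff, hU.ne_zero, hU.ne_top]

theorem ApBound.lintegral_le {p : ℝ} (hp : 1 ≤ p) {c : ℝ≥0∞} (h : ApBound p c U Y)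
    (hU : IsCubeWeight U) {k : ℝ≥0∞} {P : Cube n} {E : Set (Fin n → ℝ)} (hE : MeasurableSet E)
    (hEP : E ⊆ P.toSet) (hk : ∫⁻ x in P.toSet, U x ≤ k * ∫⁻ x in E, U x) :
    ∫⁻ x in P.toSet, Y x ≤ c * k ^ p * ∫⁻ x in E, Y x := by
  have hp0 : 0 < p := by linarith
  have h0 : (∫⁻ x in P.toSet, U x) ^ p ≠ 0 := by
    simp [ENNReal.rpow_eq_zero_iff, hU.ne_zero, hU.ne_top]
  have ht : (∫⁻ x in P.toSet, U x) ^ p ≠ ⊤ := ENNReal.rpow_ne_top_of_nonneg hp0.le (hU.ne_top _)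
  refine (ENNReal.mul_le_mul_iff_right h0 ht).1 ?_
  calc (∫⁻ x in P.toSet, U x) ^ p * ∫⁻ x in P.toSet, Y x
      ≤ (k * ∫⁻ x in E, U x) ^ p * ∫⁻ x in P.toSet, Y x := by gcongr
    _ = k ^ p * ((∫⁻ x in E, U x) ^ p * ∫⁻ x in P.toSet, Y x) := by
        rw [ENNReal.mul_rpow_of_nonneg _ _ hp0.le, mul_assoc]
    _ ≤ k ^ p * (c * (∫⁻ x in E, Y x) * (∫⁻ x in P.toSet, U x) ^ p) := by
        exact mul_le_mul_right (h P E hE hEP) _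
    _ = _ := by ring

/-- By $A_1$, `Q` carries a fixed share of the `U`-mass of its dilate, and the $A_p(U)$ condition
passes this to `Y`. The constant becomes the threshold `L` of the weak type argument. -/
theorem ApBound.lintegral_dilate_le {p : ℝ} (hp : 1 ≤ p) {a c : ℝ≥0∞} (h : ApBound p c U Y)
    (hU : IsCubeWeight U) (ha : A1Bound a U) (Q : Cube n) :
    ∫⁻ x in Q.dilate.toSet, Y x ≤ c * (6 ^ n * a) ^ p * ∫⁻ x in Q.toSet, Y x := by
  refine h.lintegral_le hp hU Q.measurableSet Q.subset_dilate ?_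
  rw [← avg_mul_volume, Q.volume_dilate, mul_assoc]
  calc avg U Q.dilate * (6 ^ n * volume Q.toSet)
      = 6 ^ n * (avg U Q.dilate * volume Q.toSet) := by ring
    _ ≤ _ := by
      exact mul_le_mul_right (ha.avg_mul_volume_le hU.aemeasurable Q.measurableSet Q.subset_dilate) _

/-- Half of the volume carries a fixed share of `U` by $A_1$, hence of `Y` by $A_p(U)$; so a
constant multiple of `Y` serves as `Φ`. -/
theorem ApBound.decay {p : ℝ} (hp : 1 ≤ p) {a c : ℝ≥0∞} (h : ApBound p c U Y)
    (hU : IsCubeWeight U) (hY : IsCubeWeight Y) (ha : A1Bound a U) :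
    Decay (c * (2 * a) ^ p) Y := by
  intro R
  refine ⟨fun x => c * (2 * a) ^ p * Y x, ?_, fun P hP E hE hEP hvol => ?_⟩
  · rw [lintegral_const_mul'' _ hY.aemeasurable.restrict]
  · rw [lintegral_const_mul'' _ hY.aemeasurable.restrict]
    refine h.lintegral_le hp hU hE hEP ?_
    calc ∫⁻ x in P.toSet, U x = avg U P * volume P.toSet := (avg_mul_volume U P).symm
      _ ≤ avg U P * (2 * volume E) := by gcongr
      _ = 2 * (avg U P * volume E) := by ring
      _ ≤ 2 * (a * ∫⁻ x in E, U x) := by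
          exact mul_le_mul_right (ha.avg_mul_volume_le hU.aemeasurable hE hEP) _
      _ = _ := by ring

theorem ApBound.ainf_lt_top (hn : 1 ≤ n) {p : ℝ} (hp : 1 ≤ p) {a c : ℝ≥0∞} (h : ApBound p c U Y)
    (hU : IsCubeWeight U) (hY : IsCubeWeight Y) (ha : A1Bound a U) (hat : a ≠ ⊤) (hct : c ≠ ⊤) :
    ainf Y < ⊤ := by
  have hN := h.decay hp hU hY ha
  have ht : c * (2 * a) ^ p ≠ ⊤ := ENNReal.mul_ne_top hct
    (ENNReal.rpow_ne_top_of_nonneg (by linarith) (ENNReal.mul_ne_top (by norm_num) hat))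
  have h1 : 1 ≤ c * (2 * a) ^ p := by
    refine one_le_mul (h.one_le hp hU hY) (ENNReal.one_le_rpow ?_ (by linarith))
    exact one_le_mul (by norm_num) (ha.one_le hU)
  rw [← ENNReal.ofReal_toReal ht] at hN
  refine hY.ainf_lt_top_of_decay hn ?_ hN
  rwa [← ENNReal.ofReal_le_iff_le_toReal ht, ENNReal.ofReal_one]

theorem avg_mul_rpow_le {f g : (Fin n → ℝ) → ℝ≥0∞} (hf : AEMeasurable f) (hg : AEMeasurable g)
    {θ : ℝ} (h0 : 0 ≤ θ) (h1 : θ ≤ 1) (Q : Cube n) :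
    avg (fun x => f x ^ (1 - θ) * g x ^ θ) Q ≤ avg f Q ^ (1 - θ) * avg g Q ^ θ := by
  have h := ENNReal.lintegral_mul_norm_pow_le (μ := volume.restrict Q.toSet) hf.restrict
    hg.restrict (sub_nonneg.2 h1) h0 (by ring)
  have e : volume Q.toSet = volume Q.toSet ^ (1 - θ) * volume Q.toSet ^ θ := by
    rw [← ENNReal.rpow_add _ _ Q.volume_pos Q.volume_ne_top]
    simp
  rw [avg, avg, avg, ENNReal.div_rpow_of_nonneg _ _ (sub_nonneg.2 h1),
    ENNReal.div_rpow_of_nonneg _ _ h0, ENNReal.div_le_iff Q.volume_pos Q.volume_ne_top]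
  refine h.trans (le_of_eq ?_)
  have e0 : volume Q.toSet ^ (1 - θ) ≠ 0 := by
    simp [ENNReal.rpow_eq_zero_iff, Q.volume_pos, Q.volume_ne_top]
  have e0' : volume Q.toSet ^ θ ≠ 0 := by
    simp [ENNReal.rpow_eq_zero_iff, Q.volume_pos, Q.volume_ne_top]
  have et : volume Q.toSet ^ (1 - θ) ≠ ⊤ :=
    ENNReal.rpow_ne_top_of_nonneg (sub_nonneg.2 h1) Q.volume_ne_top
  have et' : volume Q.toSet ^ θ ≠ ⊤ := ENNReal.rpow_ne_top_of_nonneg h0 Q.volume_ne_top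
  nth_rewrite 3 [e]
  rw [mul_mul_mul_comm, ENNReal.div_mul_cancel e0 et, ENNReal.div_mul_cancel e0' et']

theorem RHBound.one_le {q : ℝ} (hq : 1 ≤ q) {h : ℝ≥0∞} (hRH : RHBound q h U)
    (hU : IsCubeWeight U) : 1 ≤ h := by
  set Q := unitCube n
  have h1 := (avg_rpow_le hU.aemeasurable hq Q).trans (hRH Q)
  rw [ENNReal.rpow_le_rpow_iff (by linarith)] at h1
  nth_rewrite 1 [← one_mul (avg U Q)] at h1
  exact (ENNReal.mul_le_mul_iff_left (hU.avg_ne_zero _) (hU.avg_ne_top _)).1 h1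

theorem RHBound.isCubeWeight_rpow {q r : ℝ} (hr : 1 ≤ r) (hrq : r ≤ q) {h : ℝ≥0∞}
    (hRH : RHBound q h U) (hh : h ≠ ⊤) (hU : IsCubeWeight U) :
    IsCubeWeight fun x => U x ^ r := by
  have hr0 : 0 < r := by linarith
  have hm : AEMeasurable fun x => U x ^ r := hU.aemeasurable.pow_const r
  refine ⟨hm, fun Q => ?_, fun Q => ?_⟩
  · have h1 := avg_rpow_le hU.aemeasurable hr Q
    intro h0
    rw [avg, avg, h0, ENNReal.zero_div, nonpos_iff_eq_zero, ENNReal.rpow_eq_zero_iff] at h1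
    rcases h1 with h1 | h1
    · exact hU.avg_ne_zero Q h1.1
    · linarith
  · have h1 := avg_rpow_le hm ((one_le_div hr0).2 hrq) Q
    have h2 : ∀ x, (U x ^ r) ^ (q / r) = U x ^ q := fun x => by
      rw [← ENNReal.rpow_mul, mul_div_cancel₀ _ hr0.ne']
    simp only [h2] at h1
    have h3 := h1.trans (hRH Q)
    have h4 : (h * avg U Q) ^ q ≠ ⊤ := ENNReal.rpow_ne_top_of_nonneg (by linarith)
      (ENNReal.mul_ne_top hh (hU.avg_ne_top Q))
    have h5 : avg (fun x => U x ^ r) Q ≠ ⊤ := by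
      intro ht
      rw [ht, ENNReal.top_rpow_of_pos (div_pos (by linarith) hr0)] at h3
      exact h4 (top_le_iff.1 h3)
    rw [← avg_mul_volume]
    exact ENNReal.mul_ne_top h5 Q.volume_ne_top

/-- A reverse Hölder inequality for $W=U^r$ with constant linear in `h`. The exponent is chosen so
that $W^\sigma=W^{1-1/q}(U^q)^{1/q}$; after Hölder, the $RH_q$ condition is used once, to the power
$1/q$. It exceeds 1 because $q>r$. -/
theorem RHBound.avg_rpow_mul_le {r : ℝ} (hr : 1 < r) {h : ℝ≥0∞} (hRH : RHBound (2 * r - 1) h U)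
    (hh : h ≠ ⊤) (hU : IsCubeWeight U) (Q : Cube n) :
    avg (fun x => (U x ^ r) ^ (1 - 1 / (2 * r - 1) + 1 / r)) Q ≤
      h * avg (fun x => U x ^ r) Q ^ (1 - 1 / (2 * r - 1) + 1 / r) := by
  have hW := hRH.isCubeWeight_rpow hr.le (by linarith) hh hU
  set q := 2 * r - 1 with hq
  have hq1 : 1 < q := by linarith
  have hq0 : q ≠ 0 := by linarith
  have hr0 : r ≠ 0 := by linarith
  have hθ : 0 ≤ 1 / q := by positivity
  have hθ1 : 1 / q ≤ 1 := by rw [div_le_one (by linarith)]; linarith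
  have h1 := avg_mul_rpow_le hW.aemeasurable (hU.aemeasurable.pow_const q) hθ hθ1 Q
  have e : ∀ x, (U x ^ r) ^ (1 - 1 / q) * (U x ^ q) ^ (1 / q) =
      (U x ^ r) ^ (1 - 1 / q + 1 / r) := fun x => by
    rw [← ENNReal.rpow_mul (U x) q, mul_one_div_cancel hq0,
      ENNReal.rpow_add_of_nonneg _ _ (sub_nonneg.2 hθ1) (by positivity),
      ← ENNReal.rpow_mul (U x) r (1 / r), mul_one_div_cancel hr0]
  simp only [e] at h1
  refine h1.trans ?_
  have h2 : avg (fun x => U x ^ q) Q ^ (1 / q) ≤ h * avg U Q := by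
    refine (ENNReal.rpow_le_rpow (hRH Q) hθ).trans (le_of_eq ?_)
    rw [← ENNReal.rpow_mul, mul_one_div_cancel hq0, ENNReal.rpow_one]
  have h3 : avg U Q ≤ avg (fun x => U x ^ r) Q ^ (1 / r) := by
    have := ENNReal.rpow_le_rpow (avg_rpow_le hU.aemeasurable hr.le Q)
      (show 0 ≤ 1 / r by positivity)
    rwa [← ENNReal.rpow_mul, mul_one_div_cancel hr0, ENNReal.rpow_one] at this
  rw [ENNReal.rpow_add_of_nonneg _ _ (sub_nonneg.2 hθ1) (by positivity)]
  calc _ ≤ avg (fun x => U x ^ r) Q ^ (1 - 1 / q) *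
        (h * avg (fun x => U x ^ r) Q ^ (1 / r)) := by
        gcongr
        exact h2.trans (by gcongr)
    _ = _ := by ring

theorem exists_ainf_rpow_le (n : ℕ) {r : ℝ} (hr : 1 ≤ r) :
    ∃ C : ℝ, 1 ≤ C ∧ ∀ (U : (Fin n → ℝ) → ℝ≥0∞) (a h : ℝ≥0∞), IsCubeWeight U → A1Bound a U →
      RHBound (2 * r - 1) h U → h ≠ ⊤ → ainf (fun x => U x ^ r) ≤ ENNReal.ofReal C * (h * a) := by
  -- For $r=1$ the exponent $\sigma$ degenerates to 1, and the $A_1$ constant bounds `ainf U`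
  -- directly. For $r>1$ only $1\le a$ is needed from $A_1$.
  rcases hr.eq_or_lt with rfl | hr
  · refine ⟨1, le_rfl, fun U a h hU ha hRH _ => ?_⟩
    have h1 := hRH.one_le (by norm_num) hU
    simp only [ENNReal.rpow_one, ENNReal.ofReal_one, one_mul]
    exact (ha.ainf_le hU).trans (le_mul_of_one_le_left' h1)
  · set σ := 1 - 1 / (2 * r - 1) + 1 / r with hσ
    have hσ1 : 1 < σ := by
      have : 1 / (2 * r - 1) < 1 / r := one_div_lt_one_div_of_lt (by linarith) (by linarith)
      rw [hσ]; linarith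
    have hC := hlConst_ne_top n hσ1
    refine ⟨(hlConst n σ).toReal, ?_, fun U a h hU ha hRH hh => ?_⟩
    · rw [← ENNReal.ofReal_le_iff_le_toReal hC, ENNReal.ofReal_one]
      exact le_self_add
    rw [ENNReal.ofReal_toReal hC, ← mul_assoc]
    have hW := hRH.isCubeWeight_rpow hr.le (by linarith) hh hU
    refine le_trans ?_ (le_mul_of_one_le_right' (ha.one_le hU))
    refine hW.ainf_le fun Q => ?_
    exact MixedWeak.lintegral_hlMax_le hW.aemeasurable hσ1 (hW.avg_ne_zero Q) (hW.avg_ne_top Q)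
      (hRH.one_le (by linarith) hU) (hRH.avg_rpow_mul_le hr hh hU Q)

end

section

variable {n : ℕ}

/-! ### Luxemburg averages -/

/-- At $t=2(1+a)\kappa N$ the power part and the linear part of the modular are each at most $1/2$.
For the power part, $(2\kappa)^{-s}\le(2\kappa)^{-r}\le\frac12\kappa^{-r}$, so `κ` enters the norm
linearly. -/
theorem luxNorm_le {A : ℝ → ℝ} {κ r s a : ℝ} (hA : ∀ x, 0 ≤ x → A x ≤ κ ^ r * x ^ s + a * x)
    (hκ : 1 ≤ κ) (hr : 1 ≤ r) (hrs : r ≤ s) (ha : 0 ≤ a) {g : (Fin n → ℝ) → ℝ} (hg : Measurable g)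
    {Q : Cube n} {N : ℝ≥0∞} (h1 : avg (fun x => ENNReal.ofReal |g x| ^ s) Q ≤ N ^ s)
    (h2 : avg (fun x => ENNReal.ofReal |g x|) Q ≤ N) :
    luxNorm A Q g ≤ ENNReal.ofReal (2 * (1 + a) * κ) * N := by
  have hs : 1 ≤ s := hr.trans hrs
  have hs0 : 0 < s := by linarith
  have hκ0 : 0 < κ := by linarith
  have hc : 0 < 2 * (1 + a) * κ := by positivity
  have key : ∀ t : ℝ, 0 < t → ENNReal.ofReal (2 * (1 + a) * κ) * N ≤ ENNReal.ofReal t →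
      luxNorm A Q g ≤ ENNReal.ofReal t := by
    intro t ht hNt
    have hN : N ≠ ⊤ := by
      rintro rfl
      rw [ENNReal.mul_top (by simpa using hc)] at hNt
      exact ENNReal.ofReal_ne_top (top_le_iff.1 hNt)
    lift N to NNReal using hN
    set ν : ℝ := N.toReal with hν
    have hνN : (N : ℝ≥0∞) = ENNReal.ofReal ν := by simp [hν]
    have hν0 : 0 ≤ ν := N.2
    rw [hνN, ← ENNReal.ofReal_mul hc.le, ENNReal.ofReal_le_ofReal_iff ht.le] at hNt
    refine sInf_le ⟨t, ht, rfl, ?_⟩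
    have hpt : ∀ x, ENNReal.ofReal (A (|g x| / t)) ≤
        ENNReal.ofReal (κ ^ r / t ^ s) * ENNReal.ofReal |g x| ^ s +
          ENNReal.ofReal (a / t) * ENNReal.ofReal |g x| := by
      intro x
      rw [ENNReal.ofReal_rpow_of_nonneg (abs_nonneg _) hs0.le,
        ← ENNReal.ofReal_mul (by positivity), ← ENNReal.ofReal_mul (by positivity),
        ← ENNReal.ofReal_add (by positivity) (by positivity)]
      refine ENNReal.ofReal_le_ofReal ((hA _ (by positivity)).trans (le_of_eq ?_))
      rw [Real.div_rpow (abs_nonneg _) ht.le]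
      ring
    have hgm : Measurable fun x => ENNReal.ofReal |g x| :=
      (measurable_norm.comp hg).ennreal_ofReal
    have hint : (∫⁻ x in Q.toSet, ENNReal.ofReal (A (|g x| / t))) / volume Q.toSet ≤
        ENNReal.ofReal (κ ^ r / t ^ s) * avg (fun x => ENNReal.ofReal |g x| ^ s) Q +
          ENNReal.ofReal (a / t) * avg (fun x => ENNReal.ofReal |g x|) Q := by
      rw [avg, avg, ← mul_div_assoc, ← mul_div_assoc, ← ENNReal.add_div]
      refine ENNReal.div_le_div_right ?_ _
      rw [← lintegral_const_mul _ (hgm.pow_const s), ← lintegral_const_mul _ hgm,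
        ← lintegral_add_left ((hgm.pow_const s).const_mul _)]
      exact lintegral_mono hpt
    refine hint.trans ?_
    calc _ ≤ ENNReal.ofReal (κ ^ r / t ^ s) * ENNReal.ofReal ν ^ s +
          ENNReal.ofReal (a / t) * ENNReal.ofReal ν := by
          rw [hνN] at h1 h2
          gcongr
      _ = ENNReal.ofReal (κ ^ r * (ν / t) ^ s + a * (ν / t)) := by
          rw [ENNReal.ofReal_rpow_of_nonneg hν0 hs0.le,
            ← ENNReal.ofReal_mul (by positivity), ← ENNReal.ofReal_mul (by positivity),
            ← ENNReal.ofReal_add (by positivity) (by positivity), Real.div_rpow hν0 ht.le]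
          ring_nf
      _ ≤ 1 := by
          rw [ENNReal.ofReal_le_one]
          have e1 : ν / t ≤ 1 / (2 * (1 + a) * κ) := by
            rw [div_le_div_iff₀ ht hc]; linarith
          have e2 : 1 / (2 * (1 + a) * κ) ≤ 1 / (2 * κ) := by
            apply one_div_le_one_div_of_le (by positivity)
            nlinarith
          have e3 : (ν / t) ^ s ≤ (1 / 2) * (κ ^ r)⁻¹ := by
            calc (ν / t) ^ s ≤ (1 / (2 * κ)) ^ s :=
                  Real.rpow_le_rpow (by positivity) (e1.trans e2) hs0.le
              _ ≤ (1 / (2 * κ)) ^ r := Real.rpow_le_rpow_of_exponent_ge (by positivity)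
                  (by rw [div_le_one (by positivity)]; linarith) hrs
              _ = (1 / 2) ^ r * (κ ^ r)⁻¹ := by
                  rw [← Real.inv_rpow hκ0.le, ← Real.mul_rpow (by norm_num) (by positivity)]
                  congr 1
                  field_simp
              _ ≤ (1 / 2) ^ (1 : ℝ) * (κ ^ r)⁻¹ := by
                  gcongr ?_ * _
                  exact Real.rpow_le_rpow_of_exponent_ge (by norm_num) (by norm_num) hr
              _ = _ := by rw [Real.rpow_one]
          have e4 : κ ^ r * (ν / t) ^ s ≤ 1 / 2 := by
            calc κ ^ r * (ν / t) ^ s ≤ κ ^ r * ((1 / 2) * (κ ^ r)⁻¹) := by gcongr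
              _ = 1 / 2 := by
                have : κ ^ r ≠ 0 := (Real.rpow_pos_of_pos hκ0 r).ne'
                field_simp
          have e5 : a * (ν / t) ≤ 1 / 2 := by
            have h3 : a * (ν / t) ≤ a * (1 / (2 * (1 + a) * κ)) := by gcongr
            refine h3.trans ?_
            rw [mul_one_div, div_le_div_iff₀ hc (by norm_num)]
            nlinarith
          linarith
  by_cases hX : ENNReal.ofReal (2 * (1 + a) * κ) * N = ⊤
  · rw [hX]; exact le_top
  -- The infimum in `luxNorm` runs over positive reals only, and `N` may be zero.
  refine ENNReal.le_of_forall_pos_le_add fun ε hε _ => ?_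
  have hXr := ENNReal.ofReal_toReal hX
  have hsum : ENNReal.ofReal (2 * (1 + a) * κ) * N + ε =
      ENNReal.ofReal ((ENNReal.ofReal (2 * (1 + a) * κ) * N).toReal + ε) := by
    rw [ENNReal.ofReal_add ENNReal.toReal_nonneg ε.coe_nonneg, hXr, ENNReal.ofReal_coe_nnreal]
  rw [hsum]
  refine key _ (add_pos_of_nonneg_of_pos ENNReal.toReal_nonneg (by exact_mod_cast hε)) ?_
  rw [← hsum]
  exact le_self_add

/-- The part of the mass of `U` on `Q` that is carried by `G`. -/
noncomputable def density (U : (Fin n → ℝ) → ℝ≥0∞) (G : Set (Fin n → ℝ)) (Q : Cube n) : ℝ≥0∞ :=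
  (∫⁻ x in Q.toSet, G.indicator U x) / ∫⁻ x in Q.toSet, U x

variable {U : (Fin n → ℝ) → ℝ≥0∞} {G : Set (Fin n → ℝ)}

theorem density_le_one (U : (Fin n → ℝ) → ℝ≥0∞) (G : Set (Fin n → ℝ)) (Q : Cube n) :
    density U G Q ≤ 1 :=
  ENNReal.div_le_of_le_mul (by
    rw [one_mul]; exact lintegral_mono fun x => indicator_le_self _ _ _)

theorem avg_indicator_eq (hU : IsCubeWeight U) (Q : Cube n) :
    avg (G.indicator U) Q = density U G Q * avg U Q := by
  rw [density, avg, avg, ← mul_div_assoc, ENNReal.div_mul_cancel (hU.ne_zero Q) (hU.ne_top Q)]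

/-- This is the reason for $q=2r-1$: Cauchy-Schwarz for $U^r=U^{1/2}U^{q/2}$, with the restriction
to `G` kept on the first factor, produces the square root of the density. -/
theorem avg_indicator_rpow_le {r : ℝ} (hr : 1 ≤ r) {h : ℝ≥0∞} (hRH : RHBound (2 * r - 1) h U)
    (hU : IsCubeWeight U) (hG : MeasurableSet G) (Q : Cube n) :
    avg (G.indicator fun x => U x ^ r) Q ≤ density U G Q ^ (1 / 2 : ℝ) * (h * avg U Q) ^ r := by
  have hh := hRH.one_le (by linarith) hU
  set q := 2 * r - 1 with hq
  have hz0 : avg U Q ≤ h * avg U Q := le_mul_of_one_le_left' hh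
  have hRHQ := hRH Q
  generalize h * avg U Q = z at hz0 hRHQ ⊢
  have h1 := avg_mul_rpow_le (hU.aemeasurable.indicator hG) (hU.aemeasurable.pow_const q)
    (θ := 1 / 2) (by norm_num) (by norm_num) Q
  have e : ∀ x, G.indicator U x ^ (1 - 1 / 2 : ℝ) * (U x ^ q) ^ (1 / 2 : ℝ) =
      G.indicator (fun x => U x ^ r) x := fun x => by
    by_cases hx : x ∈ G
    · rw [indicator_of_mem hx, indicator_of_mem hx, ← ENNReal.rpow_mul,
        ← ENNReal.rpow_add_of_nonneg _ _ (by norm_num) (by linarith)]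
      congr 1
      rw [hq]; ring
    · rw [indicator_of_notMem hx, indicator_of_notMem hx, ENNReal.zero_rpow_of_pos (by norm_num),
        zero_mul]
  simp only [e] at h1
  refine h1.trans ?_
  rw [avg_indicator_eq hU]
  calc (density U G Q * avg U Q) ^ (1 - 1 / 2 : ℝ) * avg (fun x => U x ^ q) Q ^ (1 / 2 : ℝ)
      ≤ (density U G Q * z) ^ (1 - 1 / 2 : ℝ) * (z ^ q) ^ (1 / 2 : ℝ) := by
        gcongr
    _ = density U G Q ^ (1 / 2 : ℝ) * z ^ r := by
        rw [ENNReal.mul_rpow_of_nonneg _ _ (by norm_num), ← ENNReal.rpow_mul, mul_assoc,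
          ← ENNReal.rpow_add_of_nonneg _ _ (by norm_num) (by linarith)]
        congr 2
        · norm_num
        · rw [hq]; ring

/-- The exponent $r(1+\delta/2)$ is the midpoint of $r$ and $r(1+\delta)$: one factor of
Cauchy-Schwarz has the density gain of `avg_indicator_rpow_le`, the other the reverse Hölder bound
for $U^r$. The density survives to the power $1/4$, which `hθ` converts into $\theta r(1+\delta/2)$.
-/
theorem avg_indicator_rpow_le_of_reverse_holder {r δ θ : ℝ} (hr : 1 ≤ r) (hδ : 0 < δ) {h : ℝ≥0∞}
    (hRH : RHBound (2 * r - 1) h U) (hU : IsCubeWeight U) (hG : MeasurableSet G) {Q : Cube n}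
    (hθ : θ * (r * (1 + δ / 2)) ≤ 1 / 4)
    (hI : avg (fun x => (U x ^ r) ^ (1 + δ)) Q ≤ 3 * avg (fun x => U x ^ r) Q ^ (1 + δ)) :
    avg (G.indicator fun x => U x ^ (r * (1 + δ / 2))) Q ≤
      (3 * density U G Q ^ θ * (h * avg U Q)) ^ (r * (1 + δ / 2)) := by
  have hW : AEMeasurable fun x => U x ^ r := hU.aemeasurable.pow_const r
  set s := r * (1 + δ / 2) with hs
  have hs1 : 1 ≤ s := by nlinarith
  have h3 := avg_indicator_rpow_le hr hRH hU hG Q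
  have h2 : avg (fun x => U x ^ r) Q ≤ (h * avg U Q) ^ r := by
    have := avg_indicator_rpow_le hr hRH hU MeasurableSet.univ Q
    rw [indicator_univ] at this
    refine this.trans (mul_le_of_le_one_left' ?_)
    exact ENNReal.rpow_le_one (density_le_one _ _ _) (by norm_num)
  have hα1 := density_le_one U G Q
  generalize h * avg U Q = z at h2 h3 ⊢
  generalize density U G Q = α at h3 hα1 ⊢
  have h1 := avg_mul_rpow_le (hW.indicator hG) (hW.pow_const (1 + δ))
    (θ := 1 / 2) (by norm_num) (by norm_num) Q
  have e : ∀ x, G.indicator (fun x => U x ^ r) x ^ (1 - 1 / 2 : ℝ) *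
      ((U x ^ r) ^ (1 + δ)) ^ (1 / 2 : ℝ) = G.indicator (fun x => U x ^ s) x := fun x => by
    by_cases hx : x ∈ G
    · rw [indicator_of_mem hx, indicator_of_mem hx, ← ENNReal.rpow_mul, ← ENNReal.rpow_mul,
        ← ENNReal.rpow_mul, ← ENNReal.rpow_add_of_nonneg _ _ (by positivity) (by positivity)]
      congr 1
      rw [hs]; ring
    · rw [indicator_of_notMem hx, indicator_of_notMem hx, ENNReal.zero_rpow_of_pos (by norm_num),
        zero_mul]
  simp only [e] at h1
  refine h1.trans ?_
  have h4 : avg (fun x => (U x ^ r) ^ (1 + δ)) Q ≤ 3 * (z ^ r) ^ (1 + δ) := by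
    refine hI.trans ?_
    gcongr
  calc avg (G.indicator fun x => U x ^ r) Q ^ (1 - 1 / 2 : ℝ) *
        avg (fun x => (U x ^ r) ^ (1 + δ)) Q ^ (1 / 2 : ℝ)
      ≤ (α ^ (1 / 2 : ℝ) * z ^ r) ^ (1 - 1 / 2 : ℝ) *
        (3 * (z ^ r) ^ (1 + δ)) ^ (1 / 2 : ℝ) := by
        gcongr
    _ = 3 ^ (1 / 2 : ℝ) * α ^ (1 / 4 : ℝ) * z ^ s := by
        rw [ENNReal.mul_rpow_of_nonneg _ _ (by norm_num),
          ENNReal.mul_rpow_of_nonneg _ _ (by norm_num), ← ENNReal.rpow_mul, ← ENNReal.rpow_mul,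
          ← ENNReal.rpow_mul, ← ENNReal.rpow_mul, mul_mul_mul_comm, mul_comm (α ^ _) (3 ^ _),
          ← ENNReal.rpow_add_of_nonneg _ _ (by nlinarith) (by positivity)]
        congr 2
        · norm_num
        · rw [hs]; ring
    _ ≤ 3 ^ s * (α ^ θ) ^ s * z ^ s := by
        rw [← ENNReal.rpow_mul]
        gcongr 3 ^ ?_ * ?_ * z ^ s
        · norm_num
        · linarith
        · exact ENNReal.rpow_le_rpow_of_exponent_ge hα1 hθ
    _ = _ := by
        rw [ENNReal.mul_rpow_of_nonneg _ _ (by linarith),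
          ENNReal.mul_rpow_of_nonneg _ _ (by linarith)]

theorem A1Bound.lintegral_mul_avg_le {a : ℝ≥0∞} (h : A1Bound a U) (hU : AEMeasurable U)
    {H : (Fin n → ℝ) → ℝ≥0∞} (hH : AEMeasurable H) (Q : Cube n) :
    (∫⁻ x in Q.toSet, H x) * avg U Q ≤ a * ∫⁻ x in Q.toSet, H x * U x := by
  rw [← lintegral_mul_const'' _ hH.restrict, 
    ← lintegral_const_mul'' a (f := fun x => H x * U x) (hH.mul hU).restrict]
  refine setLIntegral_mono_ae' Q.measurableSet ?_
  filter_upwards [h] with x hx hxQ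
  calc H x * avg U Q ≤ H x * (a * U x) := by
        gcongr
        exact (avg_le_hlMax U hxQ).trans hx
    _ = _ := by ring

/-- The terms of a sparse form applied to `G.indicator u`. -/
theorem sparse_term_le {A : ℝ → ℝ} {κ r b δ θ : ℝ} (hκ : 1 ≤ κ) (hr : 1 ≤ r) (hb : 0 ≤ b)
    (hδ : 0 < δ)
    (hA : ∀ x, 0 ≤ x → A x ≤ κ ^ r * x ^ (r * (1 + δ / 2)) + b * x)
    {u : (Fin n → ℝ) → ℝ} (hu : Measurable u) (huU : ∀ x, U x = ENNReal.ofReal |u x|)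
    {a h : ℝ≥0∞} (ha : A1Bound a U) (hRH : RHBound (2 * r - 1) h U) (hU : IsCubeWeight U)
    (hθ0 : 0 ≤ θ) (hθ : θ * (r * (1 + δ / 2)) ≤ 1 / 4) (hG : MeasurableSet G)
    {Q : Cube n}
    (hI : avg (fun x => (U x ^ r) ^ (1 + δ)) Q ≤ 3 * avg (fun x => U x ^ r) Q ^ (1 + δ))
    {H : (Fin n → ℝ) → ℝ≥0∞} (hH : AEMeasurable H) :
    avg H Q * luxNorm A Q (G.indicator u) * volume Q.toSet ≤
      ENNReal.ofReal (6 * (1 + b) * κ) * (h * a) *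
        ((∫⁻ x in Q.toSet, H x * U x) * density U G Q ^ θ) := by
  set s := r * (1 + δ / 2) with hs
  have hrs : r ≤ s := by nlinarith
  have hs0 : 0 < s := by linarith
  have hθ1 : θ ≤ 1 := by nlinarith
  have hh := hRH.one_le (by linarith) hU
  have e : ∀ x, ENNReal.ofReal |G.indicator u x| = G.indicator U x := fun x => by
    by_cases hx : x ∈ G <;> simp [hx, huU]
  have e' : ∀ x, G.indicator U x ^ s = G.indicator (fun x => U x ^ s) x := fun x => by
    by_cases hx : x ∈ G <;> simp [hx, hs0]
  have hlux := luxNorm_le (N := 3 * density U G Q ^ θ * (h * avg U Q)) hA hκ hr hrs hb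
    (hu.indicator hG) (Q := Q) (by
      simp only [e, e']
      exact avg_indicator_rpow_le_of_reverse_holder hr hδ hRH hU hG hθ hI) (by
      simp only [e]
      rw [avg_indicator_eq hU]
      have h1 : density U G Q ≤ density U G Q ^ θ := by
        nth_rewrite 1 [← ENNReal.rpow_one (density U G Q)]
        exact ENNReal.rpow_le_rpow_of_exponent_ge (density_le_one _ _ _) hθ1
      refine mul_le_mul' (h1.trans (le_mul_of_one_le_left' (by norm_num))) ?_
      exact le_mul_of_one_le_left' hh)
  calc avg H Q * luxNorm A Q (G.indicator u) * volume Q.toSet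
      = (∫⁻ x in Q.toSet, H x) * luxNorm A Q (G.indicator u) := by
        rw [← avg_mul_volume H]; ring
    _ ≤ (∫⁻ x in Q.toSet, H x) * (ENNReal.ofReal (2 * (1 + b) * κ) *
        (3 * density U G Q ^ θ * (h * avg U Q))) := by gcongr
    _ = (ENNReal.ofReal (2 * (1 + b) * κ) * 3) * h * density U G Q ^ θ *
        ((∫⁻ x in Q.toSet, H x) * avg U Q) := by ring
    _ ≤ (ENNReal.ofReal (2 * (1 + b) * κ) * 3) * h * density U G Q ^ θ *
        (a * ∫⁻ x in Q.toSet, H x * U x) :=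
        mul_le_mul_right (ha.lintegral_mul_avg_le hU.aemeasurable hH Q) _
    _ = _ := by
        have : ENNReal.ofReal (2 * (1 + b) * κ) * 3 = ENNReal.ofReal (6 * (1 + b) * κ) := by
          rw [show (3 : ℝ≥0∞) = ENNReal.ofReal 3 by norm_num, ← ENNReal.ofReal_mul (by positivity)]
          ring_nf
        rw [this]; ring

end

section

variable {n : ℕ}

/-! ### Sums over nested families with a Carleson packing condition -/

/-- A dyadic weak-type estimate. Remove a cube `R` of largest side together with everything inside
it: the Carleson condition bounds this part by $\Lambda\psi(R)$, and the remaining cubes are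
disjoint from `R` by nesting and maximality. -/
theorem sum_mul_le_of_carleson (hn : 1 ≤ n) {m : Cube n → ℝ≥0∞} {Λ y : ℝ≥0∞}
    (ψ : Measure (Fin n → ℝ)) (S : Finset (Cube n))
    (hnest : ∀ P ∈ S, ∀ Q ∈ S, (P.toSet ∩ Q.toSet).Nonempty →
      P.toSet ⊆ Q.toSet ∨ Q.toSet ⊆ P.toSet)
    (hcar : ∀ R ∈ S, ∀ S' ⊆ S, (∀ Q ∈ S', Q.toSet ⊆ R.toSet) → ∑ Q ∈ S', m Q ≤ Λ * m R)
    (hψ : ∀ Q ∈ S, y * m Q ≤ ψ Q.toSet) :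
    ∑ Q ∈ S, y * m Q ≤ Λ * ψ (⋃ Q ∈ S, Q.toSet) := by
  classical
  induction S using Finset.strongInduction with
  | H S ih =>
    rcases S.eq_empty_or_nonempty with rfl | hS
    · simp
    obtain ⟨R, hR, hmax⟩ := S.exists_max_image Cube.side hS
    set S₀ := S.filter fun Q => Q.toSet ⊆ R.toSet with hS₀
    set S₁ := S.filter fun Q => ¬ Q.toSet ⊆ R.toSet with hS₁
    have hS₁S : S₁ ⊆ S := Finset.filter_subset _ _
    have hss : S₁ ⊂ S := Finset.filter_ssubset.2 ⟨R, hR, not_not.2 le_rfl⟩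
    have h0 : ∑ Q ∈ S₀, y * m Q ≤ Λ * ψ R.toSet := by
      rw [← Finset.mul_sum]
      calc y * ∑ Q ∈ S₀, m Q ≤ y * (Λ * m R) := by
            gcongr
            exact hcar R hR S₀ (Finset.filter_subset _ _) fun Q hQ => (Finset.mem_filter.1 hQ).2
        _ = Λ * (y * m R) := by ring
        _ ≤ Λ * ψ R.toSet := by
            gcongr
            exact hψ R hR
    have h1 := ih S₁ hss (fun P hP Q hQ => hnest P (hS₁S hP) Q (hS₁S hQ))
      (fun P hP S' hS' => hcar P (hS₁S hP) S' (hS'.trans hS₁S)) fun Q hQ => hψ Q (hS₁S hQ)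
    have hdisj : Disjoint R.toSet (⋃ Q ∈ S₁, Q.toSet) := by
      rw [disjoint_iUnion₂_right]
      intro Q hQ
      rw [hS₁, Finset.mem_filter] at hQ
      by_contra hne
      rw [not_disjoint_iff_nonempty_inter] at hne
      rcases hnest R hR Q hQ.1 hne with h | h
      · have := Cube.eq_of_subset_of_side_le hn h (hmax Q hQ.1)
        rw [this] at hQ
        exact hQ.2 le_rfl
      · exact hQ.2 h
    rw [← Finset.sum_filter_add_sum_filter_not S fun Q => Q.toSet ⊆ R.toSet]
    refine (add_le_add h0 h1).trans ?_
    rw [← mul_add, ← measure_union hdisj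
      (Finset.measurableSet_biUnion _ fun Q _ => Q.measurableSet)]
    refine mul_le_mul_right (measure_mono (union_subset ?_ ?_)) _
    · exact subset_iUnion₂ (s := fun (Q : Cube n) (_ : Q ∈ S) => Q.toSet) R hR
    · exact biUnion_subset_biUnion_left hS₁S

/-! ### Summation over dyadic classes under packing conditions. -/

/-- A weak-type packing condition for the level sets of `ψ / m`. -/
def Packing {ι : Type*} (S : Finset ι) (m ψ : ι → ℝ) (D : ℝ) : Prop :=
  ∀ S' ⊆ S, ∀ y : ℝ, 0 < y → (∀ Q ∈ S', y * m Q ≤ ψ Q) → ∑ Q ∈ S', y * m Q ≤ D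

variable {ι : Type*} {S T : Finset ι} {m φ ψ α : ι → ℝ} {D c β : ℝ}

theorem Packing.mono (h : Packing S m ψ D) (hT : T ⊆ S) : Packing T m ψ D :=
  fun S' hS' => h S' (hS'.trans hT)

theorem Packing.nonneg (h : Packing S m ψ D) : 0 ≤ D := by
  simpa using h ∅ (Finset.empty_subset _) 1 one_pos (by simp)

/-- Sort the cubes by the dyadic size $2^j$ of $cm/\psi$. Packing at height $c/2^{j+1}$ bounds the
sum of $\psi$ over a class by $2D$, and the extra power contributes $2^{-\beta j}$. -/
theorem Packing.sum_mul_rpow_le (h : Packing S m ψ D) (hm : ∀ Q ∈ S, 0 < m Q)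
    (hψ : ∀ Q ∈ S, 0 ≤ ψ Q) (hc : 0 < c) (hψc : ∀ Q ∈ S, ψ Q ≤ c * m Q) (hβ : 0 < β) :
    ∑ Q ∈ S, ψ Q * (ψ Q / (c * m Q)) ^ β ≤ 2 * D / (1 - 2 ^ (-β)) := by
  classical
  have hD := h.nonneg
  set b : ℝ := 2 ^ (-β) with hb
  have hb0 : 0 ≤ b := by positivity
  have hb1 : b < 1 := Real.rpow_lt_one_of_one_lt_of_neg (by norm_num) (by linarith)
  have hk : ∀ Q, ∃ k : ℕ, Q ∈ S → 0 < ψ Q →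
      2 ^ k ≤ c * m Q / ψ Q ∧ c * m Q / ψ Q < 2 ^ (k + 1) := by
    intro Q
    by_cases hQ : Q ∈ S ∧ 0 < ψ Q
    · obtain ⟨k, hk⟩ := exists_nat_pow_near ((one_le_div hQ.2).2 (hψc Q hQ.1))
        (one_lt_two (α := ℝ))
      exact ⟨k, fun _ _ => hk⟩
    · exact ⟨0, fun h1 h2 => absurd ⟨h1, h2⟩ hQ⟩
  choose k hk using hk
  set S₀ := S.filter fun Q => 0 < ψ Q with hS₀
  obtain ⟨K, hK⟩ : ∃ K, ∀ Q ∈ S₀, k Q ∈ Finset.range K :=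
    ⟨S₀.sup k + 1, fun Q hQ => Finset.mem_range.2 (Nat.lt_succ_of_le (Finset.le_sup hQ))⟩
  have hzero : ∑ Q ∈ S, ψ Q * (ψ Q / (c * m Q)) ^ β = ∑ Q ∈ S₀, ψ Q * (ψ Q / (c * m Q)) ^ β := by
    rw [hS₀, Finset.sum_filter]
    refine Finset.sum_congr rfl fun Q hQ => ?_
    split_ifs with h0
    · rfl
    · rw [le_antisymm (not_lt.1 h0) (hψ Q hQ), zero_mul]
  rw [hzero, ← Finset.sum_fiberwise_of_maps_to hK]
  have hfib : ∀ j ∈ Finset.range K,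
      ∑ Q ∈ S₀ with k Q = j, ψ Q * (ψ Q / (c * m Q)) ^ β ≤ 2 * D * b ^ j := by
    intro j _
    set F := S₀.filter fun Q => k Q = j with hF
    have hFS : F ⊆ S := (Finset.filter_subset _ _).trans (Finset.filter_subset _ _)
    set y : ℝ := c / 2 ^ (j + 1) with hy
    have hy0 : 0 < y := by positivity
    have hQs : ∀ Q ∈ F, 0 < m Q ∧ y * m Q ≤ ψ Q ∧ ψ Q ≤ 2 * (y * m Q) ∧
        (ψ Q / (c * m Q)) ^ β ≤ b ^ j := by
      intro Q hQ
      rw [hF, Finset.mem_filter, hS₀, Finset.mem_filter] at hQ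
      obtain ⟨⟨hQS, hpos⟩, rfl⟩ := hQ
      obtain ⟨h1, h2⟩ := hk Q hQS hpos
      have hmQ := hm Q hQS
      rw [le_div_iff₀ hpos] at h1
      rw [div_lt_iff₀ hpos] at h2
      have h3 : ψ Q ≤ 2 * (y * m Q) := by
        rw [hy, pow_succ]
        have : 2 * (c / (2 ^ k Q * 2) * m Q) = c * m Q / 2 ^ k Q := by field_simp
        rw [this, le_div_iff₀ (by positivity)]
        linarith
      refine ⟨hmQ, ?_, h3, ?_⟩
      · rw [hy, div_mul_eq_mul_div, div_le_iff₀ (by positivity)]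
        linarith
      · have h4 : ψ Q / (c * m Q) ≤ (2 ^ k Q : ℝ)⁻¹ := by
          rw [div_le_iff₀ (by positivity), inv_mul_eq_div, le_div_iff₀ (by positivity)]
          linarith
        calc (ψ Q / (c * m Q)) ^ β ≤ ((2 ^ k Q : ℝ)⁻¹) ^ β := by gcongr
          _ = b ^ k Q := by
            rw [hb, ← Real.rpow_natCast, ← Real.rpow_natCast, ← Real.rpow_mul (by norm_num),
              ← Real.rpow_neg (by norm_num), ← Real.rpow_mul (by norm_num)]
            ring_nf
    calc ∑ Q ∈ F, ψ Q * (ψ Q / (c * m Q)) ^ β ≤ ∑ Q ∈ F, 2 * (y * m Q) * b ^ j := by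
          refine Finset.sum_le_sum fun Q hQ => ?_
          obtain ⟨h1, h2, h3, h4⟩ := hQs Q hQ
          have : 0 ≤ ψ Q := le_trans (by positivity) h2
          gcongr
      _ = 2 * (∑ Q ∈ F, y * m Q) * b ^ j := by
          rw [Finset.mul_sum, Finset.sum_mul]
      _ ≤ 2 * D * b ^ j := by
          gcongr
          exact h F hFS y hy0 fun Q hQ => (hQs Q hQ).2.1
  refine (Finset.sum_le_sum hfib).trans ?_
  rw [← Finset.mul_sum, div_eq_mul_inv]
  refine mul_le_mul_of_nonneg_left ?_ (by positivity)
  rw [← tsum_geometric_of_lt_one hb0 hb1]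
  exact (summable_geometric_of_lt_one hb0 hb1).sum_le_tsum _ fun _ _ => by positivity

/-- Without a decaying factor each dyadic class between `c` and `L` costs $2D$; the number of
classes is the source of the logarithm. -/
theorem Packing.sum_le {L : ℝ} (h : Packing S m ψ D) (hm : ∀ Q ∈ S, 0 < m Q) (hc : 0 < c)
    (hcL : c ≤ L) (hψc : ∀ Q ∈ S, c * m Q ≤ ψ Q) (hψL : ∀ Q ∈ S, ψ Q ≤ L * m Q) :
    ∑ Q ∈ S, ψ Q ≤ 2 * D * (Real.logb 2 (L / c) + 1) := by
  classical
  have hD := h.nonneg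
  have hk : ∀ Q, ∃ k : ℕ, Q ∈ S → 2 ^ k ≤ ψ Q / (c * m Q) ∧ ψ Q / (c * m Q) < 2 ^ (k + 1) := by
    intro Q
    by_cases hQ : Q ∈ S
    · have := hm Q hQ
      obtain ⟨k, hk⟩ := exists_nat_pow_near ((one_le_div (by positivity)).2 (hψc Q hQ))
        (one_lt_two (α := ℝ))
      exact ⟨k, fun _ => hk⟩
    · exact ⟨0, fun h1 => absurd h1 hQ⟩
  choose k hk using hk
  have hlog : 0 ≤ Real.logb 2 (L / c) := Real.logb_nonneg (by norm_num) ((one_le_div hc).2 hcL)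
  set K := ⌊Real.logb 2 (L / c)⌋₊ with hK
  have hmaps : ∀ Q ∈ S, k Q ∈ Finset.range (K + 1) := by
    intro Q hQ
    rw [Finset.mem_range, Nat.lt_succ_iff, hK, Nat.le_floor_iff hlog,
      Real.le_logb_iff_rpow_le (by norm_num) (by have := hc.trans_le hcL; positivity),
      Real.rpow_natCast]
    refine (hk Q hQ).1.trans ?_
    have := hm Q hQ
    rw [div_le_div_iff₀ (by positivity) hc]
    nlinarith [hψL Q hQ]
  rw [← Finset.sum_fiberwise_of_maps_to hmaps]
  have hfib : ∀ j ∈ Finset.range (K + 1), ∑ Q ∈ S with k Q = j, ψ Q ≤ 2 * D := by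
    intro j _
    set F := S.filter fun Q => k Q = j with hF
    have hy0 : 0 < c * 2 ^ j := by positivity
    have hQs : ∀ Q ∈ F, c * 2 ^ j * m Q ≤ ψ Q ∧ ψ Q ≤ 2 * (c * 2 ^ j * m Q) := by
      intro Q hQ
      rw [hF, Finset.mem_filter] at hQ
      obtain ⟨hQS, rfl⟩ := hQ
      have hmQ := hm Q hQS
      obtain ⟨h1, h2⟩ := hk Q hQS
      rw [le_div_iff₀ (by positivity)] at h1
      rw [div_lt_iff₀ (by positivity), pow_succ] at h2
      constructor <;> linarith
    calc ∑ Q ∈ F, ψ Q ≤ ∑ Q ∈ F, 2 * (c * 2 ^ j * m Q) :=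
          Finset.sum_le_sum fun Q hQ => (hQs Q hQ).2
      _ = 2 * ∑ Q ∈ F, c * 2 ^ j * m Q := by rw [Finset.mul_sum]
      _ ≤ 2 * D := by
          gcongr
          exact h F (Finset.filter_subset _ _) _ hy0 fun Q hQ => (hQs Q hQ).1
  refine (Finset.sum_le_sum hfib).trans ?_
  rw [Finset.sum_const, Finset.card_range, nsmul_eq_mul, mul_comm]
  gcongr
  push_cast
  gcongr
  exact Nat.floor_le hlog

/-- Three ranges. If $\varphi\le c\alpha^pm$, replace $\varphi$ and sum
$\alpha^pm\cdot(\alpha^p)^{\theta/p}$ geometrically. If $c\alpha^pm<\varphi\le cm$, then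
$\alpha^\theta\le(\varphi/cm)^{\theta/p}$, again geometric. If $\varphi>cm$, use $\alpha\le1$ and
count levels up to `L`. Terms with $\alpha=0$ vanish, so the upper bound `L` is needed only where
$\alpha\ne0$. -/
theorem sum_mul_rpow_le_of_packing {D₁ D₂ L p θ : ℝ} (hp : 1 ≤ p) (hθ : 0 < θ)
    (hm : ∀ Q ∈ S, 0 < m Q) (hφ : ∀ Q ∈ S, 0 ≤ φ Q) (hα0 : ∀ Q ∈ S, 0 ≤ α Q)
    (hα1 : ∀ Q ∈ S, α Q ≤ 1) (h₁ : Packing S m φ D₁)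
    (h₂ : Packing S m (fun Q => α Q ^ p * m Q) D₂) (hc : 0 < c) (hcL : c ≤ L)
    (hφL : ∀ Q ∈ S, α Q ≠ 0 → φ Q ≤ L * m Q) :
    ∑ Q ∈ S, φ Q * α Q ^ θ ≤
      2 * D₁ * (1 / (1 - 2 ^ (-(θ / p))) + Real.logb 2 (L / c) + 1) +
        c * (2 * D₂ / (1 - 2 ^ (-(θ / p)))) := by
  classical
  have hp0 : 0 < p := by linarith
  set β := θ / p with hβ
  have hβ0 : 0 < β := by positivity
  have hαβ : ∀ Q ∈ S, α Q ^ θ = (α Q ^ p) ^ β := fun Q hQ => by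
    rw [← Real.rpow_mul (hα0 Q hQ), hβ, mul_div_cancel₀ _ hp0.ne']
  set S₁ := S.filter fun Q => φ Q ≤ c * (α Q ^ p * m Q) with hS₁
  set S₂ := S.filter fun Q => ¬ φ Q ≤ c * (α Q ^ p * m Q) ∧ φ Q ≤ c * m Q with hS₂
  set S₃ := S.filter fun Q => ¬ φ Q ≤ c * m Q ∧ α Q ≠ 0 with hS₃
  have e₁ : S₁ ⊆ S := Finset.filter_subset _ _
  have e₂ : S₂ ⊆ S := Finset.filter_subset _ _
  have e₃ : S₃ ⊆ S := Finset.filter_subset _ _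
  have b₁ : ∑ Q ∈ S₁, φ Q * α Q ^ θ ≤ c * (2 * D₂ / (1 - 2 ^ (-β))) := by
    have h := (h₂.mono e₁).sum_mul_rpow_le (c := 1) (β := β) (fun Q hQ => hm Q (e₁ hQ))
      (fun Q hQ => mul_nonneg (Real.rpow_nonneg (hα0 Q (e₁ hQ)) _) (hm Q (e₁ hQ)).le) one_pos
      (fun Q hQ => mul_le_mul_of_nonneg_right
        (Real.rpow_le_one (hα0 Q (e₁ hQ)) (hα1 Q (e₁ hQ)) hp0.le) (hm Q (e₁ hQ)).le) hβ0
    refine le_trans ?_ (mul_le_mul_of_nonneg_left h hc.le)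
    rw [Finset.mul_sum]
    refine Finset.sum_le_sum fun Q hQ => ?_
    have hQS := e₁ hQ
    have hmQ := hm Q hQS
    rw [hαβ Q hQS, one_mul, mul_div_cancel_right₀ _ hmQ.ne', ← mul_assoc]
    refine mul_le_mul_of_nonneg_right (Finset.mem_filter.1 hQ).2 ?_
    exact Real.rpow_nonneg (Real.rpow_nonneg (hα0 Q hQS) _) _
  have b₂ : ∑ Q ∈ S₂, φ Q * α Q ^ θ ≤ 2 * D₁ / (1 - 2 ^ (-β)) := by
    have h := (h₁.mono e₂).sum_mul_rpow_le (c := c) (β := β) (fun Q hQ => hm Q (e₂ hQ))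
      (fun Q hQ => hφ Q (e₂ hQ)) hc (fun Q hQ => (Finset.mem_filter.1 hQ).2.2) hβ0
    refine le_trans (Finset.sum_le_sum fun Q hQ => ?_) h
    have hQS := e₂ hQ
    have hmQ := hm Q hQS
    rw [hαβ Q hQS]
    refine mul_le_mul_of_nonneg_left ?_ (hφ Q hQS)
    refine Real.rpow_le_rpow (Real.rpow_nonneg (hα0 Q hQS) _) ?_ hβ0.le
    rw [le_div_iff₀ (by positivity)]
    linarith [not_le.1 (Finset.mem_filter.1 hQ).2.1]
  have b₃ : ∑ Q ∈ S₃, φ Q * α Q ^ θ ≤ 2 * D₁ * (Real.logb 2 (L / c) + 1) := by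
    have h := (h₁.mono e₃).sum_le (fun Q hQ => hm Q (e₃ hQ)) hc hcL
      (fun Q hQ => (not_le.1 (Finset.mem_filter.1 hQ).2.1).le)
      (fun Q hQ => hφL Q (e₃ hQ) (Finset.mem_filter.1 hQ).2.2)
    refine le_trans (Finset.sum_le_sum fun Q hQ => ?_) h
    exact mul_le_of_le_one_right (hφ Q (e₃ hQ))
      (Real.rpow_le_one (hα0 Q (e₃ hQ)) (hα1 Q (e₃ hQ)) hθ.le)
  have hsplit : ∑ Q ∈ S, φ Q * α Q ^ θ ≤ ∑ Q ∈ S₁, φ Q * α Q ^ θ + ∑ Q ∈ S₂, φ Q * α Q ^ θ +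
      ∑ Q ∈ S₃, φ Q * α Q ^ θ := by
    rw [hS₁, hS₂, hS₃, Finset.sum_filter, Finset.sum_filter, Finset.sum_filter,
      ← Finset.sum_add_distrib, ← Finset.sum_add_distrib]
    refine Finset.sum_le_sum fun Q hQ => ?_
    have h0 : 0 ≤ φ Q * α Q ^ θ := mul_nonneg (hφ Q hQ) (Real.rpow_nonneg (hα0 Q hQ) _)
    by_cases hα : α Q = 0
    · rw [hα, Real.zero_rpow hθ.ne', mul_zero]; simp
    · by_cases h3 : φ Q ≤ c * m Q
      · by_cases h1 : φ Q ≤ c * (α Q ^ p * m Q) <;> simp [h1, h3]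
      · by_cases h1 : φ Q ≤ c * (α Q ^ p * m Q) <;> simp [h1, h3, hα, h0]
  refine hsplit.trans ((add_le_add (add_le_add b₁ b₂) b₃).trans (le_of_eq ?_))
  ring

end

section

variable {n : ℕ} {U Y : (Fin n → ℝ) → ℝ≥0∞} {G : Set (Fin n → ℝ)}

/-! ### Sums over sparse families -/

/-- Sparseness for Lebesgue measure becomes a Carleson condition for `Y`:
$Y(Q)\le\eta^{-1}\int_{E_Q}M(\chi_RY)$, the sets $E_Q$ are disjoint, and the $A_\infty$ constant
controls the total. -/
theorem sum_le_of_isSparse {η : ℝ} (hη : 0 < η) (hY : IsCubeWeight Y) {S : Set (Cube n)}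
    (hS : IsSparse η S) (R : Cube n) (F : Finset (Cube n)) (hF : ↑F ⊆ S)
    (hFR : ∀ Q ∈ F, Q.toSet ⊆ R.toSet) :
    ∑ Q ∈ F, ∫⁻ x in Q.toSet, Y x ≤
      (ENNReal.ofReal η)⁻¹ * ainf Y * ∫⁻ x in R.toSet, Y x := by
  obtain ⟨E, hE, hdisj⟩ := hS
  have hη' : ENNReal.ofReal η ≠ 0 := by simpa using hη
  calc ∑ Q ∈ F, ∫⁻ x in Q.toSet, Y x
      ≤ ∑ Q ∈ F, (ENNReal.ofReal η)⁻¹ * ∫⁻ x in E Q, hlMax (R.toSet.indicator Y) x := by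
        refine Finset.sum_le_sum fun Q hQ => ?_
        obtain ⟨h1, h2, h3⟩ := hE Q (hF hQ)
        calc ∫⁻ x in Q.toSet, Y x = avg Y Q * volume Q.toSet := (avg_mul_volume Y Q).symm
          _ = (ENNReal.ofReal η)⁻¹ * (avg Y Q * (ENNReal.ofReal η * volume Q.toSet)) := by
              rw [mul_left_comm (avg Y Q), ← mul_assoc (ENNReal.ofReal η)⁻¹,
                ENNReal.inv_mul_cancel hη' ENNReal.ofReal_ne_top, one_mul]
          _ ≤ (ENNReal.ofReal η)⁻¹ * (avg Y Q * volume (E Q)) := by gcongr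
          _ ≤ _ := by
              rw [← setLIntegral_const]
              exact mul_le_mul_right (setLIntegral_mono' h1 fun x hx =>
                avg_le_hlMax_indicator Y (hFR Q hQ) (h2 hx)) _
    _ = (ENNReal.ofReal η)⁻¹ * ∫⁻ x in ⋃ Q ∈ F, E Q, hlMax (R.toSet.indicator Y) x := by
        rw [← Finset.mul_sum, lintegral_biUnion_finset]
        · exact hdisj.subset hF
        · exact fun Q hQ => (hE Q (hF hQ)).1
    _ ≤ (ENNReal.ofReal η)⁻¹ * (ainf Y * ∫⁻ x in R.toSet, Y x) := by
        refine mul_le_mul_right ((lintegral_mono_set ?_).trans (hY.lintegral_hlMax_le R)) _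
        exact iUnion₂_subset fun Q hQ => ((hE Q (hF hQ)).2.1).trans (hFR Q hQ)
    _ = _ := by ring

theorem packing_of_measure (hn : 1 ≤ n) {m : Cube n → ℝ≥0∞} (hm : ∀ Q, m Q ≠ ⊤) {Λ : ℝ}
    (hΛ : 0 ≤ Λ) (ψ : Measure (Fin n → ℝ)) (hψt : ψ univ ≠ ⊤) {F : Finset (Cube n)}
    (hnest : ∀ P ∈ F, ∀ Q ∈ F, (P.toSet ∩ Q.toSet).Nonempty →
      P.toSet ⊆ Q.toSet ∨ Q.toSet ⊆ P.toSet)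
    (hcar : ∀ R ∈ F, ∀ S' ⊆ F, (∀ Q ∈ S', Q.toSet ⊆ R.toSet) →
      ∑ Q ∈ S', m Q ≤ ENNReal.ofReal Λ * m R)
    {f : Cube n → ℝ} (hf : ∀ Q ∈ F, ENNReal.ofReal (f Q) ≤ ψ Q.toSet) :
    Packing F (fun Q => (m Q).toReal) f (Λ * (ψ univ).toReal) := by
  intro S' hS' y hy hQ
  have h := sum_mul_le_of_carleson hn (y := ENNReal.ofReal y) ψ S'
    (fun P hP Q hQ => hnest P (hS' hP) Q (hS' hQ))
    (fun R hR S'' hS'' => hcar R (hS' hR) S'' (hS''.trans hS')) (fun Q hQS => by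
      refine le_trans ?_ (hf Q (hS' hQS))
      rw [← ENNReal.ofReal_toReal (hm Q), ← ENNReal.ofReal_mul hy.le]
      exact ENNReal.ofReal_le_ofReal (hQ Q hQS))
  have h' := h.trans (mul_le_mul_right (measure_mono (subset_univ _)) _)
  have h'' := ENNReal.toReal_mono (ENNReal.mul_ne_top ENNReal.ofReal_ne_top hψt) h'
  rw [ENNReal.toReal_sum fun Q _ => ENNReal.mul_ne_top ENNReal.ofReal_ne_top (hm Q),
    ENNReal.toReal_mul, ENNReal.toReal_ofReal hΛ] at h''
  simpa only [ENNReal.toReal_mul, ENNReal.toReal_ofReal hy.le] using h''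

/-- Test the $A_p(U)$ condition on $E=Q\cap G$. The right side is a measure of `Q`, as
`packing_of_measure` requires. -/
theorem ApBound.density_rpow_mul_le {p : ℝ} (hp : 1 ≤ p) {c : ℝ≥0∞} (h : ApBound p c U Y)
    (hU : IsCubeWeight U) (hG : MeasurableSet G) (Q : Cube n) :
    density U G Q ^ p * ∫⁻ x in Q.toSet, Y x ≤ c * ∫⁻ x in Q.toSet ∩ G, Y x := by
  have hp0 : 0 < p := by linarith
  have h0 : (∫⁻ x in Q.toSet, U x) ^ p ≠ 0 := by
    simp [ENNReal.rpow_eq_zero_iff, hU.ne_zero, hU.ne_top]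
  have ht : (∫⁻ x in Q.toSet, U x) ^ p ≠ ⊤ := ENNReal.rpow_ne_top_of_nonneg hp0.le (hU.ne_top _)
  have h1 := h Q (Q.toSet ∩ G) (Q.measurableSet.inter hG) inter_subset_left
  rw [density, setLIntegral_indicator hG, inter_comm G, ENNReal.div_rpow_of_nonneg _ _ hp0.le]
  rw [← ENNReal.div_le_iff h0 ht] at h1
  refine le_trans (le_of_eq ?_) h1
  rw [div_eq_mul_inv, div_eq_mul_inv]
  ring

theorem sparse_sum_le (hn : 1 ≤ n) {p : ℝ} (hp : 1 ≤ p) {η θ : ℝ} (hη : 0 < η) (hθ : 0 < θ)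
    (hU : IsCubeWeight U) (hY : IsCubeWeight Y) {V M : ℝ} (hV : 0 ≤ V)
    (hVb : ApBound p (ENNReal.ofReal V) U Y) (hM0 : 0 ≤ M) (hM : ainf Y = ENNReal.ofReal M)
    {D S : Set (Cube n)} (hD : IsDyadicGrid D) (hSD : S ⊆ D) (hS : IsSparse η S)
    {X : (Fin n → ℝ) → ℝ≥0∞} (hX : ∫⁻ x, X x ≠ ⊤) (hG : MeasurableSet G)
    (hGY : ∫⁻ x in G, Y x ≠ ⊤) {c L : ℝ} (hc : 0 < c) (hcL : c ≤ L)
    (hGL : ∀ Q : Cube n, (Q.toSet ∩ G).Nonempty →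
      ∫⁻ x in Q.toSet, X x ≤ ENNReal.ofReal L * ∫⁻ x in Q.toSet, Y x) :
    ∑' Q : S, (∫⁻ x in Q.1.toSet, X x) * density U G Q.1 ^ θ ≤ ENNReal.ofReal
      (2 * (M / η * (∫⁻ x, X x).toReal) *
        (1 / (1 - 2 ^ (-(θ / p))) + Real.logb 2 (L / c) + 1) +
      c * (2 * (M / η * (V * (∫⁻ x in G, Y x).toReal)) / (1 - 2 ^ (-(θ / p))))) := by
  classical
  rw [ENNReal.tsum_eq_iSup_sum]
  refine iSup_le fun F' => ?_
  set F : Finset (Cube n) := F'.map (Function.Embedding.subtype _) with hF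
  have hFS : (F : Set (Cube n)) ⊆ S := by
    intro Q hQ
    simp only [hF, Finset.coe_map, mem_image] at hQ
    obtain ⟨P, -, rfl⟩ := hQ
    exact P.2
  have hsum : ∑ Q ∈ F', (∫⁻ x in Q.1.toSet, X x) * density U G Q.1 ^ θ =
      ∑ Q ∈ F, (∫⁻ x in Q.toSet, X x) * density U G Q ^ θ := by
    rw [hF, Finset.sum_map]; rfl
  rw [hsum]
  have hXQ : ∀ Q : Cube n, ∫⁻ x in Q.toSet, X x ≠ ⊤ := fun Q =>
    ne_top_of_le_ne_top hX (setLIntegral_le_lintegral _ _)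
  have hαt : ∀ Q, density U G Q ≠ ⊤ := fun Q =>
    ne_top_of_le_ne_top ENNReal.one_ne_top (density_le_one U G Q)
  have hΛ : (ENNReal.ofReal η)⁻¹ * ainf Y = ENNReal.ofReal (M / η) := by
    rw [hM, ENNReal.ofReal_div_of_pos hη, mul_comm, div_eq_mul_inv]
  obtain ⟨-, -, -, -, hnest⟩ := hD
  have hnestF : ∀ P ∈ F, ∀ Q ∈ F, (P.toSet ∩ Q.toSet).Nonempty →
      P.toSet ⊆ Q.toSet ∨ Q.toSet ⊆ P.toSet := fun P hP Q hQ =>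
    hnest P (hSD (hFS hP)) Q (hSD (hFS hQ))
  have hcar : ∀ R ∈ F, ∀ S' ⊆ F, (∀ Q ∈ S', Q.toSet ⊆ R.toSet) →
      ∑ Q ∈ S', ∫⁻ x in Q.toSet, Y x ≤ ENNReal.ofReal (M / η) * ∫⁻ x in R.toSet, Y x := by
    intro R _ S' hS' hS'R
    rw [← hΛ]
    exact sum_le_of_isSparse hη hY hS R S' (fun Q hQ => hFS (hS' hQ)) hS'R
  -- Two packings relative to the same masses $Y(Q)$: one for $\int_QX$, one for $\alpha_Q^pY(Q)$,
  -- the latter dominated by `V` times `Y` restricted to `G`.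
  have h₁ := packing_of_measure hn hY.ne_top (Λ := M / η) (by positivity) (volume.withDensity X)
    (by simpa using hX) hnestF hcar (f := fun Q => (∫⁻ x in Q.toSet, X x).toReal) (fun Q _ => by
      rw [ENNReal.ofReal_toReal (hXQ Q), withDensity_apply _ Q.measurableSet])
  rw [withDensity_apply _ MeasurableSet.univ, Measure.restrict_univ] at h₁
  have h₂ := packing_of_measure hn hY.ne_top (Λ := M / η) (by positivity)
    (ENNReal.ofReal V • (volume.withDensity Y).restrict G)
    (by
      simp only [Measure.smul_apply, Measure.restrict_apply_univ, withDensity_apply _ hG,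
        smul_eq_mul]
      exact ENNReal.mul_ne_top ENNReal.ofReal_ne_top hGY) hnestF hcar
    (f := fun Q => (density U G Q).toReal ^ p * (∫⁻ x in Q.toSet, Y x).toReal) (fun Q _ => by
      rw [ENNReal.toReal_rpow, ← ENNReal.toReal_mul, ENNReal.ofReal_toReal
        (ENNReal.mul_ne_top (ENNReal.rpow_ne_top_of_nonneg (by linarith) (hαt Q)) (hY.ne_top Q)),
        Measure.smul_apply, Measure.restrict_apply Q.measurableSet,
        withDensity_apply _ (Q.measurableSet.inter hG), smul_eq_mul]
      exact hVb.density_rpow_mul_le hp hU hG Q)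
  simp only [Measure.smul_apply, Measure.restrict_apply_univ, withDensity_apply _ hG,
    smul_eq_mul, ENNReal.toReal_mul, ENNReal.toReal_ofReal hV] at h₂
  have hmain := sum_mul_rpow_le_of_packing (c := c) (L := L) (θ := θ)
    (α := fun Q => (density U G Q).toReal) hp hθ
    (fun Q _ => ENNReal.toReal_pos (hY.ne_zero Q) (hY.ne_top Q)) (fun Q _ => ENNReal.toReal_nonneg)
    (fun Q _ => ENNReal.toReal_nonneg) (fun Q _ => by
      rw [← ENNReal.toReal_one]
      exact ENNReal.toReal_mono ENNReal.one_ne_top (density_le_one U G Q)) h₁ h₂ hc hcL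
    (fun Q _ hα => by
      have hne : (Q.toSet ∩ G).Nonempty := by
        by_contra hemp
        refine hα ?_
        rw [density, setLIntegral_indicator hG, inter_comm, not_nonempty_iff_eq_empty.1 hemp]
        simp
      have h := ENNReal.toReal_mono
        (ENNReal.mul_ne_top ENNReal.ofReal_ne_top (hY.ne_top Q)) (hGL Q hne)
      rwa [ENNReal.toReal_mul, ENNReal.toReal_ofReal (hc.le.trans hcL)] at h)
  refine le_trans (le_of_eq ?_) (ENNReal.ofReal_le_ofReal hmain)
  rw [ENNReal.ofReal_sum_of_nonneg fun Q _ =>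
    mul_nonneg ENNReal.toReal_nonneg (Real.rpow_nonneg ENNReal.toReal_nonneg _)]
  refine Finset.sum_congr rfl fun Q _ => ?_
  rw [ENNReal.toReal_rpow, ← ENNReal.toReal_mul, ENNReal.ofReal_toReal]
  exact ENNReal.mul_ne_top (hXQ Q) (ENNReal.rpow_ne_top_of_nonneg hθ.le (hαt Q))

/-! ### Numerical constants -/

/-- The argument of the logarithm is at most $C_2(KV)^{p+2}$, since $a\le K$ and the prefactor is of
order $K$. Hence its logarithm is a multiple of $\log(e+KV)$. -/
theorem exists_mixed_const_le (n : ℕ) {p b cT η β : ℝ} (hp : 1 ≤ p) (hb : 0 ≤ b) (hcT : 1 ≤ cT)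
    (hη : 0 < η) (hη1 : η ≤ 1) (hβ : 0 < β) :
    ∃ C : ℝ, 0 < C ∧ ∀ κ h h' a M V : ℝ, 1 ≤ κ → 1 ≤ h → h ≤ h' → 1 ≤ a → 1 ≤ M → 1 ≤ V →
      1 + 4 * (cT * 3 ^ n * (6 * (1 + b) * κ * (h * a))) * (M / η) *
        (1 / (1 - 2 ^ (-β)) + Real.logb 2 (V * (6 ^ n * a) ^ p /
          ((1 - 2 ^ (-β)) / (4 * (cT * 3 ^ n * (6 * (1 + b) * κ * (h * a))) * (M / η) * V))) + 1) ≤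
        C * (κ * h' * a * M * Real.log (Real.exp 1 + κ * h' * a * M * V)) := by
  set k : ℝ := 1 - 2 ^ (-β) with hk
  have hk0 : 0 < k := by
    have : (2 : ℝ) ^ (-β) < 1 := Real.rpow_lt_one_of_one_lt_of_neg (by norm_num) (by linarith)
    rw [hk]; linarith
  have hk1 : k ≤ 1 := by
    have : (0 : ℝ) < 2 ^ (-β) := by positivity
    rw [hk]; linarith
  set C₁ : ℝ := cT * 3 ^ n * (6 * (1 + b)) / η with hC₁
  have hC₁1 : 1 ≤ C₁ := by
    rw [hC₁, one_le_div hη]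
    have h3 : (1 : ℝ) ≤ 3 ^ n := one_le_pow₀ (by norm_num)
    have h4 : 1 ≤ cT * 3 ^ n := one_le_mul_of_one_le_of_one_le hcT h3
    nlinarith
  set C₂ : ℝ := 4 / k * (6 ^ n) ^ p * C₁ with hC₂
  have hC₂1 : 1 ≤ C₂ := by
    have h4 : 1 ≤ 4 / k := by rw [one_le_div hk0]; linarith
    have h6 : (1 : ℝ) ≤ (6 ^ n) ^ p :=
      Real.one_le_rpow (one_le_pow₀ (by norm_num)) (by linarith)
    exact one_le_mul_of_one_le_of_one_le (one_le_mul_of_one_le_of_one_le h4 h6) hC₁1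
  have hlC₂ : 0 ≤ Real.log C₂ := Real.log_nonneg hC₂1
  refine ⟨1 + 4 * C₁ * (1 / k + 2 * (Real.log C₂ + (p + 2)) + 1), by positivity, ?_⟩
  intro κ h h' a M V hκ hh hhh' ha hM hV
  set K := κ * h' * a * M with hK
  have hh' : 1 ≤ h' := hh.trans hhh'
  have hκh : 1 ≤ κ * h' := one_le_mul_of_one_le_of_one_le hκ hh'
  have hK1 : 1 ≤ K := one_le_mul_of_one_le_of_one_le (one_le_mul_of_one_le_of_one_le hκh ha) hM
  have haK : a ≤ K := by
    have h1 : a ≤ κ * h' * a := le_mul_of_one_le_left (by linarith) hκh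
    exact h1.trans (le_mul_of_one_le_right (by positivity) hM)
  set W := 4 * (cT * 3 ^ n * (6 * (1 + b) * κ * (h * a))) * (M / η) with hW
  have hW0 : 0 < W := by positivity
  have hWK : W ≤ 4 * C₁ * K := by
    have e : W = 4 * C₁ * (κ * h * a * M) := by rw [hW, hC₁]; field_simp
    rw [e, hK]
    gcongr
  have hKV : 1 ≤ K * V := one_le_mul_of_one_le_of_one_le hK1 hV
  set g := Real.log (Real.exp 1 + K * V) with hg
  have hg1 : 1 ≤ g := by
    rw [hg, Real.le_log_iff_exp_le (by positivity)]
    linarith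
  have hKVg : Real.log (K * V) ≤ g :=
    Real.log_le_log (by positivity) (by linarith [Real.exp_pos 1])
  set Z := V * (6 ^ n * a) ^ p / (k / (W * V)) with hZ
  have hZ0 : 0 < Z := by positivity
  have hZle : Z ≤ C₂ * (K * V) ^ (p + 2) := by
    have e : Z = (6 ^ n) ^ p * a ^ p * V * V * W / k := by
      rw [hZ, Real.mul_rpow (by positivity) (by positivity)]; field_simp
    calc Z = (6 ^ n) ^ p * a ^ p * V * V * W / k := e
      _ ≤ (6 ^ n) ^ p * (K * V) ^ p * (K * V) * V * (4 * C₁ * K) / k := by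
          gcongr
          · exact haK.trans (le_mul_of_one_le_right (by positivity) hV)
          · exact le_mul_of_one_le_left (by positivity) hK1
      _ = C₂ * ((K * V) ^ p * (K * V) ^ (2 : ℝ)) := by
          rw [hC₂, Real.rpow_two]; field_simp
      _ = _ := by rw [← Real.rpow_add (by positivity)]
  have hlogZ : Real.logb 2 Z ≤ 2 * (Real.log C₂ + (p + 2)) * g := by
    have h1 : Real.log Z ≤ Real.log C₂ + (p + 2) * Real.log (K * V) := by
      refine (Real.log_le_log hZ0 hZle).trans (le_of_eq ?_)
      rw [Real.log_mul (by positivity) (by positivity), Real.log_rpow (by positivity)]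
    have h2 : Real.log C₂ + (p + 2) * Real.log (K * V) ≤ (Real.log C₂ + (p + 2)) * g := by
      rw [add_mul]
      have := le_mul_of_one_le_right hlC₂ hg1
      have h3 : (p + 2) * Real.log (K * V) ≤ (p + 2) * g :=
        mul_le_mul_of_nonneg_left hKVg (by linarith)
      linarith
    have h4 : 1 / 2 ≤ Real.log 2 := by linarith [Real.log_two_gt_d9]
    rw [Real.logb, div_le_iff₀ (by linarith)]
    have h5 : 0 ≤ (Real.log C₂ + (p + 2)) * g := by positivity
    nlinarith
  have hk' : 0 ≤ 1 / k := by positivity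
  calc 1 + W * (1 / k + Real.logb 2 Z + 1)
      ≤ 1 + W * (1 / k * g + 2 * (Real.log C₂ + (p + 2)) * g + 1 * g) := by
        gcongr
        · exact le_mul_of_one_le_right hk' hg1
        · linarith
    _ ≤ K * g + 4 * C₁ * K * (1 / k * g + 2 * (Real.log C₂ + (p + 2)) * g + 1 * g) := by
        gcongr
        exact one_le_mul_of_one_le_of_one_le hK1 hg1
    _ = _ := by ring

end

section

variable {n : ℕ}

/-! ### The weak type estimate -/

/-- The sparse bound for a fixed function, with `H` in place of `|f|` and `t` in place of `T f`. -/
def SparseBoundAt (A : ℝ → ℝ) (c η : ℝ) (H : (Fin n → ℝ) → ℝ≥0∞) (t : (Fin n → ℝ) → ℝ) : Prop :=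
  ∀ g : (Fin n → ℝ) → ℝ, Measurable g → (∃ b : ℝ, ∀ x, |g x| ≤ b) → HasCompactSupport g →
    Integrable (fun x => t x * g x) volume →
    ∃ D S : Fin (3 ^ n) → Set (Cube n),
      (∀ j, IsDyadicGrid (D j) ∧ S j ⊆ D j ∧ IsSparse η (S j)) ∧
      ENNReal.ofReal (∫ x, t x * g x) ≤
        ENNReal.ofReal c * ∑ j, ∑' Q : S j, avg H Q.1 * luxNorm A Q.1 g * volume Q.1.toSet

variable {U Y H : (Fin n → ℝ) → ℝ≥0∞} {u v t : (Fin n → ℝ) → ℝ}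

/-- The core estimate away from the exceptional cubes. Boundedness of $u$, $t$ and `G` makes
$u\chi_G$ an admissible test function and keeps $Y(G)$ finite, so that a multiple of it can be
subtracted. -/
theorem measure_le_of_sparseBoundAt (hn : 1 ≤ n) {A : ℝ → ℝ}
    {p r κ b cT η δ θ l a h V M L : ℝ} (hp : 1 ≤ p) (hr : 1 ≤ r) (hκ : 1 ≤ κ) (hb : 0 ≤ b)
    (hcT : 1 ≤ cT) (hη : 0 < η) (hη1 : η ≤ 1) (hδ : 0 < δ) (hθ0 : 0 < θ)
    (hθ : θ * (r * (1 + δ / 2)) ≤ 1 / 4)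
    (hA : ∀ x, 0 ≤ x → A x ≤ κ ^ r * x ^ (r * (1 + δ / 2)) + b * x)
    (hum : Measurable u) (htm : Measurable t) (hu0 : ∀ x, 0 ≤ u x)
    (hv0 : ∀ x, 0 ≤ v x) (huU : ∀ x, U x = ENNReal.ofReal |u x|)
    (hYe : ∀ x, Y x = U x * ENNReal.ofReal (v x)) (hU : IsCubeWeight U) (hY : IsCubeWeight Y)
    (ha1 : 1 ≤ a) (ha : A1Bound (ENNReal.ofReal a) U)
    (hh1 : 1 ≤ h) (hRH : RHBound (2 * r - 1) (ENNReal.ofReal h) U)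
    (hV1 : 1 ≤ V) (hV : ApBound p (ENNReal.ofReal V) U Y)
    (hM1 : 1 ≤ M) (hM : ainf Y = ENNReal.ofReal M)
    (hI : ∀ Q : Cube n,
      avg (fun x => (U x ^ r) ^ (1 + δ)) Q ≤ 3 * avg (fun x => U x ^ r) Q ^ (1 + δ))
    (hH : AEMeasurable H) (hHU : ∫⁻ x, H x * U x ≠ ⊤) (hsp : SparseBoundAt A cT η H t)
    (hl : 0 < l) (hL1 : 1 ≤ L) {N : ℝ} {G : Set (Fin n → ℝ)} (hG : MeasurableSet G)
    {R : Cube n} (hGR : G ⊆ R.toSet) (hGu : ∀ x ∈ G, u x ≤ N) (hGt : ∀ x ∈ G, t x ≤ N)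
    (hGl : ∀ x ∈ G, l * v x < t x)
    (hGL : ∀ Q : Cube n, (Q.toSet ∩ G).Nonempty →
      ∫⁻ x in Q.toSet, H x * U x ≤ ENNReal.ofReal (l * L) * ∫⁻ x in Q.toSet, Y x) :
    ENNReal.ofReal l * ∫⁻ x in G, Y x ≤
      ENNReal.ofReal (4 * (cT * 3 ^ n * (6 * (1 + b) * κ * (h * a))) * (M / η) *
        (1 / (1 - 2 ^ (-(θ / p))) + Real.logb 2 (L / ((1 - 2 ^ (-(θ / p))) /
          (4 * (cT * 3 ^ n * (6 * (1 + b) * κ * (h * a))) * (M / η) * V))) + 1)) *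
        ∫⁻ x, H x * U x := by
  have hGY : ∫⁻ x in G, Y x ≠ ⊤ := ne_top_of_le_ne_top (hY.ne_top R) (lintegral_mono_set hGR)
  have hGt0 : ∀ x ∈ G, 0 < t x := fun x hx =>
    (mul_nonneg hl.le (hv0 x)).trans_lt (hGl x hx)
  set g := G.indicator u with hg
  have hgm : Measurable g := hum.indicator hG
  have hgN : ∀ x, |g x| ≤ |N| := fun x => by
    by_cases hx : x ∈ G
    · rw [hg, indicator_of_mem hx, abs_of_nonneg (hu0 x)]
      exact (hGu x hx).trans (le_abs_self N)
    · rw [hg, indicator_of_notMem hx, abs_zero]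
      exact abs_nonneg N
  have hgc : HasCompactSupport g :=
    HasCompactSupport.intro (isCompact_closedBall R.center (R.side / 2)) fun x hx =>
      indicator_of_notMem (fun hxG => hx (R.subset_closedBall (hGR hxG))) _
  have htg : Integrable fun x => t x * g x := by
    have hsupp : Function.support (fun x => t x * g x) ⊆ R.toSet := fun x hx => by
      by_contra hxR
      refine hx ?_
      simp only
      rw [hg, indicator_of_notMem fun hxG => hxR (hGR hxG), mul_zero]
    rw [← integrableOn_iff_integrable_of_support_subset hsupp]
    refine Measure.integrableOn_of_bounded (M := |N| * |N|) R.volume_ne_top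
      (htm.mul hgm).aestronglyMeasurable (Eventually.of_forall fun x => ?_)
    rw [norm_mul, Real.norm_eq_abs, Real.norm_eq_abs]
    by_cases hx : x ∈ G
    · refine mul_le_mul ?_ (hgN x) (abs_nonneg _) (abs_nonneg _)
      rw [abs_of_pos (hGt0 x hx)]
      exact (hGt x hx).trans (le_abs_self N)
    · rw [hg, indicator_of_notMem hx, abs_zero, mul_zero]
      positivity
  obtain ⟨D, S, hDS, hbound⟩ := hsp g hgm ⟨_, hgN⟩ hgc htg
  have hlow : ENNReal.ofReal l * ∫⁻ x in G, Y x ≤ ENNReal.ofReal (∫ x, t x * g x) := by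
    rw [ofReal_integral_eq_lintegral_ofReal htg (Eventually.of_forall fun x => by
      by_cases hx : x ∈ G
      · simp only [hg, indicator_of_mem hx]
        exact mul_nonneg (hGt0 x hx).le (hu0 x)
      · simp [hg, hx]), ← lintegral_const_mul' _ _ ENNReal.ofReal_ne_top,
      ← lintegral_indicator hG]
    refine lintegral_mono fun x => ?_
    by_cases hx : x ∈ G
    · simp only [hg, indicator_of_mem hx]
      rw [hYe, huU, abs_of_nonneg (hu0 x), ← ENNReal.ofReal_mul (hu0 x), ← ENNReal.ofReal_mul hl.le]
      refine ENNReal.ofReal_le_ofReal ?_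
      have := mul_le_mul_of_nonneg_right (hGl x hx).le (hu0 x)
      linarith
    · simp [hx]
  set k : ℝ := 1 - 2 ^ (-(θ / p)) with hk
  have hk0 : 0 < k := by
    have : (2 : ℝ) ^ (-(θ / p)) < 1 := Real.rpow_lt_one_of_one_lt_of_neg (by norm_num)
      (neg_neg_of_pos (by positivity))
    rw [hk]; linarith
  have hk1 : k ≤ 1 := by
    have : (0 : ℝ) < 2 ^ (-(θ / p)) := by positivity
    rw [hk]; linarith
  set B₀ : ℝ := 6 * (1 + b) * κ * (h * a) with hB₀
  set B : ℝ := cT * 3 ^ n * B₀ with hB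
  set Λ : ℝ := M / η with hΛ
  have hκ0 : 0 < κ := by linarith
  have hB₀1 : 1 ≤ B₀ := by
    have h1 : 1 ≤ h * a := one_le_mul_of_one_le_of_one_le hh1 ha1
    have h2 : 1 ≤ 6 * (1 + b) := by linarith
    exact one_le_mul_of_one_le_of_one_le (one_le_mul_of_one_le_of_one_le h2 hκ) h1
  have hB1 : 1 ≤ B := one_le_mul_of_one_le_of_one_le
    (one_le_mul_of_one_le_of_one_le hcT (one_le_pow₀ (by norm_num))) hB₀1
  have hΛ1 : 1 ≤ Λ := by rw [hΛ, one_le_div hη]; linarith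
  -- Chosen so that the lowest range of the sparse sum contributes exactly $\lambda Y(G)/2$
  -- (`habs`), which moves to the left side. The factor $3^n$ in `B` counts the sparse families.
  set c₀ : ℝ := k / (4 * B * Λ * V) with hc₀
  have hBΛV : 1 ≤ 4 * B * Λ * V := one_le_mul_of_one_le_of_one_le
    (one_le_mul_of_one_le_of_one_le (by linarith) hΛ1) hV1
  have hc₀0 : 0 < c₀ := by positivity
  have hc₀L : c₀ ≤ L := by
    refine le_trans ?_ hL1
    rw [hc₀, div_le_one (by positivity)]
    linarith
  set Φ := (∫⁻ x, H x * U x).toReal with hΦ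
  set μ := (∫⁻ x in G, Y x).toReal with hμ
  have hμ0 : 0 ≤ μ := ENNReal.toReal_nonneg
  have hΦ0 : 0 ≤ Φ := ENNReal.toReal_nonneg
  have hlog : 0 ≤ Real.logb 2 (L / c₀) :=
    Real.logb_nonneg (by norm_num) ((one_le_div hc₀0).2 hc₀L)
  set X := 2 * (Λ * Φ) * (1 / k + Real.logb 2 (L / c₀) + 1) +
    l * c₀ * (2 * (Λ * (V * μ)) / k) with hX
  have hX0 : 0 ≤ X := by positivity
  have hterm : ∀ j, ∑' Q : S j, avg H Q.1 * luxNorm A Q.1 g * volume Q.1.toSet ≤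
      ENNReal.ofReal B₀ * ENNReal.ofReal X := by
    intro j
    have h1 := sparse_sum_le hn hp hη hθ0 hU hY (by linarith) hV (by linarith) hM (hDS j).1
      (hDS j).2.1 (hDS j).2.2 hHU hG hGY (c := l * c₀) (L := l * L) (by positivity)
      (mul_le_mul_of_nonneg_left hc₀L hl.le) hGL
    rw [mul_div_mul_left _ _ hl.ne'] at h1
    refine le_trans ?_ (mul_le_mul_right h1 _)
    rw [← ENNReal.tsum_mul_left]
    refine ENNReal.tsum_le_tsum fun Q => ?_
    have h2 := sparse_term_le hκ hr hb hδ hA hum huU ha hRH hU hθ0.le hθ hG (hI Q.1) hH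
    rwa [← ENNReal.ofReal_mul (by linarith), ← ENNReal.ofReal_mul (by positivity)] at h2
  have htot : l * μ ≤ B * X := by
    have h1 : ENNReal.ofReal (l * μ) ≤ ENNReal.ofReal (B * X) := by
      calc ENNReal.ofReal (l * μ) = ENNReal.ofReal l * ∫⁻ x in G, Y x := by
            rw [ENNReal.ofReal_mul hl.le, hμ, ENNReal.ofReal_toReal hGY]
        _ ≤ _ := hlow.trans hbound
        _ ≤ ENNReal.ofReal cT * ∑ _j : Fin (3 ^ n), ENNReal.ofReal B₀ * ENNReal.ofReal X :=
            mul_le_mul_right (Finset.sum_le_sum fun j _ => hterm j) _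
        _ = ENNReal.ofReal (B * X) := by
            rw [Finset.sum_const, Finset.card_univ, Fintype.card_fin, nsmul_eq_mul,
              show B * X = cT * (((3 ^ n : ℕ) : ℝ) * (B₀ * X)) by rw [hB]; push_cast; ring,
              ENNReal.ofReal_mul (p := cT) (by linarith),
              ENNReal.ofReal_mul (p := ((3 ^ n : ℕ) : ℝ)) (Nat.cast_nonneg _),
              ENNReal.ofReal_mul (p := B₀) (by linarith), ENNReal.ofReal_natCast]
    exact (ENNReal.ofReal_le_ofReal_iff (by positivity)).1 h1
  have habs : B * (l * c₀ * (2 * (Λ * (V * μ)) / k)) = l * μ / 2 := by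
    rw [hc₀]
    field_simp
    ring
  have hfin : l * μ ≤ 4 * B * Λ * (1 / k + Real.logb 2 (L / c₀) + 1) * Φ := by
    have : B * X = 2 * B * Λ * (1 / k + Real.logb 2 (L / c₀) + 1) * Φ + l * μ / 2 := by
      rw [hX, mul_add, habs]; ring
    linarith
  have e1 : ENNReal.ofReal l * ∫⁻ x in G, Y x = ENNReal.ofReal (l * μ) := by
    rw [ENNReal.ofReal_mul hl.le, hμ, ENNReal.ofReal_toReal hGY]
  have e2 : ∫⁻ x, H x * U x = ENNReal.ofReal Φ := (ENNReal.ofReal_toReal hHU).symm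
  rw [e1, e2, ← ENNReal.ofReal_mul (by positivity)]
  exact ENNReal.ofReal_le_ofReal hfin

/-- A cube centred near the origin. -/
noncomputable def bigCube (n N : ℕ) : Cube n := ⟨fun _ => -N, 2 * N + 1, by positivity⟩

theorem bigCube_mono {N N' : ℕ} (h : N ≤ N') : (bigCube n N).toSet ⊆ (bigCube n N').toSet := by
  intro x hx i
  have h' : (N : ℝ) ≤ N' := by exact_mod_cast h
  have := hx i
  simp only [bigCube] at this ⊢
  constructor <;> linarith

theorem exists_mem_bigCube (x : Fin n → ℝ) : ∃ N : ℕ, x ∈ (bigCube n N).toSet := by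
  obtain ⟨N, hN⟩ := exists_nat_ge ‖x‖
  refine ⟨N, fun i => ?_⟩
  have h := abs_le.1 ((Real.norm_eq_abs (x i) ▸ norm_le_pi_norm x i).trans hN)
  simp only [bigCube]
  constructor <;> linarith

/-- The summand 1 in the constant pays for the exceptional set `Ω`; the rest of the level set is
exhausted by the truncations `G N`, with bounds independent of `N`. -/
theorem weak_type_of_sparseBoundAt (hn : 1 ≤ n) {A : ℝ → ℝ}
    {p r κ b cT η δ θ l a h V M : ℝ} (hp : 1 ≤ p) (hr : 1 ≤ r) (hκ : 1 ≤ κ) (hb : 0 ≤ b)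
    (hcT : 1 ≤ cT) (hη : 0 < η) (hη1 : η ≤ 1) (hδ : 0 < δ) (hθ0 : 0 < θ)
    (hθ : θ * (r * (1 + δ / 2)) ≤ 1 / 4)
    (hA : ∀ x, 0 ≤ x → A x ≤ κ ^ r * x ^ (r * (1 + δ / 2)) + b * x)
    (hum : Measurable u) (hvm : Measurable v) (htm : Measurable t) (hu0 : ∀ x, 0 ≤ u x)
    (hv0 : ∀ x, 0 ≤ v x) (huU : ∀ x, U x = ENNReal.ofReal |u x|)
    (hYe : ∀ x, Y x = U x * ENNReal.ofReal (v x)) (hU : IsCubeWeight U) (hY : IsCubeWeight Y)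
    (ha1 : 1 ≤ a) (ha : A1Bound (ENNReal.ofReal a) U)
    (hh1 : 1 ≤ h) (hRH : RHBound (2 * r - 1) (ENNReal.ofReal h) U)
    (hV1 : 1 ≤ V) (hV : ApBound p (ENNReal.ofReal V) U Y)
    (hM1 : 1 ≤ M) (hM : ainf Y = ENNReal.ofReal M)
    (hI : ∀ Q : Cube n,
      avg (fun x => (U x ^ r) ^ (1 + δ)) Q ≤ 3 * avg (fun x => U x ^ r) Q ^ (1 + δ))
    (hH : AEMeasurable H) (hHU : ∫⁻ x, H x * U x ≠ ⊤) (hsp : SparseBoundAt A cT η H t)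
    (hl : 0 < l) :
    (volume.withDensity Y) {x | l * v x < t x} ≤
      ENNReal.ofReal (1 + 4 * (cT * 3 ^ n * (6 * (1 + b) * κ * (h * a))) * (M / η) *
        (1 / (1 - 2 ^ (-(θ / p))) + Real.logb 2 (V * (6 ^ n * a) ^ p /
          ((1 - 2 ^ (-(θ / p))) /
          (4 * (cT * 3 ^ n * (6 * (1 + b) * κ * (h * a))) * (M / η) * V))) + 1)) *
        ((∫⁻ x, H x * U x) / ENNReal.ofReal l) := by
  set L : ℝ := V * (6 ^ n * a) ^ p with hL
  have h6a : (1 : ℝ) ≤ 6 ^ n * a :=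
    one_le_mul_of_one_le_of_one_le (one_le_pow₀ (by norm_num)) ha1
  have hL1 : 1 ≤ L := one_le_mul_of_one_le_of_one_le hV1 (Real.one_le_rpow h6a (by linarith))
  set W := 4 * (cT * 3 ^ n * (6 * (1 + b) * κ * (h * a))) * (M / η) *
        (1 / (1 - 2 ^ (-(θ / p))) + Real.logb 2 (L / ((1 - 2 ^ (-(θ / p))) /
          (4 * (cT * 3 ^ n * (6 * (1 + b) * κ * (h * a))) * (M / η) * V))) + 1) with hW
  set Φ := ∫⁻ x, H x * U x with hΦ
  set ν := volume.withDensity Y with hν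
  have hl' : ENNReal.ofReal l ≠ 0 := by simpa using hl
  set F : Set (Cube n) :=
    {Q | ENNReal.ofReal (l * L) * ∫⁻ x in Q.toSet, Y x < ∫⁻ x in Q.toSet, H x * U x} with hF
  -- A measurable hull replaces a possibly uncountable union of cubes.
  set Ω : Set (Fin n → ℝ) := toMeasurable ν (⋃ Q ∈ F, Q.toSet) with hΩ
  have hΩm : MeasurableSet Ω := measurableSet_toMeasurable _ _
  have hlL : ENNReal.ofReal (l * L) ≠ 0 := by simp; positivity
  have hdil : ENNReal.ofReal V * (6 ^ n * ENNReal.ofReal a) ^ p = ENNReal.ofReal L := by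
    rw [hL, ENNReal.ofReal_mul (by linarith), ← ENNReal.ofReal_rpow_of_pos (by linarith),
      ENNReal.ofReal_mul (by positivity), ENNReal.ofReal_pow (by norm_num)]
    norm_num
  -- The threshold contains the doubling constant `L`, which therefore cancels.
  have hΩν : ν Ω ≤ Φ / ENNReal.ofReal l := by
    rw [hΩ, measure_toMeasurable]
    have h1 := measure_iUnion_le_of_doubling ν
      ((ENNReal.ofReal (l * L))⁻¹ • volume.withDensity fun x => H x * U x) (ENNReal.ofReal L)
      (fun Q => by
        rw [hν, withDensity_apply _ Q.measurableSet, withDensity_apply _ Q.dilate.measurableSet,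
          ← hdil]
        exact hV.lintegral_dilate_le hp hU ha Q) F (fun Q hQ => by
        rw [Measure.smul_apply, hν, withDensity_apply _ Q.measurableSet,
          withDensity_apply _ Q.measurableSet, smul_eq_mul]
        have hQ' : ENNReal.ofReal (l * L) * ∫⁻ x in Q.toSet, Y x < ∫⁻ x in Q.toSet, H x * U x := hQ
        calc ∫⁻ x in Q.toSet, Y x = (ENNReal.ofReal (l * L))⁻¹ *
              (ENNReal.ofReal (l * L) * ∫⁻ x in Q.toSet, Y x) := by
              rw [← mul_assoc, ENNReal.inv_mul_cancel hlL ENNReal.ofReal_ne_top, one_mul]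
          _ ≤ _ := mul_le_mul_right hQ'.le _)
    refine h1.trans (le_of_eq ?_)
    rw [Measure.smul_apply, withDensity_apply _ MeasurableSet.univ, Measure.restrict_univ,
      smul_eq_mul, ENNReal.ofReal_mul hl.le, ENNReal.mul_inv (Or.inl hl')
      (Or.inl ENNReal.ofReal_ne_top), ← hΦ, ENNReal.div_eq_inv_mul]
    have hL0 : ENNReal.ofReal L ≠ 0 := by simp; linarith
    calc ENNReal.ofReal L * ((ENNReal.ofReal l)⁻¹ * (ENNReal.ofReal L)⁻¹ * Φ)
        = (ENNReal.ofReal L * (ENNReal.ofReal L)⁻¹) * ((ENNReal.ofReal l)⁻¹ * Φ) := by ring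
      _ = _ := by rw [ENNReal.mul_inv_cancel hL0 ENNReal.ofReal_ne_top, one_mul]
  let G : ℕ → Set (Fin n → ℝ) := fun N =>
    ((({x | l * v x < t x} ∩ {x | u x ≤ N}) ∩ {x | t x ≤ N}) ∩ (bigCube n N).toSet) \ Ω
  have hGm : ∀ N, MeasurableSet (G N) := fun N =>
    ((((measurableSet_lt (hvm.const_mul l) htm).inter (measurableSet_le hum measurable_const)).inter
      (measurableSet_le htm measurable_const)).inter (bigCube n N).measurableSet).diff hΩm
  have hGν : ∀ N, ν (G N) ≤ ENNReal.ofReal W * (Φ / ENNReal.ofReal l) := by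
    intro N
    have h1 := measure_le_of_sparseBoundAt hn hp hr hκ hb hcT hη hη1 hδ hθ0 hθ hA hum htm hu0
      hv0 huU hYe hU hY ha1 ha hh1 hRH hV1 hV hM1 hM hI hH hHU hsp hl hL1 (N := N) (hGm N)
      (R := bigCube n N) (fun x hx => hx.1.2) (fun x hx => hx.1.1.1.2) (fun x hx => hx.1.1.2)
      (fun x hx => hx.1.1.1.1) (fun Q ⟨x, hxQ, hxG⟩ => by
        by_contra hlt
        refine hxG.2 (subset_toMeasurable _ _ (mem_iUnion₂.2 ⟨Q, not_le.1 hlt, hxQ⟩)))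
    rw [hν, withDensity_apply _ (hGm N), ← mul_div_assoc,
      ENNReal.le_div_iff_mul_le (Or.inl hl') (Or.inl ENNReal.ofReal_ne_top), mul_comm]
    exact h1
  have hcov : {x | l * v x < t x} ⊆ Ω ∪ ⋃ N, G N := by
    intro x hx
    by_cases hxΩ : x ∈ Ω
    · exact Or.inl hxΩ
    refine Or.inr (mem_iUnion.2 ?_)
    obtain ⟨N₁, h1⟩ := exists_nat_ge (u x)
    obtain ⟨N₂, h2⟩ := exists_nat_ge (t x)
    obtain ⟨N₃, h3⟩ := exists_mem_bigCube x
    refine ⟨max N₁ (max N₂ N₃), ⟨⟨⟨hx, ?_⟩, ?_⟩, ?_⟩, hxΩ⟩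
    · exact h1.trans (by exact_mod_cast le_max_left _ _)
    · exact h2.trans (by exact_mod_cast (le_max_left _ _).trans (le_max_right _ _))
    · exact bigCube_mono ((le_max_right _ _).trans (le_max_right _ _)) h3
  have hGmono : Monotone G := by
    intro N N' hNN'
    have h' : (N : ℝ) ≤ N' := by exact_mod_cast hNN'
    rintro x ⟨⟨⟨⟨h1, h2⟩, h3⟩, h4⟩, h5⟩
    exact ⟨⟨⟨⟨h1, le_trans h2 h'⟩, le_trans h3 h'⟩, bigCube_mono hNN' h4⟩, h5⟩
  have hUν : ν (⋃ N, G N) ≤ ENNReal.ofReal W * (Φ / ENNReal.ofReal l) := by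
    rw [hGmono.measure_iUnion]
    exact iSup_le hGν
  calc ν {x | l * v x < t x} ≤ ν Ω + ν (⋃ N, G N) := (measure_mono hcov).trans (measure_union_le _ _)
    _ ≤ Φ / ENNReal.ofReal l + ENNReal.ofReal W * (Φ / ENNReal.ofReal l) := add_le_add hΩν hUν
    _ = (1 + ENNReal.ofReal W) * (Φ / ENNReal.ofReal l) := by ring
    _ = ENNReal.ofReal (1 + W) * (Φ / ENNReal.ofReal l) := by
        rw [ENNReal.ofReal_add zero_le_one, ENNReal.ofReal_one]
        have hk1 : (2 : ℝ) ^ (-(θ / p)) < 1 := Real.rpow_lt_one_of_one_lt_of_neg (by norm_num)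
          (neg_neg_of_pos (by positivity))
        have hk0 : (0 : ℝ) < 2 ^ (-(θ / p)) := by positivity
        have hk : 0 < 1 - (2 : ℝ) ^ (-(θ / p)) := by linarith
        have hκ0 : 0 < κ := by linarith
        have h2 : 1 ≤ 6 * (1 + b) := by linarith
        have hB : 1 ≤ 4 * (cT * 3 ^ n * (6 * (1 + b) * κ * (h * a))) * (M / η) * V := by
          have h3 : (1 : ℝ) ≤ cT * 3 ^ n :=
            one_le_mul_of_one_le_of_one_le hcT (one_le_pow₀ (by norm_num))
          have h4 : 1 ≤ 6 * (1 + b) * κ * (h * a) := one_le_mul_of_one_le_of_one_le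
            (one_le_mul_of_one_le_of_one_le h2 hκ) (one_le_mul_of_one_le_of_one_le hh1 ha1)
          have h5 : 1 ≤ M / η := by rw [one_le_div hη]; linarith
          have h6 := one_le_mul_of_one_le_of_one_le h3 h4
          exact one_le_mul_of_one_le_of_one_le
            (one_le_mul_of_one_le_of_one_le (by linarith) h5) hV1
        have hlog : 0 ≤ Real.logb 2 (L / ((1 - 2 ^ (-(θ / p))) /
          (4 * (cT * 3 ^ n * (6 * (1 + b) * κ * (h * a))) * (M / η) * V))) := by
          refine Real.logb_nonneg (by norm_num) ((one_le_div (by positivity)).2 (le_trans ?_ hL1))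
          rw [div_le_one (by positivity)]
          linarith
        positivity

end

section

variable {n : ℕ} {u v w : (Fin n → ℝ) → ℝ} {U V Y W : (Fin n → ℝ) → ℝ≥0∞}

/-! ### Weights with real values -/

theorem wavg_one (h : (Fin n → ℝ) → ℝ) (Q : Cube n) :
    wavg (fun _ => 1) h Q = avg (fun x => ENNReal.ofReal |h x|) Q := by
  simp [wavg, avg]

theorem maximal_one (h : (Fin n → ℝ) → ℝ) :
    maximal (fun _ => 1) h = hlMax fun x => ENNReal.ofReal |h x| := by
  ext x
  simp only [maximal, hlMax, wavg_one]

theorem avg_congr {f g : (Fin n → ℝ) → ℝ≥0∞} (h : f =ᵐ[volume] g) (Q : Cube n) :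
    avg f Q = avg g Q := by
  rw [avg, avg, lintegral_congr_ae (ae_restrict_of_ae h)]

theorem hlMax_congr {f g : (Fin n → ℝ) → ℝ≥0∞} (h : f =ᵐ[volume] g) : hlMax f = hlMax g := by
  ext x
  simp only [hlMax, avg_congr h]

theorem ainfConst_eq (hw : ∀ᵐ x, 0 < w x) (hW : W =ᵐ[volume] fun x => ENNReal.ofReal (w x)) :
    ainfConst w = ainf W := by
  rw [ainfConst, ainf]
  refine iSup_congr fun Q => ?_
  congr 1
  · rw [maximal_one]
    refine lintegral_congr fun x => ?_
    refine congrFun (hlMax_congr ?_) x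
    filter_upwards [hw, hW] with y hy hyW
    by_cases hyQ : y ∈ Q.toSet
    · rw [indicator_of_mem hyQ, indicator_of_mem hyQ, hyW, abs_of_pos hy]
    · simp [hyQ]
  · exact (lintegral_congr_ae (ae_restrict_of_ae hW)).symm

theorem setLIntegral_ne_zero_of_ae {f : (Fin n → ℝ) → ℝ≥0∞} (hf : AEMeasurable f)
    (h : ∀ᵐ x, f x ≠ 0) (Q : Cube n) : ∫⁻ x in Q.toSet, f x ≠ 0 := by
  rw [Ne, lintegral_eq_zero_iff' hf.restrict]
  intro h0
  have h1 : ∀ᵐ x ∂volume.restrict Q.toSet, False := by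
    filter_upwards [h0, ae_restrict_of_ae h] with x h2 h3 using h3 h2
  rw [ae_iff] at h1
  simp only [not_false_eq_true, ofPred_true, Measure.restrict_apply_univ] at h1
  exact Q.volume_pos h1

theorem IsWeight.aemeasurable (hu : IsWeight u) : AEMeasurable u :=
  hu.1.aestronglyMeasurable.aemeasurable

theorem IsWeight.isCubeWeight (hu : IsWeight u)
    (hU : U =ᵐ[volume] fun x => ENNReal.ofReal (u x)) : IsCubeWeight U := by
  have hm : AEMeasurable U := hu.aemeasurable.ennreal_ofReal.congr hU.symm
  refine ⟨hm, setLIntegral_ne_zero_of_ae hm ?_, fun Q => ?_⟩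
  · filter_upwards [hu.2, hU] with x hx hxU
    rw [hxU]
    simpa using hx
  · rw [lintegral_congr_ae (ae_restrict_of_ae hU)]
    have h1 : IntegrableOn u Q.toSet :=
      (hu.1.integrableOn_isCompact (isCompact_closedBall Q.center (Q.side / 2))).mono_set
        Q.subset_closedBall
    exact h1.lintegral_lt_top.ne

theorem IsWeight.a1Bound (hu : IsWeight u) (hU : U =ᵐ[volume] fun x => ENNReal.ofReal (u x)) :
    A1Bound (a1Const u) U := by
  have h : a1Const u = essSup (fun x => maximal (fun _ => 1) u x / ENNReal.ofReal (u x)) volume := by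
    rw [a1Const, apConst, if_pos rfl]
  have hmax : maximal (fun _ => 1) u = hlMax U := by
    rw [maximal_one]
    refine hlMax_congr ?_
    filter_upwards [hu.2, hU] with x hx hxU
    rw [hxU, abs_of_pos hx]
  rw [A1Bound, h]
  filter_upwards [ENNReal.ae_le_essSup
    (fun x => maximal (fun _ => 1) u x / ENNReal.ofReal (u x)), hu.2, hU] with x hx hx0 hxU
  rw [hmax, ← hxU, ENNReal.div_le_iff_le_mul] at hx
  · rwa [hmax]
  · left; rw [hxU]; simpa using hx0
  · left; rw [hxU]; exact ENNReal.ofReal_ne_top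

theorem IsWeight.rhBound (hu : IsWeight u) (hU : U =ᵐ[volume] fun x => ENNReal.ofReal (u x))
    {q : ℝ} (hq : 0 < q) : RHBound q (rhConst q u) U := by
  intro Q
  have hcw := hu.isCubeWeight hU
  have h1 : wavg (fun _ => 1) u Q = avg U Q := by
    rw [wavg_one]
    refine avg_congr ?_ Q
    filter_upwards [hu.2, hU] with x hx hxU
    rw [hxU, abs_of_pos hx]
  have h2 : wavg (fun _ => 1) (fun x => u x ^ q) Q = avg (fun x => U x ^ q) Q := by
    rw [wavg_one]
    refine avg_congr ?_ Q
    filter_upwards [hu.2, hU] with x hx hxU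
    rw [hxU, abs_of_pos (Real.rpow_pos_of_pos hx q), ENNReal.ofReal_rpow_of_pos hx]
  have h3 : avg (fun x => U x ^ q) Q ^ (1 / q) / avg U Q ≤ rhConst q u := by
    rw [← h1, ← h2]
    exact le_iSup (fun Q : Cube n => wavg (fun _ => 1) (fun x => u x ^ q) Q ^ (1 / q) /
      wavg (fun _ => 1) u Q) Q
  rw [ENNReal.div_le_iff (hcw.avg_ne_zero Q) (hcw.avg_ne_top Q)] at h3
  have h4 := ENNReal.rpow_le_rpow h3 hq.le
  rwa [← ENNReal.rpow_mul, one_div_mul_cancel hq.ne', ENNReal.rpow_one] at h4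

/-- Hölder for $U=(UV)^{1/p}(V^{-1/(p-1)}U)^{(p-1)/p}$, valid where $0<V<\infty$. Only the dual
factor is enlarged from `E` to `F`. -/
theorem lintegral_rpow_mul_le {p : ℝ} (hp : 1 < p) (hU : AEMeasurable U) (hV : AEMeasurable V)
    (hV0 : ∀ᵐ x, V x ≠ 0) (hVt : ∀ᵐ x, V x ≠ ⊤) {E F : Set (Fin n → ℝ)} (hEF : E ⊆ F) :
    (∫⁻ x in E, U x) ^ p ≤ (∫⁻ x in E, U x * V x) *
      (∫⁻ x in F, V x ^ (-(1 / (p - 1))) * U x) ^ (p - 1) := by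
  have hp0 : 0 < p := by linarith
  have hp1 : 0 < p - 1 := by linarith
  have h := ENNReal.lintegral_mul_norm_pow_le (μ := volume.restrict E)
    (f := fun x => U x * V x) (g := fun x => V x ^ (-(1 / (p - 1))) * U x)
    (hU.mul hV).restrict ((hV.pow_const _).mul hU).restrict
    (p := 1 / p) (q := (p - 1) / p) (by positivity) (by positivity) (by field_simp; ring)
  have e : ∀ᵐ x, (U x * V x) ^ (1 / p) * (V x ^ (-(1 / (p - 1))) * U x) ^ ((p - 1) / p) = U x := by
    filter_upwards [hV0, hVt] with x h0 ht
    rw [ENNReal.mul_rpow_of_nonneg _ _ (by positivity),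
      ENNReal.mul_rpow_of_nonneg _ _ (by positivity), ← ENNReal.rpow_mul,
      show -(1 / (p - 1)) * ((p - 1) / p) = -(1 / p) by field_simp]
    calc U x ^ (1 / p) * V x ^ (1 / p) * (V x ^ (-(1 / p)) * U x ^ ((p - 1) / p))
        = (V x ^ (1 / p) * V x ^ (-(1 / p))) * (U x ^ (1 / p) * U x ^ ((p - 1) / p)) := by ring
      _ = U x := by
        rw [← ENNReal.rpow_add _ _ h0 ht, ← ENNReal.rpow_add_of_nonneg _ _ (by positivity)
          (by positivity), show 1 / p + (p - 1) / p = 1 by field_simp; ring]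
        simp
  rw [lintegral_congr_ae (ae_restrict_of_ae e)] at h
  calc (∫⁻ x in E, U x) ^ p
      ≤ ((∫⁻ x in E, U x * V x) ^ (1 / p) *
        (∫⁻ x in E, V x ^ (-(1 / (p - 1))) * U x) ^ ((p - 1) / p)) ^ p := by gcongr
    _ = (∫⁻ x in E, U x * V x) * (∫⁻ x in E, V x ^ (-(1 / (p - 1))) * U x) ^ (p - 1) := by
        rw [ENNReal.mul_rpow_of_nonneg _ _ hp0.le, ← ENNReal.rpow_mul, ← ENNReal.rpow_mul,
          one_div_mul_cancel hp0.ne', div_mul_cancel₀ _ hp0.ne', ENNReal.rpow_one]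
    _ ≤ _ := by
        refine mul_le_mul_right (ENNReal.rpow_le_rpow (lintegral_mono_set hEF) hp1.le) _

theorem wavg_eq (hU : U =ᵐ[volume] fun x => ENNReal.ofReal (u x))
    {f : (Fin n → ℝ) → ℝ} {F : (Fin n → ℝ) → ℝ≥0∞}
    (hF : F =ᵐ[volume] fun x => ENNReal.ofReal |f x|) (Q : Cube n) :
    wavg u f Q = (∫⁻ x in Q.toSet, F x * U x) / ∫⁻ x in Q.toSet, U x := by
  rw [wavg]
  congr 1
  · refine lintegral_congr_ae (ae_restrict_of_ae ?_)
    filter_upwards [hF, hU] with x h1 h2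
    rw [h1, h2, ENNReal.ofReal_mul (abs_nonneg _)]
  · exact (lintegral_congr_ae (ae_restrict_of_ae hU)).symm

/-- The two consequences of the `A_p(u)` condition that are used: the mass comparison, and local
integrability of `u v`. -/
theorem apBound_and_isCubeWeight (hu : IsWeight u) (hv : IsWeight v)
    (hU : U =ᵐ[volume] fun x => ENNReal.ofReal (u x))
    (hV : V =ᵐ[volume] fun x => ENNReal.ofReal (v x)) (hY : ∀ x, Y x = U x * V x)
    {p : ℝ} (hp : 1 ≤ p) (hfin : apConst p u v ≠ ⊤) :
    ApBound p (apConst p u v) U Y ∧ IsCubeWeight Y := by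
  obtain rfl : Y = fun x => U x * V x := funext hY
  have hUm := (hu.isCubeWeight hU).aemeasurable
  have hVm := (hv.isCubeWeight hV).aemeasurable
  have hUw := hu.isCubeWeight hU
  have hU0 : ∀ᵐ x, U x ≠ 0 := by
    filter_upwards [hu.2, hU] with x hx hxU
    rw [hxU]; simpa using hx
  have hV0 : ∀ᵐ x, V x ≠ 0 := by
    filter_upwards [hv.2, hV] with x hx hxV
    rw [hxV]; simpa using hx
  have hVt : ∀ᵐ x, V x ≠ ⊤ := by
    filter_upwards [hV] with x hxV
    rw [hxV]; exact ENNReal.ofReal_ne_top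
  have hYm : AEMeasurable fun x => U x * V x := hUm.mul hVm
  have hY0 := setLIntegral_ne_zero_of_ae hYm
    (by filter_upwards [hU0, hV0] with x h1 h2 using mul_ne_zero h1 h2)
  have hVabs : V =ᵐ[volume] fun x => ENNReal.ofReal |v x| := by
    filter_upwards [hv.2, hV] with x hx hxV
    rw [hxV, abs_of_pos hx]
  have hwv : ∀ Q, wavg u v Q = (∫⁻ x in Q.toSet, U x * V x) / ∫⁻ x in Q.toSet, U x := fun Q => by
    rw [wavg_eq hU hVabs]
    simp only [mul_comm (V _)]
  have hp0 : 0 < p := by linarith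
  have hUp0 : ∀ Q : Cube n, (∫⁻ x in Q.toSet, U x) ^ p ≠ 0 := fun Q => by
    simp [ENNReal.rpow_eq_zero_iff, hUw.ne_zero, hUw.ne_top]
  have hUpt : ∀ Q : Cube n, (∫⁻ x in Q.toSet, U x) ^ p ≠ ⊤ := fun Q =>
    ENNReal.rpow_ne_top_of_nonneg hp0.le (hUw.ne_top _)
  rcases hp.eq_or_lt with rfl | hp1
  · set c := apConst 1 u v with hc
    have hc' : c = essSup (fun x => maximal u v x / ENNReal.ofReal (v x)) volume := by
      rw [hc, apConst, if_pos rfl]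
    -- One null set serves all cubes, because the essential supremum is taken of the full maximal
    -- function.
    have hae : ∀ᵐ x, ∀ Q : Cube n, x ∈ Q.toSet →
        (∫⁻ x in Q.toSet, U x * V x) / ∫⁻ x in Q.toSet, U x ≤ c * V x := by
      filter_upwards [ENNReal.ae_le_essSup
        (fun x => maximal u v x / ENNReal.ofReal (v x)), hv.2, hV] with x hx hx0 hxV Q hxQ
      rw [← hwv, hxV]
      rw [← hc', ENNReal.div_le_iff_le_mul (Or.inl (by simpa using hx0))
        (Or.inl ENNReal.ofReal_ne_top)] at hx
      exact (le_iSup₂ (f := fun (Q : Cube n) (_ : x ∈ Q.toSet) => wavg u v Q) Q hxQ).trans hx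
    refine ⟨fun Q E hE hEQ => ?_, hYm, hY0, fun Q htop => ?_⟩
    · rw [ENNReal.rpow_one, ENNReal.rpow_one]
      have h1 : (∫⁻ x in Q.toSet, U x * V x) / (∫⁻ x in Q.toSet, U x) * ∫⁻ x in E, U x ≤
          c * ∫⁻ x in E, U x * V x := by
        rw [← lintegral_const_mul'' _ hUm.restrict, ← lintegral_const_mul'' _ hYm.restrict]
        refine setLIntegral_mono_ae' hE ?_
        filter_upwards [hae] with x hx hxE
        calc _ ≤ c * V x * U x := mul_le_mul_left (hx Q (hEQ hxE)) _
          _ = _ := by ring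
      calc (∫⁻ x in E, U x) * ∫⁻ x in Q.toSet, U x * V x
          = (∫⁻ x in E, U x) * (((∫⁻ x in Q.toSet, U x * V x) / ∫⁻ x in Q.toSet, U x) *
            ∫⁻ x in Q.toSet, U x) := by
            rw [ENNReal.div_mul_cancel (hUw.ne_zero Q) (hUw.ne_top Q)]
        _ = ((∫⁻ x in Q.toSet, U x * V x) / (∫⁻ x in Q.toSet, U x) * ∫⁻ x in E, U x) *
            ∫⁻ x in Q.toSet, U x := by ring
        _ ≤ _ := mul_le_mul_left h1 _
    · have h1 : ∀ᵐ x ∂volume.restrict Q.toSet, False := by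
        filter_upwards [ae_restrict_of_ae hae, ae_restrict_of_ae hVt,
          ae_restrict_mem Q.measurableSet] with x hx hxt hxQ
        have h2 := hx Q hxQ
        rw [htop, ENNReal.top_div_of_ne_top (hUw.ne_top Q)] at h2
        exact ENNReal.mul_ne_top hfin hxt (top_le_iff.1 h2)
      rw [ae_iff] at h1
      simp only [not_false_eq_true, ofPred_true, Measure.restrict_apply_univ] at h1
      exact Q.volume_pos h1
  · have hp2 : 0 < p - 1 := by linarith
    set c := apConst p u v with hc
    have hVp : (fun x => V x ^ (-(1 / (p - 1)))) =ᵐ[volume]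
        fun x => ENNReal.ofReal |v x ^ (-(1 / (p - 1)))| := by
      filter_upwards [hv.2, hV] with x hx hxV
      rw [hxV, abs_of_pos (Real.rpow_pos_of_pos hx _), ENNReal.ofReal_rpow_of_pos hx]
    have hcQ : ∀ Q : Cube n, (∫⁻ x in Q.toSet, U x * V x) / (∫⁻ x in Q.toSet, U x) *
        ((∫⁻ x in Q.toSet, V x ^ (-(1 / (p - 1))) * U x) / ∫⁻ x in Q.toSet, U x) ^ (p - 1) ≤ c := by
      intro Q
      rw [← hwv, ← wavg_eq hU hVp, hc, apConst, if_neg hp1.ne']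
      exact le_iSup (fun Q : Cube n =>
        wavg u v Q * wavg u (fun x => v x ^ (-(1 / (p - 1)))) Q ^ (p - 1)) Q
    have hZ0 := setLIntegral_ne_zero_of_ae (f := fun x => V x ^ (-(1 / (p - 1))) * U x)
      ((hVm.pow_const _).mul hUm) (by
        filter_upwards [hU0, hV0, hVt] with x h1 h2 h3
        exact mul_ne_zero (by simp [ENNReal.rpow_eq_zero_iff, h2, h3]) h1)
    refine ⟨fun Q E hE hEQ => ?_, hYm, hY0, fun Q htop => ?_⟩
    · have h1 := lintegral_rpow_mul_le hp1 hUm hVm hV0 hVt hEQ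
      have h2 := hcQ Q
      set X := ∫⁻ x in Q.toSet, U x * V x
      set Z := ∫⁻ x in Q.toSet, V x ^ (-(1 / (p - 1))) * U x
      set I := ∫⁻ x in Q.toSet, U x with hI
      have h3 : X * Z ^ (p - 1) ≤ c * I ^ p := by
        have e : X / I * (Z / I) ^ (p - 1) = X * Z ^ (p - 1) / I ^ p := by
          rw [ENNReal.div_rpow_of_nonneg _ _ hp2.le, div_eq_mul_inv, div_eq_mul_inv, div_eq_mul_inv]
          have : I ^ p = I * I ^ (p - 1) := by
            nth_rewrite 2 [← ENNReal.rpow_one I]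
            rw [← ENNReal.rpow_add_of_nonneg _ _ zero_le_one hp2.le]
            ring_nf
          rw [this, ENNReal.mul_inv (Or.inl (hUw.ne_zero Q)) (Or.inl (hUw.ne_top Q))]
          ring
        rw [e, ENNReal.div_le_iff (hUp0 Q) (hUpt Q)] at h2
        exact h2
      calc (∫⁻ x in E, U x) ^ p * X ≤ (∫⁻ x in E, U x * V x) * Z ^ (p - 1) * X :=
            mul_le_mul_left h1 _
        _ = (∫⁻ x in E, U x * V x) * (X * Z ^ (p - 1)) := by ring
        _ ≤ (∫⁻ x in E, U x * V x) * (c * I ^ p) := mul_le_mul_right h3 _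
        _ = _ := by ring
    -- The dual average is positive, so infinite mass of $uv$ on one cube would make the $A_p(u)$
    -- constant infinite.
    · have h2 := hcQ Q
      rw [htop, ENNReal.top_div_of_ne_top (hUw.ne_top Q), ENNReal.top_mul] at h2
      · exact hfin (top_le_iff.1 h2)
      · have h3 : (∫⁻ x in Q.toSet, V x ^ (-(1 / (p - 1))) * U x) / ∫⁻ x in Q.toSet, U x ≠ 0 :=
          ENNReal.div_ne_zero.2 ⟨hZ0 Q, hUw.ne_top Q⟩
        intro h4
        rcases ENNReal.rpow_eq_zero_iff.1 h4 with h5 | h5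
        · exact h3 h5.1
        · linarith

end

section

variable {n : ℕ} {u v : (Fin n → ℝ) → ℝ}

/-! ### The mixed weak type estimate for a majorized Young function -/

/-- The bound passes to a measurable version of $T(F)$, and enlarging `c` allows the constant to be
taken at least 1. -/
theorem SparseBound.sparseBoundAt {A : ℝ → ℝ} {c c' η : ℝ} {dom : Set ((Fin n → ℝ) → ℝ)}
    {T : ((Fin n → ℝ) → ℝ) → ((Fin n → ℝ) → ℝ)} (hT : SparseBound A c η dom T)
    {F t : (Fin n → ℝ) → ℝ} (hF : F ∈ dom) (hc : c ≤ c') (ht : T F =ᵐ[volume] t) :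
    SparseBoundAt A c' η (fun x => ENNReal.ofReal |F x|) t := by
  intro g hg hgb hgc hint
  have e : (fun x => T F x * g x) =ᵐ[volume] fun x => t x * g x := by
    filter_upwards [ht] with x hx
    rw [hx]
  obtain ⟨D, S, hDS, h⟩ := (hT F hF).2 g hg hgb hgc (hint.congr e.symm)
  refine ⟨D, S, hDS, ?_⟩
  rw [integral_congr_ae e] at h
  simp only [wavg_one] at h
  exact h.trans (mul_le_mul_left (ENNReal.ofReal_le_ofReal hc) _)

/-! ### The $A_\infty$ constants of $u^r$ and $uv$. -/

theorem IsWeight.ainfConst_rpow_eq (hu : IsWeight u) {U : (Fin n → ℝ) → ℝ≥0∞}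
    (hU : U =ᵐ[volume] fun x => ENNReal.ofReal (u x)) (r : ℝ) :
    ainfConst (fun x => u x ^ r) = ainf fun x => U x ^ r := by
  refine ainfConst_eq ?_ ?_
  · filter_upwards [hu.2] with x hx using Real.rpow_pos_of_pos hx r
  · filter_upwards [hu.2, hU] with x hx hxU
    rw [hxU, ENNReal.ofReal_rpow_of_pos hx]

theorem IsWeight.ainfConst_mul_eq (hu : IsWeight u) (hv : IsWeight v)
    {U V : (Fin n → ℝ) → ℝ≥0∞} (hU : U =ᵐ[volume] fun x => ENNReal.ofReal (u x))
    (hV : V =ᵐ[volume] fun x => ENNReal.ofReal (v x)) :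
    ainfConst (fun x => u x * v x) = ainf fun x => U x * V x := by
  refine ainfConst_eq ?_ ?_
  · filter_upwards [hu.2, hv.2] with x hx hy using mul_pos hx hy
  · filter_upwards [hu.2, hU, hV] with x hx hxU hxV
    rw [hxU, hxV, ENNReal.ofReal_mul hx.le]

theorem one_le_ainfConst_rpow {r : ℝ} (hr : 1 ≤ r) (hu : IsWeight u)
    (hh : rhConst (2 * r - 1) u < ⊤) : 1 ≤ ainfConst fun x => u x ^ r := by
  rw [hu.ainfConst_rpow_eq EventuallyEq.rfl]
  exact ((hu.rhBound EventuallyEq.rfl (by linarith)).isCubeWeight_rpow hr (by linarith) hh.ne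
    (hu.isCubeWeight EventuallyEq.rfl)).one_le_ainf

theorem exists_ainfConst_rpow_le (n : ℕ) {r : ℝ} (hr : 1 ≤ r) :
    ∃ C : ℝ, 1 ≤ C ∧ ∀ u : (Fin n → ℝ) → ℝ, IsWeight u → rhConst (2 * r - 1) u < ⊤ →
      ainfConst (fun x => u x ^ r) ≤ ENNReal.ofReal C * (rhConst (2 * r - 1) u * a1Const u) := by
  obtain ⟨C, hC1, hC⟩ := exists_ainf_rpow_le n hr
  refine ⟨C, hC1, fun u hu hh => ?_⟩
  rw [hu.ainfConst_rpow_eq EventuallyEq.rfl]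
  exact hC _ _ _ (hu.isCubeWeight EventuallyEq.rfl) (hu.a1Bound EventuallyEq.rfl)
    (hu.rhBound EventuallyEq.rfl (by linarith)) hh.ne

theorem ainfConst_rpow_lt_top {r : ℝ} (hr : 1 ≤ r) (hu : IsWeight u) (ha : a1Const u < ⊤)
    (hh : rhConst (2 * r - 1) u < ⊤) : ainfConst (fun x => u x ^ r) < ⊤ := by
  obtain ⟨C, _, hC⟩ := exists_ainfConst_rpow_le n hr
  exact (hC u hu hh).trans_lt (ENNReal.mul_lt_top ENNReal.ofReal_lt_top (ENNReal.mul_lt_top hh ha))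

theorem one_le_toReal_ainfConst_rpow {r : ℝ} (hr : 1 ≤ r) (hu : IsWeight u) (ha : a1Const u < ⊤)
    (hh : rhConst (2 * r - 1) u < ⊤) : 1 ≤ (ainfConst fun x => u x ^ r).toReal := by
  rw [← ENNReal.ofReal_le_iff_le_toReal (ainfConst_rpow_lt_top hr hu ha hh).ne, ENNReal.ofReal_one]
  exact one_le_ainfConst_rpow hr hu hh

theorem ainfConst_mul_lt_top (hn : 1 ≤ n) {p : ℝ} (hp : 1 ≤ p) (hu : IsWeight u) (hv : IsWeight v)
    (ha : a1Const u < ⊤) (hV : apConst p u v < ⊤) : ainfConst (fun x => u x * v x) < ⊤ := by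
  rw [hu.ainfConst_mul_eq hv EventuallyEq.rfl EventuallyEq.rfl]
  obtain ⟨h1, h2⟩ := apBound_and_isCubeWeight hu hv EventuallyEq.rfl EventuallyEq.rfl
    (fun _ => rfl) hp hV.ne
  exact h1.ainf_lt_top hn hp (hu.isCubeWeight EventuallyEq.rfl) h2 (hu.a1Bound EventuallyEq.rfl)
    ha.ne hV.ne

/-- A measurable and nonnegative version of a weight. -/
theorem IsWeight.exists_measurable (hu : IsWeight u) : ∃ u₀ : (Fin n → ℝ) → ℝ, Measurable u₀ ∧
    (∀ x, 0 ≤ u₀ x) ∧ u₀ =ᵐ[volume] u := by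
  refine ⟨fun x => max (hu.aemeasurable.mk u x) 0, hu.aemeasurable.measurable_mk.max
    measurable_const, fun x => le_max_right _ _, ?_⟩
  filter_upwards [hu.2, hu.aemeasurable.ae_eq_mk] with x hx hxe
  rw [← hxe, max_eq_left hx.le]

/-- The function `A` enters only through its majorant, so `C` depends on it through `b` alone; both
cases of the theorem follow by different choices of `κ`. -/
theorem exists_mixedWeakType (hn : 1 ≤ n) {p r b cT η : ℝ} (hp : 1 ≤ p) (hr : 1 ≤ r) (hb : 0 ≤ b)
    (hη : 0 < η) (hη1 : η ≤ 1) :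
    ∃ C : ℝ, 0 < C ∧ ∀ (A : ℝ → ℝ) (κ : ℝ) (dom : Set ((Fin n → ℝ) → ℝ))
      (T : ((Fin n → ℝ) → ℝ) → ((Fin n → ℝ) → ℝ)), SparseBound A cT η dom T →
      ∀ u v : (Fin n → ℝ) → ℝ, IsWeight u → IsWeight v →
        a1Const u < ⊤ → rhConst (2 * r - 1) u < ⊤ → apConst p u v < ⊤ → 1 ≤ κ →
        (∀ x, 0 ≤ x → A x ≤ κ ^ r * x ^ expo (8 * (n + 1)) r u + b * x) →
        MixedWeakType (C * mixedConst p r κ u v) dom T u v := by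
  -- Since $\delta\le1$ below, $\theta r(1+\delta/2)\le\frac16\cdot\frac32=\frac14$; thus `θ` does
  -- not depend on the weights.
  set θ : ℝ := 1 / (6 * r) with hθ
  have hr0 : 0 < r := by linarith
  have hp0 : 0 < p := by linarith
  have hθ0 : 0 < θ := by positivity
  obtain ⟨C, hC0, hC⟩ := exists_mixed_const_le n (p := p) (b := b) (cT := max 1 cT) (η := η)
    (β := θ / p) hp hb (le_max_left _ _) hη hη1 (by positivity)
  refine ⟨C, hC0, fun A κ dom T hT u v hu hv ha hh hV hκ hA => ?_⟩
  intro f hf hfv l hl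
  obtain ⟨u₀, hu₀m, hu₀0, hu₀⟩ := hu.exists_measurable
  obtain ⟨v₀, hv₀m, hv₀0, hv₀⟩ := hv.exists_measurable
  set U : (Fin n → ℝ) → ℝ≥0∞ := fun x => ENNReal.ofReal |u₀ x| with hU
  set V : (Fin n → ℝ) → ℝ≥0∞ := fun x => ENNReal.ofReal (v₀ x) with hVd
  have hUe : U =ᵐ[volume] fun x => ENNReal.ofReal (u x) := by
    filter_upwards [hu₀] with x hx
    rw [hU]
    simp only
    rw [abs_of_nonneg (hu₀0 x), hx]
  have hVe : V =ᵐ[volume] fun x => ENNReal.ofReal (v x) := by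
    filter_upwards [hv₀] with x hx
    rw [hVd]
    simp only
    rw [hx]
  set Y : (Fin n → ℝ) → ℝ≥0∞ := fun x => U x * V x with hY
  obtain ⟨hAp, hYw⟩ := apBound_and_isCubeWeight hu hv hUe hVe (Y := Y) (fun _ => rfl) hp hV.ne
  have hUw := hu.isCubeWeight hUe
  have hRH := hu.rhBound hUe (q := 2 * r - 1) (by linarith)
  have hA1 := hu.a1Bound hUe
  have hM := ainfConst_mul_lt_top hn hp hu hv ha hV
  have hMY : ainf Y = ainfConst fun x => u x * v x := (hu.ainfConst_mul_eq hv hUe hVe).symm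
  have hW1 := one_le_toReal_ainfConst_rpow hr hu ha hh
  have hWt := ainfConst_rpow_lt_top hr hu ha hh
  have hWU := hu.ainfConst_rpow_eq hUe r
  have hWw := hRH.isCubeWeight_rpow hr (by linarith) hh.ne hUw
  have one_le : ∀ {x : ℝ≥0∞}, x < ⊤ → 1 ≤ x → 1 ≤ x.toReal := fun hx h1 => by
    rwa [← ENNReal.ofReal_le_iff_le_toReal hx.ne, ENNReal.ofReal_one]
  have ha1 := one_le ha (hA1.one_le hUw)
  have hh1 := one_le hh (hRH.one_le (by linarith) hUw)
  have hV1 := one_le hV (hAp.one_le hp hUw hYw)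
  have hM1 := one_le hM (hMY ▸ hYw.one_le_ainf)
  set W := (ainfConst fun x => u x ^ r).toReal with hW
  -- The weight $u^r$ satisfies `Decay` with $N=2W$, so $4(n+1)N\delta=1$, the limit allowed by
  -- `reverse_holder`. Then $\varepsilon=\delta/2$ for $\tau=8(n+1)$.
  set δ : ℝ := 1 / (8 * (n + 1) * W) with hδ
  have hn0 : (0 : ℝ) ≤ n := Nat.cast_nonneg n
  have hδ0 : 0 < δ := by positivity
  have hδ1 : δ ≤ 1 := by
    rw [hδ, div_le_one (by positivity)]
    nlinarith
  have hexp : expo (8 * (n + 1)) r u = r * (1 + δ / 2) := by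
    rw [expo, ← hW, hδ]
    field_simp
  rw [hexp] at hA
  have hdec : Decay (ENNReal.ofReal (2 * W)) fun x => U x ^ r := by
    have := hWw.decay
    rwa [← hWU, ← ENNReal.ofReal_toReal hWt.ne, ← hW, show (2 : ℝ≥0∞) = ENNReal.ofReal 2 by simp,
      ← ENNReal.ofReal_mul (by norm_num)] at this
  have hI := hWw.reverse_holder hn (N := 2 * W) (by linarith) hdec hδ0 (by
    rw [hδ]; field_simp; norm_num)
  have hθr : θ * (r * (1 + δ / 2)) ≤ 1 / 4 := by
    rw [hθ]; field_simp; linarith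
  set F : (Fin n → ℝ) → ℝ := fun x => f x * v x with hF
  have hFm : AEMeasurable F := hf.mul hv.aemeasurable
  set H : (Fin n → ℝ) → ℝ≥0∞ := fun x => ENNReal.ofReal |F x| with hH
  have hHm : AEMeasurable H := (continuous_abs.measurable.comp_aemeasurable hFm).ennreal_ofReal
  have hTm := (hT F hfv).1
  set t := hTm.mk (T F) with ht
  have hsp := hT.sparseBoundAt hfv (le_max_right 1 cT) hTm.ae_eq_mk
  have hl0 : ENNReal.ofReal l ≠ 0 := by simpa using hl
  have hR : ∫⁻ x, ENNReal.ofReal (|f x| / l * (u x * v x)) =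
      (∫⁻ x, H x * U x) / ENNReal.ofReal l := by
    rw [div_eq_mul_inv, ← lintegral_mul_const' _ _ (ENNReal.inv_ne_top.2 hl0)]
    refine lintegral_congr_ae ?_
    filter_upwards [hu.2, hv.2, hUe] with x hx hy hxU
    rw [hxU, hH]
    simp only
    rw [← ENNReal.ofReal_mul (abs_nonneg _), ← div_eq_mul_inv, ← ENNReal.ofReal_div_of_pos hl, hF]
    simp only
    rw [abs_mul, abs_of_pos hy]
    congr 1
    ring
  have hd : (volume.withDensity fun x => ENNReal.ofReal (u x * v x)) = volume.withDensity Y := by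
    refine withDensity_congr_ae ?_
    filter_upwards [hu.2, hUe, hVe] with x hx hxU hxV
    rw [hY]
    simp only
    rw [hxU, hxV, ENNReal.ofReal_mul hx.le]
  have hset : (volume.withDensity Y) {x | l < T F x / v x} =
      (volume.withDensity Y) {x | l * v₀ x < t x} := by
    refine measure_congr ((withDensity_absolutelyContinuous volume Y).ae_le ?_)
    filter_upwards [hv.2, hv₀, hTm.ae_eq_mk] with x hx hxv hxt
    refine propext ?_
    change l < T F x / v x ↔ l * v₀ x < t x
    rw [lt_div_iff₀ hx, hxv, hxt]
  -- The argument produces only the first power of $[u]_{RH_q}\ge1$; the exponent $1+q/(4r)$ is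
  -- larger.
  have h' : (rhConst (2 * r - 1) u).toReal ≤
      (rhConst (2 * r - 1) u).toReal ^ (1 + (2 * r - 1) / (4 * r)) := by
    refine Real.self_le_rpow_of_one_le hh1 ?_
    have : 0 ≤ (2 * r - 1) / (4 * r) := div_nonneg (by linarith) (by linarith)
    linarith
  have hCm := hC κ _ _ _ _ _ hκ hh1 h' ha1 hM1 hV1
  have hmix : (0 : ℝ) < C * mixedConst p r κ u v := by
    refine mul_pos hC0 ?_
    simp only [mixedConst]
    have h1 : 0 < κ * (rhConst (2 * r - 1) u).toReal ^ (1 + (2 * r - 1) / (4 * r)) *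
        (a1Const u).toReal * (ainfConst fun x => u x * v x).toReal := by positivity
    refine mul_pos h1 (Real.log_pos ?_)
    have := mul_pos h1 (zero_lt_one.trans_le hV1)
    have := Real.add_one_lt_exp one_ne_zero
    linarith
  rw [hR, hd, hset]
  by_cases hHU : ∫⁻ x, H x * U x = ⊤
  · rw [hHU, ENNReal.top_div_of_ne_top ENNReal.ofReal_ne_top, ENNReal.mul_top (by simpa using hmix)]
    exact le_top
  refine (weak_type_of_sparseBoundAt hn hp hr hκ hb (le_max_left 1 cT) hη hη1 hδ0 hθ0 hθr hA hu₀m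
    hv₀m hTm.measurable_mk hu₀0 hv₀0 (fun _ => rfl) (fun _ => rfl) hUw hYw ha1
    (by rwa [ENNReal.ofReal_toReal ha.ne]) hh1 (by rwa [ENNReal.ofReal_toReal hh.ne]) hV1
    (by rwa [ENNReal.ofReal_toReal hV.ne]) hM1 (by rw [ENNReal.ofReal_toReal hM.ne, hMY]) hI hHm
    hHU hsp hl).trans ?_
  exact mul_le_mul_left (ENNReal.ofReal_le_ofReal hCm) _

end

section

variable {n : ℕ} {u v : (Fin n → ℝ) → ℝ}

/-! ### Young functions and the constants of the estimate -/

theorem MixedWeakType.mono {C C' : ℝ} {dom : Set ((Fin n → ℝ) → ℝ)}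
    {T : ((Fin n → ℝ) → ℝ) → ((Fin n → ℝ) → ℝ)} (h : MixedWeakType C dom T u v) (hC : C ≤ C') :
    MixedWeakType C' dom T u v := fun f hf hfv l hl =>
  (h f hf hfv l hl).trans (mul_le_mul_left (ENNReal.ofReal_le_ofReal hC) _)

/-- A factor `k` inside the logarithm costs only $1+\log k$, because the logarithm is at least 1.
Constants may thus be moved out of `κ`. -/
theorem mixedConst_le (p r : ℝ) {κ κ' k : ℝ} (hκ : 0 ≤ κ) (hκ' : 0 ≤ κ') (hk : 1 ≤ k)
    (h : κ ≤ k * κ') (u v : (Fin n → ℝ) → ℝ) :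
    mixedConst p r κ u v ≤ k * (1 + Real.log k) * mixedConst p r κ' u v := by
  simp only [mixedConst]
  have hV : 0 ≤ (apConst p u v).toReal := ENNReal.toReal_nonneg
  generalize (apConst p u v).toReal = V at hV
  set m := (rhConst (2 * r - 1) u).toReal ^ (1 + (2 * r - 1) / (4 * r)) * (a1Const u).toReal *
    (ainfConst fun x => u x * v x).toReal with hm
  have hm0 : 0 ≤ m := by positivity
  have e : ∀ κ : ℝ, κ * (rhConst (2 * r - 1) u).toReal ^ (1 + (2 * r - 1) / (4 * r)) *
      (a1Const u).toReal * (ainfConst fun x => u x * v x).toReal = κ * m := fun κ => by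
    rw [hm]; ring
  rw [e, e]
  have he : 1 ≤ Real.exp 1 := by linarith [Real.add_one_le_exp (1 : ℝ)]
  have hK : κ * m ≤ k * (κ' * m) := by
    have := mul_le_mul_of_nonneg_right h hm0
    linarith
  have hK0 : 0 ≤ κ' * m := by positivity
  have hlk : 0 ≤ Real.log k := Real.log_nonneg hk
  have hl1 : 1 ≤ Real.log (Real.exp 1 + κ' * m * V) := by
    rw [Real.le_log_iff_exp_le (by positivity)]
    have : 0 ≤ κ' * m * V := by positivity
    linarith
  have hl : Real.log (Real.exp 1 + κ * m * V) ≤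
      (1 + Real.log k) * Real.log (Real.exp 1 + κ' * m * V) := by
    have h1 : Real.log (Real.exp 1 + κ * m * V) ≤
        Real.log (k * (Real.exp 1 + κ' * m * V)) := by
      refine Real.log_le_log (by positivity) ?_
      have := mul_le_mul_of_nonneg_right hK hV
      nlinarith
    rw [Real.log_mul (by linarith) (by positivity)] at h1
    nlinarith
  have hl0 : 0 ≤ Real.log (Real.exp 1 + κ * m * V) :=
    Real.log_nonneg (by have : 0 ≤ κ * m * V := by positivity
                        linarith)
  calc κ * m * Real.log (Real.exp 1 + κ * m * V)
      ≤ k * (κ' * m) * ((1 + Real.log k) * Real.log (Real.exp 1 + κ' * m * V)) :=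
        mul_le_mul hK hl hl0 (by positivity)
    _ = _ := by ring

theorem IsYoung.nonneg {A : ℝ → ℝ} (hA : IsYoung A) {x : ℝ} (hx : 0 ≤ x) : 0 ≤ A x :=
  hA.2.2.1 ▸ hA.2.1 (mem_Ici.2 le_rfl) hx hx

theorem IsYoung.le_mul {A : ℝ → ℝ} (hA : IsYoung A) {x : ℝ} (hx : 0 ≤ x) (hx1 : x ≤ 1) :
    A x ≤ A 1 * x := by
  have h := hA.1.2 (mem_Ici.2 le_rfl) (mem_Ici.2 zero_le_one) (sub_nonneg.2 hx1) hx (by ring)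
  simp only [smul_eq_mul, mul_zero, mul_one, zero_add, hA.2.2.1] at h
  linarith

/-- Since `A` is monotone, the $B_s$ integral over $(t,2t]$ alone dominates a fixed multiple of
$A(t)/t^s$. -/
theorem IsYoung.growth_lt_top {A : ℝ → ℝ} (hA : IsYoung A) {s : ℝ} (hs : 0 ≤ s)
    (hB : MemB s A) : growth A s < ⊤ := by
  set I := ∫ t in Ioi (1 : ℝ), A t / t ^ s / t with hI
  have key : ∀ t : ℝ, 1 ≤ t → A t / t ^ s ≤ 2 * 2 ^ s * I := by
    intro t ht
    have ht0 : 0 < t := by linarith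
    have hsub : Ioc t (2 * t) ⊆ Ioi 1 := fun x hx => lt_of_le_of_lt ht hx.1
    have h1 : ∫ x in Ioc t (2 * t), A x / x ^ s / x ≤ I := by
      refine setIntegral_mono_set hB ?_ hsub.eventuallyLE
      filter_upwards [ae_restrict_mem measurableSet_Ioi] with x hx
      have hx0 : (0 : ℝ) ≤ x := zero_le_one.trans (le_of_lt hx)
      exact div_nonneg (div_nonneg (hA.nonneg hx0) (Real.rpow_nonneg hx0 _)) hx0
    have h2 : A t / (2 * t) ^ s / (2 * t) * volume.real (Ioc t (2 * t)) ≤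
        ∫ x in Ioc t (2 * t), A x / x ^ s / x := by
      refine setIntegral_ge_of_const_le_real measurableSet_Ioc (by simp) (fun x hx => ?_)
        (hB.mono_set hsub)
      have hx0 : 0 < x := ht0.trans hx.1
      have h3 : A t ≤ A x := hA.2.1 ht0.le hx0.le hx.1.le
      have h4 := hA.nonneg ht0.le
      have h5 := hA.nonneg hx0.le
      have h6 : x ^ s ≤ (2 * t) ^ s := Real.rpow_le_rpow hx0.le hx.2 hs
      exact div_le_div₀ (by positivity) (div_le_div₀ h5 h3 (by positivity) h6) hx0 hx.2
    rw [Real.volume_real_Ioc_of_le (by linarith), Real.mul_rpow (by norm_num) ht0.le] at h2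
    have h7 : A t / t ^ s = 2 * 2 ^ s * (A t / (2 ^ s * t ^ s) / (2 * t) * (2 * t - t)) := by
      field_simp
      ring
    rw [h7]
    exact mul_le_mul_of_nonneg_left (h2.trans h1) (by positivity)
  exact (iSup₂_le fun t ht => ENNReal.ofReal_le_ofReal (key t ht)).trans_lt ENNReal.ofReal_lt_top

theorem le_growth_mul {A : ℝ → ℝ} {s x : ℝ} (hg : growth A s < ⊤) (hx : 1 ≤ x) :
    A x ≤ (growth A s).toReal * x ^ s := by
  have hx0 : 0 < x := by linarith
  rw [← div_le_iff₀ (by positivity)]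
  have h : ENNReal.ofReal (A x / x ^ s) ≤ growth A s :=
    le_iSup₂ (f := fun (t : ℝ) (_ : 1 ≤ t) => ENNReal.ofReal (A t / t ^ s)) x hx
  rwa [ENNReal.ofReal_le_iff_le_toReal hg.ne] at h

theorem one_add_log_rpow_le {x γ c : ℝ} (hx : 1 ≤ x) (hγ : 0 ≤ γ) (hc : 0 < c) :
    (1 + Real.log x) ^ γ ≤ (1 + γ / c) ^ γ * x ^ c := by
  rcases hγ.eq_or_lt with rfl | hγ
  · simpa using Real.one_le_rpow hx hc.le
  have hx0 : 0 < x := by linarith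
  have hσ : 0 < c / γ := by positivity
  have hl : 0 ≤ Real.log x := Real.log_nonneg hx
  have h1 : 1 + Real.log x ≤ (1 + γ / c) * x ^ (c / γ) := by
    have h2 := Real.log_le_rpow_div hx0.le hσ
    have h3 : 1 ≤ x ^ (c / γ) := Real.one_le_rpow hx hσ.le
    have h4 : x ^ (c / γ) / (c / γ) = γ / c * x ^ (c / γ) := by field_simp
    linarith
  refine (Real.rpow_le_rpow (by linarith) h1 hγ.le).trans (le_of_eq ?_)
  rw [Real.mul_rpow (by positivity) (by positivity), ← Real.rpow_mul hx0.le,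
    div_mul_cancel₀ _ hγ.ne']

/-- Trading the logarithm for a power $x^c$ costs $(1+\gamma/c)^\gamma$. With
$c=r\varepsilon\sim1/[u^r]_{A_\infty}$ this is of order $[u^r]_{A_\infty}^\gamma$, hence
$\kappa_u=[u^r]_{A_\infty}^{\gamma/r}$. -/
theorem powLog_le {r γ c x : ℝ} (hr : 1 ≤ r) (hγ : 0 ≤ γ) (hc : 0 < c) (hx : 0 ≤ x) :
    powLog r γ x ≤ (1 + γ / c) ^ γ * x ^ (r + c) + x := by
  rcases le_total x 1 with h | h
  · have h1 : Real.posLog x = 0 := by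
      rw [Real.posLog_eq_zero_iff, abs_of_nonneg hx]; exact h
    have h2 : x ^ r ≤ x := by
      rcases hx.eq_or_lt with rfl | hx0
      · rw [Real.zero_rpow (by linarith)]
      · simpa using Real.rpow_le_rpow_of_exponent_ge hx0 h hr
    have h3 : 0 ≤ (1 + γ / c) ^ γ * x ^ (r + c) := by positivity
    rw [powLog, h1, add_zero, Real.one_rpow, mul_one]
    linarith
  · have hx0 : 0 < x := by linarith
    have h1 : Real.posLog x = Real.log x := Real.posLog_eq_log (by rwa [abs_of_nonneg hx])
    rw [powLog, h1, Real.rpow_add hx0]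
    have h2 := mul_le_mul_of_nonneg_left (one_add_log_rpow_le h hγ hc)
      (Real.rpow_nonneg hx r)
    nlinarith

theorem toReal_ainfConst_rpow_le (n : ℕ) {r γ : ℝ} (hr : 1 ≤ r) (hγ : 0 ≤ γ) :
    ∃ C : ℝ, 0 < C ∧ ∀ u : (Fin n → ℝ) → ℝ, IsWeight u → a1Const u < ⊤ →
      rhConst (2 * r - 1) u < ⊤ →
      (ainfConst (fun x => u x ^ r)).toReal ^ (γ / r) ≤
        C * ((rhConst (2 * r - 1) u).toReal ^ (γ / r) * (a1Const u).toReal ^ (γ / r)) := by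
  obtain ⟨C, hC1, hC⟩ := exists_ainfConst_rpow_le n hr
  have hC0 : 0 < C := by linarith
  refine ⟨C ^ (γ / r), by positivity, fun u hu ha hh => ?_⟩
  have h1 := ENNReal.toReal_mono (ENNReal.mul_ne_top ENNReal.ofReal_ne_top
    (ENNReal.mul_lt_top hh ha).ne) (hC u hu hh)
  rw [ENNReal.toReal_mul, ENNReal.toReal_mul, ENNReal.toReal_ofReal hC0.le] at h1
  have h2 := Real.rpow_le_rpow ENNReal.toReal_nonneg h1 (div_nonneg hγ (by linarith : 0 ≤ r))
  rwa [Real.mul_rpow hC0.le (by positivity),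
    Real.mul_rpow ENNReal.toReal_nonneg ENNReal.toReal_nonneg] at h2

theorem lt_expo {τ r : ℝ} (hτ : 0 < τ) (hr : 1 ≤ r)
    (hW : 1 ≤ (ainfConst fun x => u x ^ r).toReal) : r < expo τ r u := by
  have : 0 < 1 / (2 * τ * (ainfConst fun x => u x ^ r).toReal) := by positivity
  rw [expo]
  nlinarith

theorem expo_le {τ r : ℝ} (hτ : 0 < τ) (hr : 1 ≤ r)
    (hW : 1 ≤ (ainfConst fun x => u x ^ r).toReal) : expo τ r u ≤ r * (1 + 1 / (2 * τ)) := by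
  rw [expo]
  have : 1 / (2 * τ * (ainfConst fun x => u x ^ r).toReal) ≤ 1 / (2 * τ) :=
    one_div_le_one_div_of_le (by positivity) (le_mul_of_one_le_right (by positivity) hW)
  nlinarith

/-- The estimate is proved for $\max(1,\kappa_u)$. Some $t\ge1$ has $A(t)\ge1$, and the exponents
are bounded by $r(1+1/(2\tau))$ for all $u$, so $\kappa_u$ is bounded below uniformly and the
maximum can be dropped. -/
theorem IsYoung.exists_one_le_mul_kappa {A : ℝ → ℝ} (hA : IsYoung A) {τ r : ℝ} (hτ : 0 < τ)
    (hr : 1 ≤ r) :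
    ∃ k : ℝ, 1 ≤ k ∧ ∀ u : (Fin n → ℝ) → ℝ, 1 ≤ (ainfConst fun x => u x ^ r).toReal →
      growth A (expo τ r u) < ⊤ → 1 ≤ k * kappa τ r A u := by
  obtain ⟨t, ht1, ht⟩ := ((eventually_ge_atTop (1 : ℝ)).and
    (hA.2.2.2.eventually_ge_atTop 1)).exists
  have ht0 : 0 < t := by linarith
  have hr0 : 0 < r := by linarith
  set s := r * (1 + 1 / (2 * τ)) with hs
  refine ⟨(t ^ s) ^ (1 / r), Real.one_le_rpow (Real.one_le_rpow ht1 (by positivity))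
    (by positivity), fun u hW hg => ?_⟩
  have h1 := le_growth_mul hg ht1
  have h2 : t ^ expo τ r u ≤ t ^ s := Real.rpow_le_rpow_of_exponent_le ht1 (expo_le hτ hr hW)
  have h3 : 1 ≤ t ^ s * (growth A (expo τ r u)).toReal := by
    have := mul_le_mul_of_nonneg_left h2 (ENNReal.toReal_nonneg (a := growth A (expo τ r u)))
    linarith
  rw [kappa, ← Real.mul_rpow (by positivity) ENNReal.toReal_nonneg]
  exact Real.one_le_rpow h3 (by positivity)

/-- The linear term handles $x\le1$, by convexity, where the growth constant says nothing. -/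
theorem IsYoung.le_kappa_rpow_mul_add {A : ℝ → ℝ} (hA : IsYoung A) {τ r : ℝ} (hr : 1 ≤ r)
    (hg : growth A (expo τ r u) < ⊤) {x : ℝ} (hx : 0 ≤ x) :
    A x ≤ max 1 (kappa τ r A u) ^ r * x ^ expo τ r u + A 1 * x := by
  have hr0 : 0 < r := by linarith
  have hA1 : 0 ≤ A 1 * x := mul_nonneg (hA.nonneg zero_le_one) hx
  have hm : 0 ≤ max 1 (kappa τ r A u) ^ r * x ^ expo τ r u := by positivity
  rcases le_total x 1 with h | h
  · linarith [hA.le_mul hx h]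
  · have h1 : (growth A (expo τ r u)).toReal ≤ max 1 (kappa τ r A u) ^ r := by
      have h2 : (growth A (expo τ r u)).toReal = kappa τ r A u ^ r := by
        rw [kappa, ← Real.rpow_mul ENNReal.toReal_nonneg, one_div_mul_cancel hr0.ne', Real.rpow_one]
      rw [h2]
      exact Real.rpow_le_rpow (Real.rpow_nonneg ENNReal.toReal_nonneg _) (le_max_right _ _) hr0.le
    have h3 := mul_le_mul_of_nonneg_right h1 (Real.rpow_nonneg hx (expo τ r u))
    linarith [le_growth_mul hg h]

end

end MixedWeak

theorem theorem1p1 (n : ℕ) (hn : 1 ≤ n) :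
    ∃ τ : ℝ, 0 < τ ∧
      -- general Young functions
      (∀ (p r : ℝ), 1 ≤ p → 1 ≤ r →
        ∀ A : ℝ → ℝ, IsYoung A → (∀ ρ : ℝ, r < ρ → MemB ρ A) →
        ∀ (cT η : ℝ), 0 < cT → 0 < η → η ≤ 1 →
        ∃ C : ℝ, 0 < C ∧
          ∀ (dom : Set ((Fin n → ℝ) → ℝ)) (T : ((Fin n → ℝ) → ℝ) → ((Fin n → ℝ) → ℝ)),
            SparseBound A cT η dom T →
          ∀ u v : (Fin n → ℝ) → ℝ, IsWeight u → IsWeight v →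
            a1Const u < ⊤ → rhConst (2 * r - 1) u < ⊤ → apConst p u v < ⊤ →
            ainfConst (fun x => u x ^ r) < ⊤ ∧
            ainfConst (fun x => u x * v x) < ⊤ ∧
            growth A (expo τ r u) < ⊤ ∧
            MixedWeakType (C * mixedConst p r (kappa τ r A u) u v) dom T u v) ∧
      -- the functions `t ^ r (1 + log⁺ t) ^ γ`
      (∀ (p r γ : ℝ), 1 ≤ p → 1 ≤ r → 0 ≤ γ →
        ∀ (cT η : ℝ), 0 < cT → 0 < η → η ≤ 1 →
        ∃ C : ℝ, 0 < C ∧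
          ∀ (dom : Set ((Fin n → ℝ) → ℝ)) (T : ((Fin n → ℝ) → ℝ) → ((Fin n → ℝ) → ℝ)),
            SparseBound (powLog r γ) cT η dom T →
          ∀ u v : (Fin n → ℝ) → ℝ, IsWeight u → IsWeight v →
            a1Const u < ⊤ → rhConst (2 * r - 1) u < ⊤ → apConst p u v < ⊤ →
            MixedWeakType
              (C * mixedConst p r ((ainfConst (fun x => u x ^ r)).toReal ^ (γ / r)) u v)
              dom T u v) ∧
      (∀ (r γ : ℝ), 1 ≤ r → 0 ≤ γ →
        ∃ C : ℝ, 0 < C ∧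
          ∀ u : (Fin n → ℝ) → ℝ, IsWeight u →
            a1Const u < ⊤ → rhConst (2 * r - 1) u < ⊤ →
            (ainfConst (fun x => u x ^ r)).toReal ^ (γ / r) ≤
              C * ((rhConst (2 * r - 1) u).toReal ^ (γ / r) * (a1Const u).toReal ^ (γ / r))) := by
  have hτ : (0 : ℝ) < 8 * (n + 1) := by positivity
  refine ⟨8 * (n + 1), hτ, ?_, ?_, fun r γ hr hγ => toReal_ainfConst_rpow_le n hr hγ⟩
  · intro p r hp hr A hA hB cT η _ hη hη1
    obtain ⟨C, hC0, hC⟩ := exists_mixedWeakType (n := n) (cT := cT) hn hp hr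
      (hA.nonneg zero_le_one) hη hη1
    obtain ⟨k, hk1, hk⟩ := hA.exists_one_le_mul_kappa (n := n) hτ hr
    have hlk : 0 ≤ Real.log k := Real.log_nonneg hk1
    refine ⟨C * (k * (1 + Real.log k)), by positivity, fun dom T hT u v hu hv ha hh hV => ?_⟩
    have hW := one_le_toReal_ainfConst_rpow hr hu ha hh
    have hexp := lt_expo hτ hr hW
    have hg := hA.growth_lt_top (by linarith) (hB _ hexp)
    refine ⟨ainfConst_rpow_lt_top hr hu ha hh, ainfConst_mul_lt_top hn hp hu hv ha hV, hg, ?_⟩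
    have hκ0 : 0 ≤ kappa (8 * (n + 1)) r A u := Real.rpow_nonneg ENNReal.toReal_nonneg _
    refine (hC A (max 1 (kappa (8 * (n + 1)) r A u)) dom T hT u v hu hv ha hh hV (le_max_left _ _)
      fun x hx => hA.le_kappa_rpow_mul_add hr hg hx).mono ?_
    rw [mul_assoc C]
    refine mul_le_mul_of_nonneg_left (mixedConst_le p r (by positivity) hκ0 hk1 ?_ u v) hC0.le
    exact max_le (hk u hW hg) (le_mul_of_one_le_left hκ0 hk1)
  · intro p r γ hp hr hγ cT η _ hη hη1
    obtain ⟨C, hC0, hC⟩ := exists_mixedWeakType (n := n) (cT := cT) hn hp hr zero_le_one hη hη1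
    have hr0 : 0 < r := by linarith
    -- With $c=r\varepsilon=r/(2\tau W)$ one has $1+\gamma/c\le aW$ because $W\ge1$; so
    -- $\kappa=(aW)^{\gamma/r}$ is admissible, and $k=a^{\gamma/r}$ goes into the constant.
    set a : ℝ := 1 + 2 * (8 * (n + 1)) * γ / r with ha
    have ha1 : 1 ≤ a := by
      have : 0 ≤ 2 * (8 * (n + 1)) * γ / r := by positivity
      linarith
    set k := a ^ (γ / r) with hk
    have hk1 : 1 ≤ k := Real.one_le_rpow ha1 (by positivity)
    have hlk : 0 ≤ Real.log k := Real.log_nonneg hk1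
    refine ⟨C * (k * (1 + Real.log k)), by positivity, fun dom T hT u v hu hv h1 hh hV => ?_⟩
    have hW := one_le_toReal_ainfConst_rpow hr hu h1 hh
    set W := (ainfConst fun x => u x ^ r).toReal with hWd
    have hW0 : 0 < W := by linarith
    refine (hC (powLog r γ) (k * W ^ (γ / r)) dom T hT u v hu hv h1 hh hV
      (one_le_mul_of_one_le_of_one_le hk1 (Real.one_le_rpow hW (by positivity)))
      fun x hx => ?_).mono ?_
    · have h2 := powLog_le hr hγ (c := r / (2 * (8 * (n + 1)) * W)) (by positivity) hx
      have h3 : r + r / (2 * (8 * (n + 1)) * W) = expo (8 * (n + 1)) r u := by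
        rw [expo, ← hWd]; ring
      have h4 : (1 + γ / (r / (2 * (8 * (n + 1)) * W))) ^ γ ≤ (k * W ^ (γ / r)) ^ r := by
        rw [hk, ← Real.mul_rpow (by positivity) hW0.le, ← Real.rpow_mul (by positivity),
          div_mul_cancel₀ _ hr0.ne']
        refine Real.rpow_le_rpow (by positivity) ?_ hγ
        have h5 : γ / (r / (2 * (8 * (n + 1)) * W)) = 2 * (8 * (n + 1)) * γ / r * W := by
          field_simp
        rw [h5, ha]
        linarith
      rw [h3] at h2
      have h6 := mul_le_mul_of_nonneg_right h4 (Real.rpow_nonneg hx (expo (8 * (n + 1)) r u))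
      linarith
    · rw [mul_assoc C]
      exact mul_le_mul_of_nonneg_left (mixedConst_le p r (by positivity) (by positivity) hk1 le_rfl
        u v) hC0.le
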